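/- Let $n\ge 1$, $g\ge 2$, $G=SU(n)$ with Lie algebra $\mathfrak g=\mathfrak{su}(n)$, and let $\beta$ be a generator of the (cyclic) centre $Z(G)$. Fix an $\mathrm{Ad}$-invariant inner product $\,\cdot\,$ on $\mathfrak g$. Let $F$ be the free group on $x_1,\dots,x_{2g}$, let $R=\prod_{i=1}^g[x_{2i-1},x_{2i}]$ with $[a,b]=aba^{-1}b^{-1}$, identify $\mathrm{Hom}(F,G)=G^{2g}$, and let $\epsilon_R:G^{2g}\to G$, $\epsilon_R(h)=\prod_{i=1}^g[h_{2i-1},h_{2i}]$, be evaluation on $R$. Put $$Y_\beta=\epsilon_R^{-1}(\beta),\qquad \mathcal M_\beta=Y_\beta/G\ \text{ (conjugation action, quotient topology)},$$ $$X_\beta=\{(h,\Lambda)\in G^{2g}\times\mathfrak g:\ \epsilon_R(h)=\beta\exp(\Lambda)\},\qquad \mu=2\,\mathrm{pr}_2:X_\beta\to\mathfrak g,\ (h,\Lambda)\mapsto 2\Lambda .$$ Let $\theta,\bar\theta$ be the left- and right-invariant Maurer–Cartan forms of $G$, and let $\Omega=\theta_1\cdot\bar\theta_2\in\Omega^2(G^2)$,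 i.e. $\Omega(a,b)=\theta_1(a)\cdot\bar\theta_2(b)-\theta_1(b)\cdot\bar\theta_2(a)$, where $\theta_1,\bar\theta_2$ are the pull-backs of $\theta,\bar\theta$ from the first and second factor. Let $c=\sum_{i=1}^{2g}(\partial R/\partial x_i,x_i)$ be the $2$-chain on $F$ given by the Fox derivatives $\partial R/\partial x_i\in\mathbb Z[F]$ (with $(\,\cdot\,,x_i)$ extended $\mathbb Z$-linearly), and let $\omega=\langle c,E^*\Omega\rangle\in\Omega^2(G^{2g})$, that is $\omega=\sum_{u,v}c_{u,v}\,E_{(u,v)}^*\Omega$ for $c=\sum_{u,v} c_{u,v}\,(u,v)$, where $E_{(u,v)}:G^{2g}=\mathrm{Hom}(F,G)\to G^2$, $h\mapsto(h(u),h(v))$. Then: 1. $0$ is a regular value of $\mu$: the zero level $\mu^{-1}(0)$ has an open neighbourhood in $X_\beta$ which is an embedded smooth submanifold of $G^{2g}\times\mathfrak g$, and at each point of $\mu^{-1}(0)$ the differential of $\mu$ on the tangent space of this manifold is onto $\mathfrak g$. 2. $\mathcal M_\beta$ is a smooth manifold: it is Hausdorff and second countable, $Y_\beta$ is an embedded smooth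 submanifold of $G^{2g}$, and $\mathcal M_\beta$ has a smooth structure, compatible with the quotient topology, for which the quotient map $q:Y_\beta\to\mathcal M_\beta$ is a smooth submersion. 3. The restriction of $\omega$ to $Y_\beta$ descends to a smooth $2$-form $\bar\omega$ on $\mathcal M_\beta$, i.e. $q^*\bar\omega=\omega|_{Y_\beta}$, and $\bar\omega$ is nondegenerate at every point of $\mathcal M_\beta$. -/

import Mathlib

open Manifold Bundle TopologicalSpace
open scoped ContDiff Matrix.Norms.L2Operator

noncomputable section

namespace TwistedModuli

/-! ### The group `SU(n)`, its Lie algebra, the exponential map -/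

/-- Complex `n × n` matrices, with the operator norm (any norm would do). -/
abbrev Mat (n : ℕ) : Type := Matrix (Fin n) (Fin n) ℂ

/-- The group `SU(n)`, with the topology induced from the space of matrices. -/
abbrev SU (n : ℕ) : Type := Matrix.specialUnitaryGroup (Fin n) ℂ

/-- The Lie algebra `𝔰𝔲(n)`: skew-Hermitian matrices of trace zero, as a real vector space. -/
def su (n : ℕ) : Submodule ℝ (Mat n) where
  carrier := {A | A.conjTranspose = -A ∧ A.trace = 0}
  add_mem' := by
    rintro A B ⟨hA, hA'⟩ ⟨hB, hB'⟩
    refine ⟨?_, ?_⟩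
    · rw [Matrix.conjTranspose_add, hA, hB, neg_add]
    · rw [Matrix.trace_add, hA', hB', add_zero]
  zero_mem' := by simp
  smul_mem' := by
    rintro c A ⟨hA, hA'⟩
    refine ⟨?_, ?_⟩
    · rw [Matrix.conjTranspose_smul, hA, star_trivial, smul_neg]
    · rw [Matrix.trace_smul, hA', smul_zero]

theorem mem_su_iff {n : ℕ} {A : Mat n} :
    A ∈ su n ↔ A.conjTranspose = -A ∧ A.trace = 0 := Iff.rfl

theorem SU.conjTranspose_mul {n : ℕ} (k : SU n) : (k : Mat n).conjTranspose * (k : Mat n) = 1 :=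
  k.2.1.1

theorem SU.mul_conjTranspose {n : ℕ} (k : SU n) : (k : Mat n) * (k : Mat n).conjTranspose = 1 :=
  k.2.1.2

theorem SU.coe_inv {n : ℕ} (k : SU n) : ((k⁻¹ : SU n) : Mat n) = (k : Mat n).conjTranspose := rfl

/-- The adjoint action `Ad_k X = k X k⁻¹` of `SU(n)` on its Lie algebra. -/
def Ad {n : ℕ} (k : SU n) (X : su n) : su n :=
  ⟨(k : Mat n) * (X : Mat n) * ((k⁻¹ : SU n) : Mat n), by
    refine ⟨?_, ?_⟩
    · rw [SU.coe_inv, Matrix.conjTranspose_mul, Matrix.conjTranspose_mul,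
        Matrix.conjTranspose_conjTranspose, X.2.1]
      simp [mul_assoc]
    · rw [SU.coe_inv, Matrix.trace_mul_comm, ← mul_assoc, SU.conjTranspose_mul, one_mul]
      exact X.2.2⟩

/-- The derivative of the determinant at the identity is the trace. -/
theorem hasDerivAt_det_of_eq_one {n : ℕ} {c : ℝ → Mat n} {A : Mat n}
    (hc : HasDerivAt c A 0) (h0 : c 0 = 1) : HasDerivAt (fun t => (c t).det) A.trace 0 := by
  have hd : DifferentiableAt ℝ (fun M : Mat n => M.det) 1 := by
    have : (fun M : Mat n => M.det) = fun M : Mat n =>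
        ∑ σ : Equiv.Perm (Fin n), (Equiv.Perm.sign σ : ℤ) • ∏ i, M (σ i) i := by
      funext M; exact Matrix.det_apply M
    rw [this]
    have h : ∀ i j : Fin n, DifferentiableAt ℝ (fun M : Mat n => M i j) 1 := fun i j =>
      (LinearMap.toContinuousLinearMap (Matrix.entryLinearMap ℝ ℂ i j)).differentiableAt
    fun_prop
  -- along the straight line
  have h1 : HasDerivAt (fun t : ℝ => (1 : Mat n) + t • A) A 0 := by
    have h := ((hasDerivAt_id (0 : ℝ)).smul_const A).const_add (1 : Mat n)
    rw [one_smul] at h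
    exact h
  have e1 : HasDerivAt (fun t : ℝ => ((1 : Mat n) + t • A).det)
      (fderiv ℝ (fun M : Mat n => M.det) 1 A) 0 := by
    have := hd.hasFDerivAt
    rw [show (1 : Mat n) = 1 + (0 : ℝ) • A by simp] at this
    have := this.comp_hasDerivAt (0 : ℝ) h1
    rw [show (1 : Mat n) + (0 : ℝ) • A = 1 by simp] at this
    exact this
  have e2 : HasDerivAt (fun t : ℝ => ((1 : Mat n) + t • A).det) A.trace 0 := by
    have hfun : (fun t : ℝ => ((1 : Mat n) + t • A).det) = fun t : ℝ =>
        1 + A.trace * (t : ℂ) + (Matrix.det (1 + (Polynomial.X : Polynomial ℂ) •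
          A.map Polynomial.C)).divX.divX.eval (t : ℂ) * (t : ℂ) ^ 2 := by
      funext t
      rw [← Matrix.det_one_add_smul]
      rfl
    rw [hfun]
    set p := (Matrix.det (1 + (Polynomial.X : Polynomial ℂ) •
          A.map Polynomial.C)).divX.divX
    have hz : HasDerivAt (fun z : ℂ => 1 + A.trace * z + p.eval z * z ^ 2) A.trace
        ((0 : ℝ) : ℂ) := by
      have := (((hasDerivAt_id (0 : ℂ)).const_mul A.trace).const_add 1).add
        ((p.hasDerivAt 0).mul (hasDerivAt_pow 2 (0 : ℂ)))
      have e : A.trace * 1 + (p.derivative.eval 0 * (0 : ℂ) ^ 2 +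
          p.eval 0 * (((2 : ℕ) : ℂ) * (0 : ℂ) ^ (2 - 1))) = A.trace := by simp
      rw [e] at this
      rw [Complex.ofReal_zero]
      exact this
    exact hz.comp_ofReal
  have e3 : HasDerivAt (fun t : ℝ => (c t).det) (fderiv ℝ (fun M : Mat n => M.det) 1 A) 0 := by
    have := hd.hasFDerivAt
    rw [← h0] at this
    have := this.comp_hasDerivAt (0 : ℝ) hc
    rw [h0] at this
    exact this
  rw [e2.unique e1]
  exact e3

theorem conjTranspose_exp_mul_exp {n : ℕ} (X : su n) :
    (NormedSpace.exp (X : Mat n)).conjTranspose * NormedSpace.exp (X : Mat n) = 1 := by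
  rw [← Matrix.exp_conjTranspose, X.2.1,
    ← Matrix.exp_add_of_commute _ _ (Commute.neg_left (Commute.refl (X : Mat n)))]
  simp

theorem det_exp_su {n : ℕ} (X : su n) : (NormedSpace.exp (X : Mat n)).det = 1 := by
  set f : ℝ → ℂ := fun t => (NormedSpace.exp (t • (X : Mat n))).det with hf
  have hadd : ∀ s t : ℝ, f (s + t) = f s * f t := by
    intro s t
    simp only [hf]
    rw [add_smul, Matrix.exp_add_of_commute _ _
      (((Commute.refl (X : Mat n)).smul_left s).smul_right t), Matrix.det_mul]
  have h0 : HasDerivAt f 0 0 := by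
    have h := hasDerivAt_exp_smul_const (𝕂 := ℝ) (X : Mat n) (0 : ℝ)
    rw [zero_smul, NormedSpace.exp_zero, one_mul] at h
    have h' := hasDerivAt_det_of_eq_one h (by simp)
    rw [X.2.2] at h'
    exact h'
  have hd : ∀ s, HasDerivAt f 0 s := by
    intro s
    have h1 : HasDerivAt (fun t => f s * f (t - s)) (f s * 0) s := by
      have h2 : HasDerivAt (fun t => f (t - s)) 0 s := by
        have h3 : HasDerivAt f 0 (s - s) := by rwa [sub_self]
        exact h3.comp_sub_const s s
      exact h2.const_mul (f s)
    have e : (fun t => f s * f (t - s)) = f := by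
      funext t
      rw [← hadd, add_sub_cancel]
    rwa [e, mul_zero] at h1
  have h := is_const_of_deriv_eq_zero (fun s => (hd s).differentiableAt) (fun s => (hd s).deriv) 1 0
  simpa [hf] using h

/-- The exponential map `exp : 𝔰𝔲(n) → SU(n)`. -/
def expSU {n : ℕ} (X : su n) : SU n :=
  ⟨NormedSpace.exp (X : Mat n), by
    exact ⟨⟨conjTranspose_exp_mul_exp X, mul_eq_one_comm.mp (conjTranspose_exp_mul_exp X)⟩,
      det_exp_su X⟩⟩

/-! ### Maurer-Cartan forms -/

/-- A curve `c` in `SU(n)`, regarded as a curve of matrices, has velocity `c'(0)`. -/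
def velocity {n : ℕ} (c : ℝ → SU n) : Mat n := deriv (fun t => (c t : Mat n)) 0

theorem left_velocity_mem {n : ℕ} (c : ℝ → SU n) :
    (((c 0)⁻¹ : SU n) : Mat n) * velocity c ∈ su n := by
  by_cases hc : DifferentiableAt ℝ (fun t => (c t : Mat n)) 0
  · have hv : HasDerivAt (fun t => (c t : Mat n)) (velocity c) 0 := hc.hasDerivAt
    have hD : HasDerivAt (fun t => (((c 0)⁻¹ * c t : SU n) : Mat n))
        ((((c 0)⁻¹ : SU n) : Mat n) * velocity c) 0 := hv.const_mul (((c 0)⁻¹ : SU n) : Mat n)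
    refine ⟨?_, ?_⟩
    · have h1 := hD.star
      have h2 := h1.mul hD
      have e : ((fun t => star (((c 0)⁻¹ * c t : SU n) : Mat n)) *
          fun t => (((c 0)⁻¹ * c t : SU n) : Mat n)) = fun _ => (1 : Mat n) := by
        funext t
        exact SU.conjTranspose_mul ((c 0)⁻¹ * c t)
      have h3 := h2.unique (by rw [e]; exact hasDerivAt_const 0 (1 : Mat n))
      simp only [inv_mul_cancel, OneMemClass.coe_one, star_one, mul_one, one_mul] at h3
      exact eq_neg_of_add_eq_zero_left h3
    · have h1 := hasDerivAt_det_of_eq_one hD (by simp)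
      refine h1.unique ?_
      have e : (fun t => (((c 0)⁻¹ * c t : SU n) : Mat n).det) = fun _ => (1 : ℂ) := by
        funext t
        exact ((c 0)⁻¹ * c t).2.2
      rw [e]
      exact hasDerivAt_const 0 (1 : ℂ)
  · have : velocity c = 0 := deriv_zero_of_not_differentiableAt hc
    rw [this, mul_zero]
    exact (su n).zero_mem

theorem right_velocity_mem {n : ℕ} (c : ℝ → SU n) :
    velocity c * (((c 0)⁻¹ : SU n) : Mat n) ∈ su n := by
  have h := (Ad (c 0) ⟨_, left_velocity_mem c⟩).2
  have e : ((Ad (c 0) ⟨_, left_velocity_mem c⟩ : su n) : Mat n) =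
      velocity c * (((c 0)⁻¹ : SU n) : Mat n) := by
    change ((c 0 : SU n) : Mat n) * ((((c 0)⁻¹ : SU n) : Mat n) * velocity c) *
      (((c 0)⁻¹ : SU n) : Mat n) = _
    rw [← mul_assoc, SU.coe_inv, SU.mul_conjTranspose, one_mul]
  rwa [e] at h

/-- The value `c(0)⁻¹ c'(0)` of the left-invariant Maurer-Cartan form of `SU(n)` on the
velocity at `0` of a curve `c`. -/
def mcLeft {n : ℕ} (c : ℝ → SU n) : su n :=
  ⟨(((c 0)⁻¹ : SU n) : Mat n) * velocity c, left_velocity_mem c⟩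

/-- The value `c'(0) c(0)⁻¹` of the right-invariant Maurer-Cartan form of `SU(n)` on the
velocity at `0` of a curve `c`. -/
def mcRight {n : ℕ} (c : ℝ → SU n) : su n :=
  ⟨velocity c * (((c 0)⁻¹ : SU n) : Mat n), right_velocity_mem c⟩

/-- An `Ad`-invariant inner product on `𝔰𝔲(n)`. -/
structure InvariantInnerProduct (n : ℕ) where
  /-- the underlying bilinear form -/
  form : LinearMap.BilinForm ℝ (su n)
  symm : ∀ X Y, form X Y = form Y X
  pos : ∀ X, X ≠ 0 → 0 < form X X
  invariant : ∀ (k : SU n) (X Y : su n), form (Ad k X) (Ad k Y) = form X Y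

/-! ### The free group, Fox calculus, and the distinguished 2-chain -/

/-- The free group on the `2g` generators `x_{2i-1} = (i, 0)`, `x_{2i} = (i, 1)`. -/
abbrev F (g : ℕ) : Type := FreeGroup (Fin g × Fin 2)

/-- The relation `R = ∏ [x_{2i-1}, x_{2i}]`, where `[a, b] = a b a⁻¹ b⁻¹`. -/
def surfaceRelation (g : ℕ) : F g :=
  (List.ofFn fun i : Fin g =>
    FreeGroup.of (i, 0) * FreeGroup.of (i, 1) * (FreeGroup.of (i, 0))⁻¹ *
      (FreeGroup.of (i, 1))⁻¹).prod

/-- Fox derivative with respect to `x_s` of a word, given as a list of letters `(t, true)`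
(meaning `x_t`) and `(t, false)` (meaning `x_t⁻¹`). -/
def foxWord {g : ℕ} (s : Fin g × Fin 2) : List ((Fin g × Fin 2) × Bool) → MonoidAlgebra ℤ (F g)
  | [] => 0
  | (t, true) :: l =>
      (if t = s then 1 else 0) + MonoidAlgebra.of ℤ (F g) (FreeGroup.of t) * foxWord s l
  | (t, false) :: l =>
      MonoidAlgebra.of ℤ (F g) (FreeGroup.of t)⁻¹ * (foxWord s l - (if t = s then 1 else 0))

/-- The Fox derivative `∂w/∂x_s ∈ ℤ[F]`. -/
def fox {g : ℕ} (s : Fin g × Fin 2) (w : F g) : MonoidAlgebra ℤ (F g) := foxWord s w.toWord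

theorem foxWord_append {g : ℕ} (s : Fin g × Fin 2) (l m : List ((Fin g × Fin 2) × Bool)) :
    foxWord s (l ++ m) =
      foxWord s l + MonoidAlgebra.of ℤ (F g) (FreeGroup.mk l) * foxWord s m := by
  induction l with
  | nil => rw [← FreeGroup.one_eq_mk, map_one, one_mul, List.nil_append, foxWord, zero_add]
  | cons a l ih =>
    obtain ⟨t, b⟩ := a
    have e : (FreeGroup.mk ((t, b) :: l) : F g) = FreeGroup.mk [(t, b)] * FreeGroup.mk l := by
      rw [FreeGroup.mul_mk]; rfl
    rw [e, map_mul]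
    cases b
    · have : (FreeGroup.mk [(t, false)] : F g) = (FreeGroup.of t)⁻¹ := rfl
      rw [this, List.cons_append, foxWord, foxWord, ih]
      noncomm_ring
    · have : (FreeGroup.mk [(t, true)] : F g) = FreeGroup.of t := rfl
      rw [this, List.cons_append, foxWord, foxWord, ih]
      noncomm_ring

theorem foxWord_eq_of_red {g : ℕ} (s : Fin g × Fin 2) {l m : List ((Fin g × Fin 2) × Bool)}
    (h : FreeGroup.Red l m) : foxWord s l = foxWord s m := by
  induction h with
  | refl => rfl
  | tail _ hstep ih =>
    rw [ih]
    obtain @⟨L₁, L₂, t, b⟩ := hstep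
    rw [foxWord_append, foxWord_append]
    congr 2
    cases b
    · simp [foxWord, ← mul_assoc, ← MonoidAlgebra.one_def]
    · simp [foxWord, ← mul_assoc, mul_sub, ← MonoidAlgebra.one_def]

/-- The product rule `∂(vw)/∂x_s = ∂v/∂x_s + v ∂w/∂x_s`. -/
theorem fox_mul {g : ℕ} (s : Fin g × Fin 2) (v w : F g) :
    fox s (v * w) = fox s v + MonoidAlgebra.of ℤ (F g) v * fox s w := by
  have h : FreeGroup.Red (v.toWord ++ w.toWord) (v * w).toWord := by
    rw [FreeGroup.toWord_mul]
    exact FreeGroup.reduce.red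
  rw [fox, ← foxWord_eq_of_red s h, foxWord_append, FreeGroup.mk_toWord]
  rfl

/-- `∂x_t/∂x_s` is `1` if `t = s` and `0` otherwise. -/
theorem fox_of {g : ℕ} (s t : Fin g × Fin 2) :
    fox s (FreeGroup.of t) = if t = s then 1 else 0 := by
  simp [fox, foxWord]

/-- The distinguished group 2-chain `c = ∑_s (∂R/∂x_s, x_s)`; 2-chains are `ℤ`-linear
combinations of pairs of elements of `F`, and `(·, x_s)` is extended `ℤ`-linearly. -/
def surfaceChain (g : ℕ) : (F g × F g) →₀ ℤ :=
  ∑ s : Fin g × Fin 2, (fox s (surfaceRelation g)).coeff.mapDomain fun u => (u, FreeGroup.of s)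

/-! ### The form `ω` on `Hom(F, G) = G^{2g}` -/

/-- `Y = Hom(F, SU(n)) = SU(n)^{2g}`. -/
abbrev Y (n g : ℕ) : Type := Fin g × Fin 2 → SU n

/-- Evaluation of a representation `h : F → SU(n)` on the element `w` of `F`. -/
def eval {n g : ℕ} (w : F g) (h : Y n g) : SU n := FreeGroup.lift h w

/-- The curve `t ↦ h exp(t ξ)` in `Y`; its velocity at `0` is the tangent vector `h ξ`. -/
def curve {n g : ℕ} (h : Y n g) (ξ : Fin g × Fin 2 → su n) (t : ℝ) : Y n g :=
  fun s => h s * expSU (t • ξ s)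

/-- The tangent vector `h ξ = (h_s ξ_s)_s` to `SU(n)^{2g}` at `h`, in the ambient space of tuples of
matrices. Every tangent vector is of this form for exactly one `ξ ∈ 𝔰𝔲(n)^{2g}`. -/
def leftTranslate {n g : ℕ} (h : Y n g) (ξ : Fin g × Fin 2 → su n) : Fin g × Fin 2 → Mat n :=
  fun s => (h s : Mat n) * (ξ s : Mat n)

/-- The pull-back to `Y` of the 2-form `Ω = θ₁ · θ̄₂` on `SU(n)²` under the evaluation map
`E_{(u,v)} : Y → SU(n)²`, on the tangent vectors `h ξ` and `h ζ`. -/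
def pullbackOmega {n g : ℕ} (B : InvariantInnerProduct n) (p : F g × F g) (h : Y n g)
    (ξ ζ : Fin g × Fin 2 → su n) : ℝ :=
  B.form (mcLeft fun t => eval p.1 (curve h ξ t)) (mcRight fun t => eval p.2 (curve h ζ t)) -
    B.form (mcLeft fun t => eval p.1 (curve h ζ t)) (mcRight fun t => eval p.2 (curve h ξ t))

/-- The 2-form `ω = ⟨c, E^*Ω⟩` on `Y`, on the tangent vectors `h ξ` and `h ζ` at `h`. -/
def omega {n g : ℕ} (B : InvariantInnerProduct n) (h : Y n g)
    (ξ ζ : Fin g × Fin 2 → su n) : ℝ :=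
  (surfaceChain g).sum fun p a => (a : ℝ) * pullbackOmega B p h ξ ζ

/-! ### The moduli spaces -/

/-- The map `ε_R : Y → SU(n)`, `h ↦ ∏ [h_{2i-1}, h_{2i}]`. -/
def epsR {n g : ℕ} (h : Y n g) : SU n := eval (surfaceRelation g) h

/-- The fibre `Y_t = ε_R⁻¹(t)`. -/
abbrev Yfib (n g : ℕ) (t : SU n) : Type := {h : Y n g // epsR h = t}

/-- `Y_t → SU(n)^{2g} ⊆ Mat^{2g}`. -/
def Yfib.incl {n g : ℕ} {t : SU n} (h : Yfib n g t) : Fin g × Fin 2 → Mat n :=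
  fun s => (h.1 s : Mat n)

/-- Two elements of `Y_t` are equivalent when they are conjugate under the centralizer `Z_t`. -/
def conjSetoid (n g : ℕ) (t : SU n) : Setoid (Yfib n g t) where
  r h h' := ∃ k ∈ Subgroup.centralizer {t}, ∀ s, k * h.1 s * k⁻¹ = h'.1 s
  iseqv := by
    refine ⟨fun h => ⟨1, Subgroup.one_mem _, by simp⟩, ?_, ?_⟩
    · rintro h h' ⟨k, hk, e⟩
      exact ⟨k⁻¹, Subgroup.inv_mem _ hk, fun s => by rw [← e s]; group⟩
    · rintro h h' h'' ⟨k, hk, e⟩ ⟨l, hl, e'⟩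
      exact ⟨l * k, Subgroup.mul_mem _ hl hk, fun s => by rw [← e' s, ← e s]; group⟩

/-- The moduli space `M_t = Y_t / Z_t`, with the quotient topology. -/
abbrev Moduli (n g : ℕ) (t : SU n) : Type := Quotient (conjSetoid n g t)

/-- The quotient map `Y_t → M_t`. -/
def Moduli.proj {n g : ℕ} {t : SU n} (h : Yfib n g t) : Moduli n g t := Quotient.mk _ h

/-- The extended moduli space `X_β = {(h, Λ) | ε_R(h) = β exp(Λ)} ⊆ SU(n)^{2g} × 𝔰𝔲(n)`. -/
abbrev ExtModuli (n g : ℕ) (β : SU n) : Type :=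
  {p : Y n g × su n // epsR p.1 = β * expSU p.2}

/-- `X_β → SU(n)^{2g} × 𝔰𝔲(n) ⊆ Mat^{2g} × 𝔰𝔲(n)`. -/
def ExtModuli.incl {n g : ℕ} {β : SU n} (p : ExtModuli n g β) :
    (Fin g × Fin 2 → Mat n) × su n :=
  (fun s => (p.1.1 s : Mat n), p.1.2)

/-- The moment map `μ = 2 pr₂` on `X_β`. -/
def momentMap {n g : ℕ} {β : SU n} (p : ExtModuli n g β) : su n := (2 : ℝ) • p.1.2

/-! ### Manifolds -/

section Manifolds

variable {E V : Type} [NormedAddCommGroup E] [NormedSpace ℝ E]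
  [NormedAddCommGroup V] [NormedSpace ℝ V]

/-- `ι` is a smooth embedding of the manifold `M` in the finite-dimensional vector space `E`: it is
smooth, immersive, and a homeomorphism onto its image. -/
structure IsEmbeddedBy (d : ℕ) {M : Type} [TopologicalSpace M]
    [ChartedSpace (EuclideanSpace ℝ (Fin d)) M] (ι : M → E) : Prop where
  isManifold : IsManifold (𝓡 d) ∞ M
  contMDiff : ContMDiff (𝓡 d) 𝓘(ℝ, E) ∞ ι
  injective_mfderiv : ∀ x, Function.Injective (mfderiv (𝓡 d) 𝓘(ℝ, E) ι x)
  isEmbedding : Topology.IsEmbedding ι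

/-- Let the space `X` be embedded by `ι` in a vector space `E`. The point `v` is a regular value of
`f : X → V` if `X` is a smooth submanifold of `E` on an open neighbourhood `U` of `f⁻¹(v)`, if `f` is
smooth on `U`, and if the differential of `f` is onto at each point of `f⁻¹(v)`. -/
def IsRegularValue {X : Type} [TopologicalSpace X] (ι : X → E) (f : X → V) (v : V) : Prop :=
  ∃ (U : Opens X) (d : ℕ) (_ : ChartedSpace (EuclideanSpace ℝ (Fin d)) U),
    f ⁻¹' {v} ⊆ U ∧
    IsEmbeddedBy d (fun x : U => ι x) ∧
    ContMDiff (𝓡 d) 𝓘(ℝ, V) ∞ (fun x : U => f x) ∧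
    ∀ x : U, f x = v → Function.Surjective (mfderiv (𝓡 d) 𝓘(ℝ, V) (fun y : U => f y) x)

/-- `q` is a smooth surjective submersion. -/
structure IsSmoothSubmersion (k d : ℕ) {N M : Type} [TopologicalSpace N] [TopologicalSpace M]
    [ChartedSpace (EuclideanSpace ℝ (Fin k)) N] [ChartedSpace (EuclideanSpace ℝ (Fin d)) M]
    (q : N → M) : Prop where
  surjective : Function.Surjective q
  contMDiff : ContMDiff (𝓡 k) (𝓡 d) ∞ q
  surjective_mfderiv : ∀ x, Function.Surjective (mfderiv (𝓡 k) (𝓡 d) q x)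

/-- A smooth differential 2-form on a manifold: an alternating bilinear form on each tangent space,
depending smoothly on the point. -/
structure TwoForm (d : ℕ) (M : Type) [TopologicalSpace M]
    [ChartedSpace (EuclideanSpace ℝ (Fin d)) M] [IsManifold (𝓡 d) ∞ M] where
  /-- the bilinear form on each tangent space -/
  toFun : ∀ x : M, TangentSpace (𝓡 d) x →L[ℝ] TangentSpace (𝓡 d) x →L[ℝ] ℝ
  alternating : ∀ (x : M) (v : TangentSpace (𝓡 d) x), toFun x v v = 0
  contMDiff : ContMDiff (𝓡 d) ((𝓡 d).prod
      𝓘(ℝ, EuclideanSpace ℝ (Fin d) →L[ℝ] EuclideanSpace ℝ (Fin d) →L[ℝ] ℝ)) ∞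
    (fun x => TotalSpace.mk' (EuclideanSpace ℝ (Fin d) →L[ℝ] EuclideanSpace ℝ (Fin d) →L[ℝ] ℝ)
      (E := fun x : M => TangentSpace (𝓡 d) x →L[ℝ] TangentSpace (𝓡 d) x →L[ℝ] ℝ) x (toFun x))

/-- A 2-form is nondegenerate if at each point only the zero tangent vector pairs to zero with
every tangent vector. -/
def TwoForm.Nondegenerate {d : ℕ} {M : Type} [TopologicalSpace M]
    [ChartedSpace (EuclideanSpace ℝ (Fin d)) M] [IsManifold (𝓡 d) ∞ M] (σ : TwoForm d M) : Prop :=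
  ∀ (x : M) (v : TangentSpace (𝓡 d) x), (∀ w, σ.toFun x v w = 0) → v = 0

end Manifolds

/-- The 2-form `σ` on `M_t` is induced by `ω`: its pull-back under the quotient map `q : Y_t → M_t`
is the restriction of `ω` to `Y_t`, i.e. `σ(dq u, dq v) = ω(u, v)` for all `u, v ∈ T_h Y_t`. Here
`u, v` are written as `h ξ, h ζ` by means of the inclusion of `Y_t` in `SU(n)^{2g}`. -/
def IsInducedForm {n g d k : ℕ} {t : SU n} (B : InvariantInnerProduct n)
    [ChartedSpace (EuclideanSpace ℝ (Fin k)) (Yfib n g t)]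
    [ChartedSpace (EuclideanSpace ℝ (Fin d)) (Moduli n g t)]
    [IsManifold (𝓡 d) ∞ (Moduli n g t)]
    (σ : TwoForm d (Moduli n g t)) : Prop :=
  ∀ (h : Yfib n g t) (u v : TangentSpace (𝓡 k) h), ∃ ξ ζ : Fin g × Fin 2 → su n,
    mfderiv (𝓡 k) 𝓘(ℝ, Fin g × Fin 2 → Mat n) Yfib.incl h u = leftTranslate h.1 ξ ∧
    mfderiv (𝓡 k) 𝓘(ℝ, Fin g × Fin 2 → Mat n) Yfib.incl h v = leftTranslate h.1 ζ ∧
    σ.toFun (Moduli.proj h) (mfderiv (𝓡 k) (𝓡 d) Moduli.proj h u)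
      (mfderiv (𝓡 k) (𝓡 d) Moduli.proj h v) = omega B h.1 ξ ζ

end TwistedModuli

end

open TwistedModuli

/-!
A tangent vector `ξ` of `SU(n)^{2g} = Hom(F, SU(n))` at `h`, left-translated to the Lie algebra,
determines a crossed homomorphism `dEval h ξ` on the free group `F` with values in `𝔰𝔲(n)`, on
which `F` acts through `h` and the adjoint representation: its value at `w` is the logarithmic
derivative of `h ↦ h(w)`. All crossed homomorphisms arise in this way, and `ω` becomes the
antisymmetrized cup product, evaluated on the chain `c` of Fox derivatives (`omega_eq`). The cup
product on the chain `∑ₛ (∂w/∂xₛ, xₛ)` is, as a function of `w`, additive up to the explicit term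
`⟨a(v), v b(w)⟩` (`cupFox_mul`). Since every additive function on `F` vanishes on the product of
commutators `R`, this gives at `w = R`

* `(δX ∪ b)[c] = ⟨X, b(R)⟩` for a coboundary `δX` (`cupFox_coboundary_left`), and
* `(a ∪ b)[c] + (b ∪ a)[c] = ⟨a(R), b(R)⟩` (`cupFox_swap`).

Moreover the pairing `(a ∪ b)[c]` is nondegenerate on crossed homomorphisms, by a computation for
one handle and induction over the handles (`eq_zero_of_cupFox_eq_zero`). This replaces Poincaré
duality.

If `ε_R(h) = β` generates the centre, a matrix commuting with all `h_s` is scalar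
(`eq_scalar_of_commute`), so that no nonzero `X ∈ 𝔰𝔲(n)` is fixed by all `Ad(h_s)`. Hence
`X ↦ δX` is injective, and by nondegeneracy and the first formula the differential of `ε_R` at `h`
is onto (`dEvalL_surjective`). On the kernel of this differential, the second formula shows that the
radical of `ω` is exactly the space of directions tangent to the conjugation orbit
(`omega_orbitDir`, `exists_eq_orbitDir`).

The rest is geometry. Near the zero level, `X_β` is the graph over an open subset of `SU(n)^{2g}` of
the function `log(β⁻¹ε_R)`, twice which is the moment map (`isRegularValue_momentMap`). By the
inverse function theorem the conjugation action on `ε_R⁻¹(β)` has a slice at each point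
(`nonempty_slice`), and by compactness of `SU(n)` a small slice meets every orbit at most once
(`exists_separating_slice`). Slices give charts of the fibre (`fibChart`) and of the moduli space
(`modChart`); two such charts have a smooth change of coordinates because the projection, read in
any slice chart, is a component of a smooth map on the ambient matrices. The form `ω` is invariant
under conjugation and annihilates the orbit directions, so that it descends to each tangent space of
the moduli space (`exists_descended_form`); in a slice chart `s` the result is `s^*ω`, hence smooth
(`contMDiff_descended_form`), and it is nondegenerate because the radical of `ω` is no larger than
the orbit directions.
-/

noncomputable section

namespace TwistedModuli

/-! ### Group cocycles and the cup product on the fundamental chain -/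

section Cocycles

variable {g : ℕ} {V : Type*} [AddCommGroup V]

/-- The additive extension to `ℤ[F]` of a function on `F`. -/
def pairing (φ : F g → V) : MonoidAlgebra ℤ (F g) →+ V :=
  (Finsupp.liftAddHom fun u => zmultiplesHom V (φ u)).comp
    MonoidAlgebra.coeffAddEquiv.toAddMonoidHom

theorem pairing_apply (φ : F g → V) (c : MonoidAlgebra ℤ (F g)) :
    pairing φ c = c.coeff.sum fun u m => m • φ u := rfl

theorem pairing_of (φ : F g → V) (v : F g) : pairing φ (MonoidAlgebra.of ℤ (F g) v) = φ v := by
  rw [pairing_apply, MonoidAlgebra.of_apply, MonoidAlgebra.coeff_single,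
    Finsupp.sum_single_index (h := fun u (m : ℤ) => m • φ u) (zero_smul _ _), one_smul]

theorem pairing_one (φ : F g → V) : pairing φ 1 = φ 1 := by
  rw [← _root_.map_one (MonoidAlgebra.of ℤ (F g)), pairing_of]

theorem pairing_of_mul (φ : F g → V) (v : F g) (c : MonoidAlgebra ℤ (F g)) :
    pairing φ (MonoidAlgebra.of ℤ (F g) v * c) = pairing (fun u => φ (v * u)) c := by
  induction c using MonoidAlgebra.induction_linear with
  | zero => simp
  | add c d hc hd => rw [mul_add, map_add, map_add, hc, hd]
  | single u m =>
    rw [MonoidAlgebra.of_apply, MonoidAlgebra.single_mul_single, one_mul, pairing_apply,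
      pairing_apply, MonoidAlgebra.coeff_single, MonoidAlgebra.coeff_single,
      Finsupp.sum_single_index (h := fun u (m : ℤ) => m • φ u) (zero_smul _ _),
      Finsupp.sum_single_index (h := fun u (m : ℤ) => m • φ (v * u)) (zero_smul _ _)]

theorem pairing_add (φ ψ : F g → V) (c : MonoidAlgebra ℤ (F g)) :
    pairing (fun u => φ u + ψ u) c = pairing φ c + pairing ψ c := by
  simp only [pairing_apply, smul_add, Finsupp.sum_add]

variable [Module ℝ V]

/-- Crossed homomorphisms from the free group to a representation. -/
def IsCocycle (ρ : Representation ℝ (F g) V) (a : F g → V) : Prop :=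
  ∀ v w, a (v * w) = a v + ρ v (a w)

namespace IsCocycle

variable {ρ : Representation ℝ (F g) V} {a b : F g → V}

theorem map_one (ha : IsCocycle ρ a) : a 1 = 0 := by
  have h := ha 1 1
  simpa using h

theorem map_inv (ha : IsCocycle ρ a) (v : F g) : a v⁻¹ = -ρ v⁻¹ (a v) := by
  have h := ha v⁻¹ v
  rw [inv_mul_cancel, ha.map_one] at h
  exact eq_neg_of_add_eq_zero_left h.symm

theorem add (ha : IsCocycle ρ a) (hb : IsCocycle ρ b) : IsCocycle ρ (a + b) := fun v w => by
  simp only [Pi.add_apply, ha v w, hb v w, _root_.map_add]; abel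

theorem sub (ha : IsCocycle ρ a) (hb : IsCocycle ρ b) : IsCocycle ρ (a - b) := fun v w => by
  simp only [Pi.sub_apply, ha v w, hb v w, _root_.map_sub]; abel

theorem smul (ha : IsCocycle ρ a) (c : ℝ) : IsCocycle ρ (c • a) := fun v w => by
  simp only [Pi.smul_apply, ha v w, _root_.map_smul, smul_add]

theorem coboundary (X : V) : IsCocycle ρ (fun v => X - ρ v X) := fun v w => by
  simp only [_root_.map_sub, _root_.map_mul, Module.End.mul_apply]; abel

/-- A cocycle on a free group is determined by its values on the generators. -/
theorem ext (ha : IsCocycle ρ a) (hb : IsCocycle ρ b)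
    (h : ∀ s, a (FreeGroup.of s) = b (FreeGroup.of s)) : a = b := by
  funext w
  induction w using FreeGroup.induction_on with
  | C1 => rw [ha.map_one, hb.map_one]
  | of s => exact h s
  | inv_of s _ => rw [ha.map_inv, hb.map_inv, h]
  | mul v w hv hw => rw [ha v w, hb v w, hv, hw]

end IsCocycle

theorem pairing_map {W : Type*} [AddCommGroup W] [Module ℝ W] (L : V →ₗ[ℝ] W) (φ : F g → V)
    (c : MonoidAlgebra ℤ (F g)) : pairing (fun u => L (φ u)) c = L (pairing φ c) := by
  simp only [pairing_apply, map_finsuppSum, map_zsmul]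

theorem fox_one (s : Fin g × Fin 2) : fox s (1 : F g) = 0 := by
  simp [fox, foxWord]

/-- The cocycle with prescribed values on the generators, given by the fundamental formula
`b(w) = ∑ₛ (∂w/∂xₛ) b(xₛ)` of Fox calculus. -/
def foxCocycle (ρ : Representation ℝ (F g) V) (p : Fin g × Fin 2 → V) (w : F g) : V :=
  ∑ s, pairing (fun u => ρ u (p s)) (fox s w)

theorem isCocycle_foxCocycle (ρ : Representation ℝ (F g) V) (p : Fin g × Fin 2 → V) :
    IsCocycle ρ (foxCocycle ρ p) := fun v w => by
  simp only [foxCocycle, fox_mul, map_add, pairing_of_mul, _root_.map_mul, Module.End.mul_apply,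
    pairing_map, Finset.sum_add_distrib, map_sum]

theorem foxCocycle_of (ρ : Representation ℝ (F g) V) (p : Fin g × Fin 2 → V)
    (t : Fin g × Fin 2) : foxCocycle ρ p (FreeGroup.of t) = p t := by
  simp only [foxCocycle, fox_of]
  rw [Finset.sum_eq_single t]
  · simp [pairing_one]
  · intro s _ hs
    rw [if_neg hs.symm, map_zero]
  · simp

theorem IsCocycle.eq_foxCocycle {ρ : Representation ℝ (F g) V} {b : F g → V}
    (hb : IsCocycle ρ b) : b = foxCocycle ρ fun s => b (FreeGroup.of s) :=
  hb.ext (isCocycle_foxCocycle ρ _) fun s =>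
    (foxCocycle_of ρ (fun s => b (FreeGroup.of s)) s).symm

/-- The cup product `⟨a, u b⟩` of two cocycles, evaluated on the 2-chain
`∑ₛ (∂w/∂xₛ, xₛ)`. -/
def cupFox (ρ : Representation ℝ (F g) V) (B : LinearMap.BilinForm ℝ V) (a b : F g → V)
    (w : F g) : ℝ :=
  ∑ s, pairing (fun u => B (a u) (ρ u (b (FreeGroup.of s)))) (fox s w)

variable {ρ : Representation ℝ (F g) V} {B : LinearMap.BilinForm ℝ V} {a b : F g → V}

/-- `w ↦ -∑ₛ (∂w/∂xₛ, xₛ)` is a primitive of the cup product. -/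
theorem cupFox_mul (hB : ∀ u x y, B (ρ u x) (ρ u y) = B x y) (ha : IsCocycle ρ a)
    (hb : IsCocycle ρ b) (v w : F g) :
    cupFox ρ B a b (v * w) = cupFox ρ B a b v + cupFox ρ B a b w + B (a v) (ρ v (b w)) := by
  have h : ∀ (s : Fin g × Fin 2) u, B (a (v * u)) (ρ (v * u) (b (FreeGroup.of s))) =
      B (a v) (ρ v (ρ u (b (FreeGroup.of s)))) + B (a u) (ρ u (b (FreeGroup.of s))) := by
    intro s u
    rw [ha v u, _root_.map_mul, Module.End.mul_apply, map_add, LinearMap.add_apply, hB]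
  have h2 : ∀ s, pairing (fun u => B (a v) (ρ v (ρ u (b (FreeGroup.of s))))) (fox s w) =
      B (a v) (ρ v (pairing (fun u => ρ u (b (FreeGroup.of s))) (fox s w))) := fun s =>
    pairing_map ((B (a v)).comp (ρ v)) (fun u => ρ u (b (FreeGroup.of s))) (fox s w)
  simp only [cupFox, fox_mul, map_add, pairing_of_mul, h, pairing_add, h2, Finset.sum_add_distrib]
  rw [← map_sum, ← map_sum, ← foxCocycle.eq_1 ρ (fun s => b (FreeGroup.of s)), ← hb.eq_foxCocycle]
  ring

theorem cupFox_of (ha : IsCocycle ρ a) (t : Fin g × Fin 2) :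
    cupFox ρ B a b (FreeGroup.of t) = 0 := by
  refine Finset.sum_eq_zero fun s _ => ?_
  rw [fox_of]
  split_ifs
  · rw [pairing_one, ha.map_one, map_zero, LinearMap.zero_apply]
  · rw [map_zero]

theorem cupFox_one : cupFox ρ B a b 1 = 0 := by simp [cupFox, fox_one]

theorem cupFox_inv_of (hB : ∀ u x y, B (ρ u x) (ρ u y) = B x y) (ha : IsCocycle ρ a)
    (hb : IsCocycle ρ b) (t : Fin g × Fin 2) :
    cupFox ρ B a b (FreeGroup.of t)⁻¹ = B (a (FreeGroup.of t)) (b (FreeGroup.of t)) := by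
  have h := cupFox_mul hB ha hb (FreeGroup.of t) (FreeGroup.of t)⁻¹
  rw [mul_inv_cancel, cupFox_one, cupFox_of ha, hb.map_inv, map_neg, map_neg,
    Representation.self_inv_apply] at h
  linarith

theorem cupFox_sub (a' : F g → V) (w : F g) :
    cupFox ρ B (a - a') b w = cupFox ρ B a b w - cupFox ρ B a' b w := by
  rw [eq_sub_iff_add_eq]
  simp only [cupFox, ← Finset.sum_add_distrib, ← pairing_add]
  simp

/-- Every homomorphism to a commutative group kills a product of commutators. -/
theorem map_surfaceRelation {A : Type*} [CommGroup A] (χ : F g →* A) :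
    χ (surfaceRelation g) = 1 := by
  rw [surfaceRelation, map_list_prod, List.map_ofFn]
  refine List.prod_eq_one fun x hx => ?_
  obtain ⟨i, rfl⟩ := List.mem_ofFn.1 hx
  simp

theorem additive_surfaceRelation (f : F g → ℝ) (hf : ∀ v w, f (v * w) = f v + f w) :
    f (surfaceRelation g) = 0 := by
  have h1 : f 1 = 0 := by simpa using hf 1 1
  exact map_surfaceRelation (A := Multiplicative ℝ)
    { toFun := fun w => Multiplicative.ofAdd (f w)
      map_one' := by rw [h1]; rfl
      map_mul' := fun v w => by rw [hf]; rfl }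

/-- The cup product of a coboundary with a cocycle. -/
theorem cupFox_coboundary_left (hB : ∀ u x y, B (ρ u x) (ρ u y) = B x y) (hb : IsCocycle ρ b)
    (X : V) : cupFox ρ B (fun v => X - ρ v X) b (surfaceRelation g) =
      B X (b (surfaceRelation g)) := by
  have h := additive_surfaceRelation
    (fun w => cupFox ρ B (fun v => X - ρ v X) b w - B X (b w)) fun v w => by
      rw [cupFox_mul hB (IsCocycle.coboundary X) hb, hb v w]
      simp only [map_sub, map_add, LinearMap.sub_apply, hB]
      ring
  linarith

/-- Antisymmetry of the cup product in degree one, up to an explicit boundary term. -/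
theorem cupFox_swap (hB : ∀ u x y, B (ρ u x) (ρ u y) = B x y) (hs : ∀ x y, B x y = B y x)
    (ha : IsCocycle ρ a) (hb : IsCocycle ρ b) :
    cupFox ρ B a b (surfaceRelation g) + cupFox ρ B b a (surfaceRelation g) =
      B (a (surfaceRelation g)) (b (surfaceRelation g)) := by
  have h := additive_surfaceRelation
    (fun w => cupFox ρ B a b w + cupFox ρ B b a w - B (a w) (b w)) fun v w => by
      rw [cupFox_mul hB ha hb, cupFox_mul hB hb ha, ha v w, hb v w]
      simp only [map_add, LinearMap.add_apply, hB]
      rw [hs (b v)]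
      ring
  linarith

theorem cupFox_commutator (hB : ∀ u x y, B (ρ u x) (ρ u y) = B x y)
    (ha : IsCocycle ρ a) (hb : IsCocycle ρ b) (s t : Fin g × Fin 2) :
    cupFox ρ B a b (FreeGroup.of s * FreeGroup.of t * (FreeGroup.of s)⁻¹ * (FreeGroup.of t)⁻¹) =
      B (a (FreeGroup.of s)) (ρ (FreeGroup.of s) (b (FreeGroup.of t))) +
      B (a (FreeGroup.of s)) (b (FreeGroup.of s)) + B (a (FreeGroup.of t)) (b (FreeGroup.of t)) +
      B (ρ (FreeGroup.of t) (a (FreeGroup.of s))) (b (FreeGroup.of t)) -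
      B (a (FreeGroup.of s) + ρ (FreeGroup.of s) (a (FreeGroup.of t)))
        (ρ (FreeGroup.of s * FreeGroup.of t * (FreeGroup.of s)⁻¹) (b (FreeGroup.of s)) +
         ρ (FreeGroup.of s * FreeGroup.of t * (FreeGroup.of s)⁻¹ * (FreeGroup.of t)⁻¹)
          (b (FreeGroup.of t))) := by
  set x : F g := FreeGroup.of s with hx
  set y : F g := FreeGroup.of t with hy
  have e : x * y * x⁻¹ * y⁻¹ = (x * y) * (x⁻¹ * y⁻¹) := by group
  have h1 : ∀ p q : V, B p (ρ y⁻¹ q) = B (ρ y p) q := fun p q => by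
    rw [← hB y, Representation.self_inv_apply]
  have h2 : ∀ p q : V, B (ρ x⁻¹ p) (ρ (x⁻¹ * y⁻¹) q) = B (ρ y p) q := fun p q => by
    rw [_root_.map_mul, Module.End.mul_apply, hB, h1]
  rw [e, cupFox_mul hB ha hb, cupFox_mul hB ha hb, cupFox_mul hB ha hb, hx, hy, cupFox_of ha,
    cupFox_of ha, cupFox_inv_of hB ha hb, cupFox_inv_of hB ha hb, ← hx, ← hy, ha x y, hb x⁻¹ y⁻¹,
    ha.map_inv, hb.map_inv, hb.map_inv]
  simp only [map_neg, LinearMap.neg_apply, neg_neg, map_add, ← Module.End.mul_apply,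
    ← _root_.map_mul, h2]
  simp only [← mul_assoc]
  ring

theorem prod_ofFn_take_eq {M : Type*} [Monoid M] {m : ℕ} (f : Fin m → M) (i : Fin m) :
    (List.ofFn f).prod = ((List.ofFn f).take i).prod * f i * ((List.ofFn f).drop (i + 1)).prod := by
  rw [← List.prod_take_mul_prod_drop (List.ofFn f) (i + 1), List.prod_take_succ _ _ (by simp)]
  simp

/-- Nondegeneracy for a single commutator `[x, y]`: the coefficients of `b(x)` and `b(y)` in the
pairing are two linear equations for `a(x)` and `a(y)`, and these have only the zero solution. -/
theorem eq_zero_of_cupFox_commutator (hB : ∀ u x y, B (ρ u x) (ρ u y) = B x y)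
    (hnd : ∀ x, (∀ y, B x y = 0) → x = 0) (ha : IsCocycle ρ a) {s t : Fin g × Fin 2}
    (h : ∀ p q : V, ∃ b, IsCocycle ρ b ∧ b (FreeGroup.of s) = p ∧ b (FreeGroup.of t) = q ∧
      cupFox ρ B a b (FreeGroup.of s * FreeGroup.of t * (FreeGroup.of s)⁻¹ *
        (FreeGroup.of t)⁻¹) = 0) :
    a (FreeGroup.of s) = 0 ∧ a (FreeGroup.of t) = 0 := by
  set x : F g := FreeGroup.of s
  set y : F g := FreeGroup.of t
  have h1 : ∀ (u : F g) (p q : V), B p (ρ u q) = B (ρ u⁻¹ p) q := fun u p q => by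
    rw [← hB u (ρ u⁻¹ p), Representation.self_inv_apply]
  -- the coefficient of `b x`
  have e1 : ρ (x * y * x⁻¹)⁻¹ (a x + ρ x (a y)) = a x := by
    refine (sub_eq_zero.1 (hnd _ fun p => ?_)).symm
    obtain ⟨b, hb, hx, hy, h0⟩ := h p 0
    rw [cupFox_commutator hB ha hb, hx, hy] at h0
    rw [map_sub, LinearMap.sub_apply, ← h1]
    simpa using h0
  -- the coefficient of `b y`
  have e2 : ρ x⁻¹ (a x) + a y + ρ y (a x) = ρ (x * y * x⁻¹ * y⁻¹)⁻¹ (a x + ρ x (a y)) := by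
    refine sub_eq_zero.1 (hnd _ fun q => ?_)
    obtain ⟨b, hb, hx, hy, h0⟩ := h 0 q
    rw [cupFox_commutator hB ha hb, hx, hy, h1 x] at h0
    rw [map_sub, LinearMap.sub_apply, ← h1]
    simpa using h0
  have e3 : ρ (x * y * x⁻¹ * y⁻¹)⁻¹ (a x + ρ x (a y)) = ρ y (a x) := by
    rw [mul_inv_rev, inv_inv, _root_.map_mul, Module.End.mul_apply, e1]
  have e4 : ρ x⁻¹ (a x) + a y = 0 := by
    rw [e3] at e2
    exact add_eq_right.1 e2
  have e5 : a x + ρ x (a y) = 0 := by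
    have := congrArg (ρ x) e4
    rwa [map_add, Representation.self_inv_apply, map_zero] at this
  have e6 : a x = 0 := by rw [← e1, e5, map_zero]
  refine ⟨e6, ?_⟩
  rwa [e6, map_zero, zero_add] at e4

theorem IsCocycle.list_prod_eq_zero (ha : IsCocycle ρ a) (l : List (F g))
    (h : ∀ w ∈ l, a w = 0) : a l.prod = 0 := by
  induction l with
  | nil => simpa using ha.map_one
  | cons w l ih =>
    rw [List.prod_cons, ha, h w (by simp), ih fun v hv => h v (by simp [hv]), map_zero, add_zero]

theorem cupFox_list_prod_eq_zero (hB : ∀ u x y, B (ρ u x) (ρ u y) = B x y)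
    (ha : IsCocycle ρ a) (hb : IsCocycle ρ b) (l : List (F g))
    (h : ∀ w ∈ l, b w = 0 ∧ cupFox ρ B a b w = 0) : cupFox ρ B a b l.prod = 0 := by
  induction l with
  | nil => simpa using cupFox_one
  | cons w l ih =>
    rw [List.prod_cons, cupFox_mul hB ha hb, (h w (by simp)).2,
      ih fun v hv => h v (by simp [hv]),
      hb.list_prod_eq_zero l fun v hv => (h v (by simp [hv])).1]
    simp

/-- The commutator `[x_{2i-1}, x_{2i}]`. -/
def handle (i : Fin g) : F g :=
  FreeGroup.of (i, 0) * FreeGroup.of (i, 1) * (FreeGroup.of (i, 0))⁻¹ * (FreeGroup.of (i, 1))⁻¹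

theorem IsCocycle.handle_eq_zero (ha : IsCocycle ρ a) {i : Fin g}
    (h : ∀ j, a (FreeGroup.of (i, j)) = 0) : a (handle i) = 0 := by
  rw [handle, ha, ha, ha, ha.map_inv, ha.map_inv, h, h]
  simp

/-- The cup product pairing on cocycles, evaluated on the distinguished chain, is nondegenerate.
The cocycles `b` supported on the `i`-th handle suffice to show that `a` vanishes on that handle,
once it vanishes on the earlier ones: the only terms of the pairing that survive are those of a
single commutator. -/
theorem eq_zero_of_cupFox_eq_zero (hB : ∀ u x y, B (ρ u x) (ρ u y) = B x y)
    (hnd : ∀ x, (∀ y, B x y = 0) → x = 0) (ha : IsCocycle ρ a)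
    (h : ∀ b, IsCocycle ρ b → cupFox ρ B a b (surfaceRelation g) = 0) : a = 0 := by
  have main : ∀ (m : ℕ) (i : Fin g), (i : ℕ) = m → ∀ j, a (FreeGroup.of (i, j)) = 0 := by
    intro m
    induction m using Nat.strong_induction_on with
    | _ m ih =>
      intro i hi
      have key : a (FreeGroup.of (i, 0)) = 0 ∧ a (FreeGroup.of (i, 1)) = 0 := by
        refine eq_zero_of_cupFox_commutator hB hnd ha fun p q => ?_
        -- test against cocycles supported on the `i`-th handle
        set b := foxCocycle ρ fun s : Fin g × Fin 2 =>
          if s = (i, 0) then p else if s = (i, 1) then q else 0 with hbdef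
        have hb : IsCocycle ρ b := isCocycle_foxCocycle ρ _
        have hbi : ∀ k, k ≠ i → ∀ j, b (FreeGroup.of (k, j)) = 0 := fun k hk j => by
          rw [hbdef, foxCocycle_of]
          simp [hk]
        refine ⟨b, hb, by rw [hbdef, foxCocycle_of]; simp, by rw [hbdef, foxCocycle_of]; simp, ?_⟩
        have hR := h b hb
        have hoff : ∀ k, k ≠ i → b (handle k) = 0 ∧ cupFox ρ B a b (handle k) = 0 := by
          intro k hk
          refine ⟨hb.handle_eq_zero (hbi k hk), ?_⟩
          rw [handle, cupFox_commutator hB ha hb, hbi k hk, hbi k hk]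
          simp
        have hsplit : surfaceRelation g = ((List.ofFn handle).take i).prod * handle i *
            ((List.ofFn handle).drop (i + 1)).prod := prod_ofFn_take_eq handle i
        have hpre : ∀ w ∈ (List.ofFn (handle (g := g))).take i, ∃ k : Fin g, k < i ∧ handle k = w := by
          intro w hw
          obtain ⟨k, hk, rfl⟩ := List.mem_take_iff_getElem.1 hw
          simp only [List.length_ofFn, lt_min_iff] at hk
          exact ⟨⟨k, hk.2⟩, hk.1, by simp⟩
        have hpost : ∀ w ∈ (List.ofFn (handle (g := g))).drop (i + 1),
            ∃ k : Fin g, i < k ∧ handle k = w := by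
          intro w hw
          obtain ⟨k, hk, rfl⟩ := List.mem_drop_iff_getElem.1 hw
          simp only [List.length_ofFn] at hk
          exact ⟨⟨i + 1 + k, by omega⟩, Fin.lt_def.2 (by simp; omega), by simp⟩
        rw [hsplit, cupFox_mul hB ha hb, cupFox_mul hB ha hb,
          cupFox_list_prod_eq_zero hB ha hb _ fun w hw => ?_,
          cupFox_list_prod_eq_zero hB ha hb ((List.ofFn handle).drop (i + 1)) fun w hw => ?_,
          ha.list_prod_eq_zero _ fun w hw => ?_,
          hb.list_prod_eq_zero ((List.ofFn handle).drop (i + 1)) fun w hw => ?_] at hR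
        · simpa [handle] using hR
        · obtain ⟨k, hk, rfl⟩ := hpost w hw
          exact (hoff k hk.ne').1
        · obtain ⟨k, hk, rfl⟩ := hpre w hw
          exact ha.handle_eq_zero (ih k (hi ▸ hk) k rfl)
        · obtain ⟨k, hk, rfl⟩ := hpost w hw
          exact hoff k hk.ne'
        · obtain ⟨k, hk, rfl⟩ := hpre w hw
          exact hoff k hk.ne
      intro j
      fin_cases j
      · exact key.1
      · exact key.2
  refine ha.ext (fun v w => by simp) ?_
  rintro ⟨i, j⟩
  exact main i i rfl j

end Cocycles

/-! ### The derivative of evaluation maps -/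

section Derivative

variable {n g : ℕ}

theorem coe_Ad (k : SU n) (X : su n) :
    (Ad k X : Mat n) = (k : Mat n) * (X : Mat n) * ((k⁻¹ : SU n) : Mat n) := rfl

theorem SU.coe_mul_inv (k : SU n) : (k : Mat n) * ((k⁻¹ : SU n) : Mat n) = 1 :=
  SU.mul_conjTranspose k

theorem SU.coe_inv_mul (k : SU n) : ((k⁻¹ : SU n) : Mat n) * (k : Mat n) = 1 :=
  SU.conjTranspose_mul k

/-- The adjoint representation of `SU(n)`. -/
def adRep (n : ℕ) : Representation ℝ (SU n) (su n) where
  toFun k :=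
    { toFun := Ad k
      map_add' := fun X Y => Subtype.ext <| by simp [coe_Ad, mul_add, add_mul]
      map_smul' := fun c X => Subtype.ext <| by simp [coe_Ad] }
  map_one' := LinearMap.ext fun X => Subtype.ext <| by simp [coe_Ad]
  map_mul' k l := LinearMap.ext fun X => Subtype.ext <| by simp [coe_Ad, mul_assoc]

theorem adRep_apply (k : SU n) (X : su n) : adRep n k X = Ad k X := rfl

/-- A homomorphism `h : F → SU(n)` makes `𝔰𝔲(n)` a representation of the free group. -/
def adRepOf (h : Y n g) : Representation ℝ (F g) (su n) := (adRep n).comp (FreeGroup.lift h)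

theorem adRepOf_apply (h : Y n g) (w : F g) (X : su n) : adRepOf h w X = Ad (eval w h) X := rfl

theorem eval_one (h : Y n g) : eval 1 h = 1 := map_one _

theorem eval_mul (v w : F g) (h : Y n g) : eval (v * w) h = eval v h * eval w h := map_mul _ v w

theorem eval_inv (w : F g) (h : Y n g) : eval w⁻¹ h = (eval w h)⁻¹ := map_inv _ w

theorem eval_of (s : Fin g × Fin 2) (h : Y n g) : eval (FreeGroup.of s) h = h s := by
  simp [eval]

theorem curve_zero (h : Y n g) (ξ : Fin g × Fin 2 → su n) : curve h ξ 0 = h := by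
  funext s
  refine Subtype.ext ?_
  simp [curve, expSU]

theorem hasDerivAt_star {c : ℝ → Mat n} {c' : Mat n} {t : ℝ} (hc : HasDerivAt c c' t) :
    HasDerivAt (fun t => (c t).conjTranspose) c'.conjTranspose t := hc.star

theorem differentiableAt_eval {c : ℝ → Y n g}
    (hc : ∀ s, DifferentiableAt ℝ (fun t => (c t s : Mat n)) 0) (w : F g) :
    DifferentiableAt ℝ (fun t => (eval w (c t) : Mat n)) 0 := by
  have hinv : ∀ {f : ℝ → SU n}, DifferentiableAt ℝ (fun t => (f t : Mat n)) 0 →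
      DifferentiableAt ℝ (fun t => ((f t)⁻¹ : SU n).1) 0 := fun hf =>
    (hasDerivAt_star hf.hasDerivAt).differentiableAt
  induction w using FreeGroup.induction_on with
  | C1 => simp only [eval_one]; exact differentiableAt_const _
  | of s => simpa only [eval_of] using hc s
  | inv_of s h => simpa only [eval_inv] using hinv h
  | mul v w hv hw =>
    simp only [eval_mul, Submonoid.coe_mul]
    exact hv.mul hw

theorem mcRight_mul {c d : ℝ → SU n} (hc : DifferentiableAt ℝ (fun t => (c t : Mat n)) 0)
    (hd : DifferentiableAt ℝ (fun t => (d t : Mat n)) 0) :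
    mcRight (fun t => c t * d t) = mcRight c + Ad (c 0) (mcRight d) := by
  refine Subtype.ext ?_
  have h : velocity (fun t => c t * d t) =
      velocity c * (d 0 : Mat n) + (c 0 : Mat n) * velocity d := by
    simp only [velocity, Submonoid.coe_mul]
    exact (hc.hasDerivAt.mul hd.hasDerivAt).deriv
  simp only [mcRight, h, mul_inv_rev, Submonoid.coe_mul, Submodule.coe_add, coe_Ad, add_mul]
  congr 1
  · rw [mul_assoc, ← mul_assoc (d 0 : Mat n), SU.coe_mul_inv, one_mul]
  · simp only [mul_assoc]

theorem mcLeft_eq (c : ℝ → SU n) : mcLeft c = Ad (c 0)⁻¹ (mcRight c) := by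
  refine Subtype.ext ?_
  simp only [mcLeft, mcRight, coe_Ad, inv_inv]
  rw [mul_assoc, mul_assoc, SU.coe_inv_mul, mul_one]

theorem hasDerivAt_exp_su (X : su n) :
    HasDerivAt (fun t : ℝ => (expSU (t • X) : Mat n)) (X : Mat n) 0 := by
  have h := hasDerivAt_exp_smul_const (𝕂 := ℝ) (X : Mat n) (0 : ℝ)
  rw [zero_smul, NormedSpace.exp_zero, one_mul] at h
  exact h

theorem hasDerivAt_curve (h : Y n g) (ξ : Fin g × Fin 2 → su n) (s : Fin g × Fin 2) :
    HasDerivAt (fun t => (curve h ξ t s : Mat n)) ((h s : Mat n) * (ξ s : Mat n)) 0 :=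
  (hasDerivAt_exp_su (ξ s)).const_mul (h s : Mat n)

/-- The right logarithmic derivative of `eval w` at `h` in the direction `h ξ`. -/
def dEval (h : Y n g) (ξ : Fin g × Fin 2 → su n) (w : F g) : su n :=
  mcRight fun t => eval w (curve h ξ t)

theorem isCocycle_mcRight {c : ℝ → Y n g}
    (hc : ∀ s, DifferentiableAt ℝ (fun t => (c t s : Mat n)) 0) :
    IsCocycle (adRepOf (c 0)) fun w => mcRight fun t => eval w (c t) := by
  intro v w
  simp only [eval_mul]
  rw [mcRight_mul (differentiableAt_eval hc v) (differentiableAt_eval hc w)]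
  rfl

theorem isCocycle_dEval (h : Y n g) (ξ : Fin g × Fin 2 → su n) :
    IsCocycle (adRepOf h) (dEval h ξ) := by
  have := isCocycle_mcRight (c := curve h ξ) fun s => (hasDerivAt_curve h ξ s).differentiableAt
  rwa [curve_zero] at this

theorem dEval_of (h : Y n g) (ξ : Fin g × Fin 2 → su n) (s : Fin g × Fin 2) :
    dEval h ξ (FreeGroup.of s) = Ad (h s) (ξ s) := by
  refine Subtype.ext ?_
  simp only [dEval, mcRight, eval_of, curve_zero, velocity, (hasDerivAt_curve h ξ s).deriv, coe_Ad]

/-- The logarithmic derivative of `eval w` along any differentiable curve. -/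
theorem mcRight_eval {c : ℝ → Y n g} (hc : ∀ s, DifferentiableAt ℝ (fun t => (c t s : Mat n)) 0)
    (w : F g) : mcRight (fun t => eval w (c t)) = dEval (c 0) (fun s => mcLeft fun t => c t s) w := by
  refine congrFun ((isCocycle_mcRight hc).ext (isCocycle_dEval _ _) fun s => ?_) w
  rw [dEval_of, mcLeft_eq]
  simp only [eval_of]
  rw [← adRep_apply, ← adRep_apply, Representation.self_inv_apply]

theorem mcLeft_eval_curve (h : Y n g) (ξ : Fin g × Fin 2 → su n) (w : F g) :
    mcLeft (fun t => eval w (curve h ξ t)) = Ad (eval w h)⁻¹ (dEval h ξ w) := by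
  rw [mcLeft_eq, curve_zero]
  rfl

/-- `ξ ↦ dEval h ξ w` is linear. -/
def dEvalL (h : Y n g) (w : F g) : (Fin g × Fin 2 → su n) →ₗ[ℝ] su n where
  toFun ξ := dEval h ξ w
  map_add' ξ ζ := congrFun ((isCocycle_dEval h (ξ + ζ)).ext
    ((isCocycle_dEval h ξ).add (isCocycle_dEval h ζ)) fun s => by
      simp only [dEval_of, Pi.add_apply, ← adRep_apply, map_add]) w
  map_smul' c ξ := congrFun ((isCocycle_dEval h (c • ξ)).ext
    ((isCocycle_dEval h ξ).smul c) fun s => by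
      simp only [dEval_of, Pi.smul_apply, ← adRep_apply, map_smul]) w

theorem dEvalL_apply (h : Y n g) (w : F g) (ξ : Fin g × Fin 2 → su n) :
    dEvalL h w ξ = dEval h ξ w := rfl

/-- Every cocycle on the free group is an infinitesimal deformation of `h`. -/
theorem exists_dEval_eq (h : Y n g) {b : F g → su n} (hb : IsCocycle (adRepOf h) b) :
    ∃ ξ, dEval h ξ = b := by
  refine ⟨fun s => Ad (h s)⁻¹ (b (FreeGroup.of s)), (isCocycle_dEval h _).ext hb fun s => ?_⟩
  rw [dEval_of, ← adRep_apply, ← adRep_apply, Representation.self_inv_apply]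

/-- The infinitesimal conjugation action: `h ξ` with `ξ_s = Ad(h_s)⁻¹ X - X` is the velocity at
`0` of the curve `t ↦ exp(tX) h exp(-tX)`. -/
def orbitDir (h : Y n g) : su n →ₗ[ℝ] (Fin g × Fin 2 → su n) where
  toFun X := fun s => Ad (h s)⁻¹ X - X
  map_add' X Y := by
    funext s
    simp only [Pi.add_apply, ← adRep_apply, map_add]; abel
  map_smul' c X := by
    funext s
    simp only [Pi.smul_apply, ← adRep_apply, map_smul, smul_sub, RingHom.id_apply]

theorem orbitDir_apply (h : Y n g) (X : su n) (s : Fin g × Fin 2) :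
    orbitDir h X s = Ad (h s)⁻¹ X - X := rfl

theorem dEval_orbitDir (h : Y n g) (X : su n) :
    dEval h (orbitDir h X) = fun w => X - adRepOf h w X := by
  refine (isCocycle_dEval h _).ext (IsCocycle.coboundary X) fun s => ?_
  rw [dEval_of, orbitDir_apply, adRepOf_apply, eval_of, ← adRep_apply, ← adRep_apply, map_sub,
    Representation.self_inv_apply, adRep_apply]

theorem dEval_injective (h : Y n g) {ξ ζ : Fin g × Fin 2 → su n} (e : dEval h ξ = dEval h ζ) :
    ξ = ζ := by
  funext s
  have := congrFun e (FreeGroup.of s)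
  rw [dEval_of, dEval_of] at this
  have := congrArg (adRep n (h s)⁻¹) this
  simpa only [← adRep_apply, Representation.inv_self_apply] using this

theorem pullbackOmega_eq (B : InvariantInnerProduct n) (p : F g × F g) (h : Y n g)
    (ξ ζ : Fin g × Fin 2 → su n) :
    pullbackOmega B p h ξ ζ =
      B.form (dEval h ξ p.1) (Ad (eval p.1 h) (dEval h ζ p.2)) -
      B.form (dEval h ζ p.1) (Ad (eval p.1 h) (dEval h ξ p.2)) := by
  have e : ∀ ξ ζ, B.form (mcLeft fun t => eval p.1 (curve h ξ t))
      (mcRight fun t => eval p.2 (curve h ζ t)) =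
      B.form (dEval h ξ p.1) (Ad (eval p.1 h) (dEval h ζ p.2)) := by
    intro ξ ζ
    rw [mcLeft_eval_curve, ← B.invariant (eval p.1 h), ← adRep_apply, ← adRep_apply,
      Representation.self_inv_apply]
    rfl
  rw [pullbackOmega, e, e]

/-- The 2-form `ω` is the antisymmetrized cup product, evaluated on the distinguished chain. -/
theorem omega_eq (B : InvariantInnerProduct n) (h : Y n g) (ξ ζ : Fin g × Fin 2 → su n) :
    omega B h ξ ζ =
      cupFox (adRepOf h) B.form (dEval h ξ) (dEval h ζ) (surfaceRelation g) -
      cupFox (adRepOf h) B.form (dEval h ζ) (dEval h ξ) (surfaceRelation g) := by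
  rw [omega, surfaceChain, ← Finsupp.sum_finsetSum_index (fun p => by simp)
    (fun p a b => by push_cast; ring), cupFox, cupFox, ← Finset.sum_sub_distrib]
  refine Finset.sum_congr rfl fun s _ => ?_
  rw [Finsupp.sum_mapDomain_index (fun p => by simp) (fun p a b => by push_cast; ring),
    pairing_apply, pairing_apply, ← Finsupp.sum_sub]
  refine Finsupp.sum_congr fun u _ => ?_
  simp only [pullbackOmega_eq, adRepOf_apply, zsmul_eq_mul]
  ring

end Derivative

/-! ### Consequences of nondegeneracy -/

section Nondegeneracy

variable {n g : ℕ}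

instance : FiniteDimensional ℝ (su n) := inferInstance

theorem InvariantInnerProduct.eq_zero (B : InvariantInnerProduct n) (X : su n)
    (h : ∀ Y, B.form X Y = 0) : X = 0 := by
  by_contra hX
  exact (B.pos X hX).ne' (h X)

theorem InvariantInnerProduct.exists_eq (B : InvariantInnerProduct n) (f : su n →ₗ[ℝ] ℝ) :
    ∃ X, ∀ Y, f Y = B.form X Y := by
  have hinj : Function.Injective B.form := by
    rw [injective_iff_map_eq_zero]
    exact fun X hX => B.eq_zero X fun Y => by rw [hX]; rfl
  have hsurj : Function.Surjective B.form :=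
    (LinearMap.injective_iff_surjective_of_finrank_eq_finrank (K := ℝ) (V := su n)
      (V₂ := Module.Dual ℝ (su n)) Subspace.dual_finrank_eq.symm).1 hinj
  obtain ⟨X, hX⟩ := hsurj f
  exact ⟨X, fun Y => by rw [hX]⟩

theorem InvariantInnerProduct.form_adRepOf (B : InvariantInnerProduct n) (h : Y n g) (u : F g)
    (x y : su n) : B.form (adRepOf h u x) (adRepOf h u y) = B.form x y :=
  B.invariant _ _ _

/-- The stabilizer of `h` under conjugation has trivial Lie algebra. -/
def HasTrivialStabilizer (h : Y n g) : Prop := ∀ X : su n, (∀ s, Ad (h s) X = X) → X = 0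

theorem orbitDir_injective {h : Y n g} (hirr : HasTrivialStabilizer h) :
    Function.Injective (orbitDir h) := by
  rw [injective_iff_map_eq_zero]
  intro X hX
  refine hirr X fun s => ?_
  have := congrFun hX s
  rw [orbitDir_apply, Pi.zero_apply, sub_eq_zero] at this
  have := congrArg (adRep n (h s)) this
  rw [← adRep_apply, Representation.self_inv_apply] at this
  exact this.symm

/-- At an irreducible `h` the differential of `ε_R` is onto: an `X` orthogonal to the image has
`⟨X, b(R)⟩ = (δX ∪ b)[c] = 0` for all cocycles `b`, hence `δX = 0`. -/
theorem dEvalL_surjective (B : InvariantInnerProduct n) {h : Y n g}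
    (hirr : HasTrivialStabilizer h) :
    Function.Surjective (dEvalL h (surfaceRelation g)) := by
  rw [← LinearMap.range_eq_top]
  by_contra hne
  obtain ⟨f, hf, hker⟩ := Submodule.exists_le_ker_of_lt_top _ (lt_top_iff_ne_top.2 hne)
  obtain ⟨X, hX⟩ := B.exists_eq f
  refine hf (LinearMap.ext fun Z => ?_)
  have hδ : (fun w => X - adRepOf h w X) = 0 := by
    refine eq_zero_of_cupFox_eq_zero (B.form_adRepOf h) B.eq_zero (IsCocycle.coboundary X)
      fun b hb => ?_
    rw [cupFox_coboundary_left (B.form_adRepOf h) hb, ← hX]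
    obtain ⟨ξ, rfl⟩ := exists_dEval_eq h hb
    exact hker ⟨ξ, rfl⟩
  have : X = 0 := hirr X fun s => by
    have := congrFun hδ (FreeGroup.of s)
    simp only [adRepOf_apply, eval_of, Pi.zero_apply, sub_eq_zero] at this
    exact this.symm
  rw [hX, this, map_zero]

/-- The orbit directions are in the radical of `ω` on the kernel of the differential of `ε_R`. -/
theorem omega_orbitDir (B : InvariantInnerProduct n) (h : Y n g) (X : su n)
    {ζ : Fin g × Fin 2 → su n} (hζ : dEval h ζ (surfaceRelation g) = 0) :
    omega B h (orbitDir h X) ζ = 0 := by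
  have h1 := cupFox_coboundary_left (B.form_adRepOf h) (isCocycle_dEval h ζ) X
  have h2 := cupFox_swap (B.form_adRepOf h) B.symm (IsCocycle.coboundary X) (isCocycle_dEval h ζ)
  rw [hζ, map_zero] at h1 h2
  rw [omega_eq, dEval_orbitDir, h1]
  linarith

/-- The pairing `ζ ↦ (a ∪ dEval h ζ)[c]` as a linear functional. -/
def cupFoxL (B : InvariantInnerProduct n) (h : Y n g) (a : F g → su n) :
    (Fin g × Fin 2 → su n) →ₗ[ℝ] ℝ where
  toFun ζ := cupFox (adRepOf h) B.form a (dEval h ζ) (surfaceRelation g)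
  map_add' ζ η := by
    have : ∀ w, dEval h (ζ + η) w = dEval h ζ w + dEval h η w := fun w => (dEvalL h w).map_add ζ η
    simp only [cupFox, this, map_add, pairing_add, Finset.sum_add_distrib]
  map_smul' c ζ := by
    have : ∀ w, dEval h (c • ζ) w = c • dEval h ζ w := fun w => (dEvalL h w).map_smul c ζ
    simp only [cupFox, this, map_smul, RingHom.id_apply, Finset.smul_sum]
    exact Finset.sum_congr rfl fun s _ => pairing_map (LinearMap.lsmul ℝ ℝ c) _ _

/-- On the kernel of the differential of `ε_R`, the radical of `ω` consists of orbit directions. -/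
theorem exists_eq_orbitDir (B : InvariantInnerProduct n) {h : Y n g}
    (hirr : HasTrivialStabilizer h) {ξ : Fin g × Fin 2 → su n}
    (hξ : dEval h ξ (surfaceRelation g) = 0)
    (hω : ∀ ζ, dEval h ζ (surfaceRelation g) = 0 → omega B h ξ ζ = 0) :
    ∃ X, ξ = orbitDir h X := by
  obtain ⟨r, hr⟩ := (dEvalL h (surfaceRelation g)).exists_rightInverse_of_surjective
    (LinearMap.range_eq_top.2 (dEvalL_surjective B hirr))
  set φ := cupFoxL B h (dEval h ξ) with hφ
  have hφ0 : ∀ ζ, dEval h ζ (surfaceRelation g) = 0 → φ ζ = 0 := by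
    intro ζ hζ
    have h1 := hω ζ hζ
    have h2 := cupFox_swap (B.form_adRepOf h) B.symm (isCocycle_dEval h ξ) (isCocycle_dEval h ζ)
    rw [hξ, map_zero, LinearMap.zero_apply] at h2
    rw [omega_eq] at h1
    change cupFox (adRepOf h) B.form (dEval h ξ) (dEval h ζ) (surfaceRelation g) = 0
    linarith
  obtain ⟨X, hX⟩ := B.exists_eq (φ.comp r)
  have hfac : ∀ ζ, φ ζ = B.form X (dEval h ζ (surfaceRelation g)) := by
    intro ζ
    rw [← hX, LinearMap.comp_apply, ← sub_eq_zero, ← map_sub]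
    refine hφ0 _ ?_
    rw [← dEvalL_apply, map_sub, ← dEvalL_apply, ← LinearMap.comp_apply (f := dEvalL _ _), hr,
      LinearMap.id_apply, sub_self]
  refine ⟨X, dEval_injective h ?_⟩
  rw [dEval_orbitDir, ← sub_eq_zero]
  refine eq_zero_of_cupFox_eq_zero (B.form_adRepOf h) B.eq_zero
    ((isCocycle_dEval h ξ).sub (IsCocycle.coboundary X)) fun b hb => ?_
  obtain ⟨ζ, rfl⟩ := exists_dEval_eq h hb
  rw [cupFox_sub, cupFox_coboundary_left (B.form_adRepOf h) hb, sub_eq_zero]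
  exact hfac ζ

end Nondegeneracy

/-! ### Irreducibility -/

section Irreducible

variable {n g : ℕ}

/-- Some power of a generator of the centre is a primitive `n`-th root of unity times the identity. -/
theorem exists_scalar_generator (hn : 1 ≤ n) {β : SU n}
    (hβ : Subgroup.zpowers β = Subgroup.center (SU n)) :
    ∃ (ζ : ℂ) (m : ℤ), IsPrimitiveRoot ζ n ∧ ((β ^ m : SU n) : Mat n) = ζ • (1 : Mat n) := by
  have hprim := Complex.isPrimitiveRoot_exp n (by omega)
  set ζ := Complex.exp (2 * Real.pi * Complex.I / n) with hζ
  have hstar : star ζ * ζ = 1 := by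
    have : ‖ζ‖ = 1 := hprim.norm'_eq_one (by omega)
    rw [Complex.star_def, mul_comm, Complex.mul_conj, Complex.normSq_eq_norm_sq, this]
    simp
  have hmem : ζ • (1 : Mat n) ∈ Matrix.specialUnitaryGroup (Fin n) ℂ := by
    rw [Matrix.mem_specialUnitaryGroup_iff, Matrix.mem_unitaryGroup_iff']
    refine ⟨?_, ?_⟩
    · rw [star_smul, star_one, smul_mul_smul_comm, hstar]; simp
    · rw [Matrix.det_smul, Matrix.det_one, mul_one, Fintype.card_fin, hprim.pow_eq_one]
  have hc : (⟨_, hmem⟩ : SU n) ∈ Subgroup.center (SU n) := by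
    rw [Subgroup.mem_center_iff]
    intro k
    refine Subtype.ext ?_
    simp
  rw [← hβ] at hc
  obtain ⟨m, hm⟩ := hc
  exact ⟨ζ, m, hprim, congrArg Subtype.val hm⟩

/-- A matrix commuting with all `h_s` is scalar when `ε_R(h)` generates the centre: on an
eigenspace, of dimension `k`, the determinant of a product of commutators is `1`, but some power
of it is the determinant of a primitive root of unity, so that `n ∣ k`. -/
theorem eq_scalar_of_commute (hn : 1 ≤ n) {β : SU n}
    (hβ : Subgroup.zpowers β = Subgroup.center (SU n)) {h : Y n g} (hh : epsR h = β)
    {M : Mat n} (hM : ∀ s, (h s : Mat n) * M = M * (h s : Mat n)) :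
    ∃ c : ℂ, M = c • (1 : Mat n) := by
  have : NeZero n := ⟨by omega⟩
  obtain ⟨ζ, m, hζ, hζm⟩ := exists_scalar_generator hn hβ
  have hinv : ∀ k : SU n, (k : Mat n) * M = M * (k : Mat n) →
      ((k⁻¹ : SU n) : Mat n) * M = M * ((k⁻¹ : SU n) : Mat n) := by
    intro k hk
    calc ((k⁻¹ : SU n) : Mat n) * M = (k⁻¹ : SU n).1 * (M * k.1) * (k⁻¹ : SU n).1 := by
          rw [mul_assoc, mul_assoc, SU.coe_mul_inv, mul_one]
      _ = M * ((k⁻¹ : SU n) : Mat n) := by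
          rw [← hk, ← mul_assoc, SU.coe_inv_mul, one_mul]
  have hcomm : ∀ w : F g, (eval w h : Mat n) * M = M * (eval w h : Mat n) := by
    intro w
    induction w using FreeGroup.induction_on with
    | C1 => simp [eval_one]
    | of s => simpa only [eval_of] using hM s
    | inv_of s hs => rw [eval_inv]; exact hinv _ hs
    | mul v w hv hw =>
      rw [eval_mul, Submonoid.coe_mul, mul_assoc, hw, ← mul_assoc, hv, mul_assoc]
  obtain ⟨c, hc⟩ := Module.End.exists_eigenvalue (Matrix.toLin' M)
  set W := Module.End.eigenspace (Matrix.toLin' M) c with hW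
  have hmaps : ∀ w : F g, ∀ x ∈ W, Matrix.toLin' (eval w h : Mat n) x ∈ W := by
    intro w x hx
    rw [hW, Module.End.mem_eigenspace_iff] at hx ⊢
    rw [← LinearMap.comp_apply, ← Matrix.toLin'_mul, ← hcomm, Matrix.toLin'_mul,
      LinearMap.comp_apply, hx, map_smul]
  let χ : F g →* ℂ :=
    { toFun := fun w => LinearMap.det ((Matrix.toLin' (eval w h : Mat n)).restrict (hmaps w))
      map_one' := by
        rw [← map_one (LinearMap.det (M := W))]
        congr 1
        ext x : 2
        simp [LinearMap.restrict_apply, eval_one]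
      map_mul' := fun v w => by
        rw [← map_mul]
        congr 1
        ext x : 2
        simp [LinearMap.restrict_apply, eval_mul, Matrix.mulVec_mulVec] }
  have hR : χ.toHomUnits (surfaceRelation g) = 1 := map_surfaceRelation χ.toHomUnits
  have hRm : χ (surfaceRelation g ^ m) = 1 := by
    have : χ.toHomUnits (surfaceRelation g ^ m) = 1 := by rw [map_zpow, hR, one_zpow]
    exact congrArg Units.val this
  have hev : (eval (surfaceRelation g ^ m) h : Mat n) = ζ • 1 := by
    rw [← hζm, ← hh]
    exact congrArg Subtype.val (map_zpow (FreeGroup.lift h) (surfaceRelation g) m)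
  have hdet : ζ ^ Module.finrank ℂ W = 1 := by
    rw [← hRm]
    change _ = LinearMap.det ((Matrix.toLin' (eval (surfaceRelation g ^ m) h : Mat n)).restrict _)
    have : (Matrix.toLin' (eval (surfaceRelation g ^ m) h : Mat n)).restrict (hmaps _) =
        ζ • (LinearMap.id : W →ₗ[ℂ] W) := by
      ext x : 2
      simp [LinearMap.restrict_apply, hev]
    rw [this, LinearMap.det_smul, LinearMap.det_id, mul_one]
  have hpos : 0 < Module.finrank ℂ W := by
    rw [Module.finrank_pos_iff]
    exact Submodule.nontrivial_iff_ne_bot.2 hc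
  have hle := Nat.le_of_dvd hpos (hζ.dvd_of_pow_eq_one _ hdet)
  have htop : W = ⊤ := by
    refine Submodule.eq_top_of_finrank_eq (le_antisymm (Submodule.finrank_le _) ?_)
    simpa using hle
  refine ⟨c, Matrix.toLin'.injective (LinearMap.ext fun x => ?_)⟩
  have hx : x ∈ W := htop ▸ Submodule.mem_top
  rw [hW, Module.End.mem_eigenspace_iff] at hx
  rw [hx]
  simp

theorem hasTrivialStabilizer (hn : 1 ≤ n) {β : SU n}
    (hβ : Subgroup.zpowers β = Subgroup.center (SU n)) {h : Y n g} (hh : epsR h = β) :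
    HasTrivialStabilizer h := by
  intro X hX
  obtain ⟨c, hc⟩ := eq_scalar_of_commute hn hβ hh (M := (X : Mat n)) fun s => by
    have := congrArg Subtype.val (hX s)
    rw [coe_Ad] at this
    nth_rw 2 [← this]
    rw [mul_assoc, SU.coe_inv_mul, mul_one]
  have ht := X.2.2
  rw [hc, Matrix.trace_smul, Matrix.trace_one, Fintype.card_fin, smul_eq_mul, mul_eq_zero] at ht
  refine Subtype.ext ?_
  rw [hc]
  rcases ht with ht | ht
  · simp [ht]
  · exact absurd (Nat.cast_eq_zero.1 ht) (by omega)

theorem mem_center_of_conj_eq (hn : 1 ≤ n) {β : SU n}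
    (hβ : Subgroup.zpowers β = Subgroup.center (SU n)) {h : Y n g} (hh : epsR h = β) {k : SU n}
    (hk : ∀ s, k * h s * k⁻¹ = h s) : k ∈ Subgroup.center (SU n) := by
  obtain ⟨c, hc⟩ := eq_scalar_of_commute hn hβ hh (M := (k : Mat n)) fun s => by
    have h1 : h s * k = k * h s := by nth_rw 1 [← hk s]; group
    exact congrArg Subtype.val h1
  rw [Subgroup.mem_center_iff]
  intro l
  refine Subtype.ext ?_
  simp [hc]

end Irreducible

/-! ### Logarithmic charts -/

section InverseFunction

variable {E F : Type*} [NormedAddCommGroup E] [NormedSpace ℝ E] [CompleteSpace E]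
  [NormedAddCommGroup F] [NormedSpace ℝ F]

/-- The analytic inverse function theorem on an open set, inside a prescribed neighbourhood. -/
theorem exists_openPartialHomeomorph_of_contDiffAt {f : E → F} {a : E} (hf : ContDiffAt ℝ ω f a)
    {f' : E ≃L[ℝ] F} (hf' : HasFDerivAt f (f' : E →L[ℝ] F) a) {N : Set E} (hN : N ∈ nhds a) :
    ∃ e : OpenPartialHomeomorph E F, a ∈ e.source ∧ e.source ⊆ N ∧ (e : E → F) = f ∧
      ContDiffOn ℝ ω f e.source ∧ ContDiffOn ℝ ω e.symm e.target := by
  have hω : (ω : WithTop ℕ∞) ≠ 0 := by simp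
  have hω' : (ω : WithTop ℕ∞) ≠ ∞ := by simp
  set e₀ := hf.toOpenPartialHomeomorph f hf' hω with he₀
  have ha : a ∈ e₀.source := hf.mem_toOpenPartialHomeomorph_source hf' hω
  have h1 := hf.eventually hω'
  have h2 : ∀ᶠ y in nhds (f a), ContDiffAt ℝ ω e₀.symm y :=
    (hf.to_localInverse hf' hω).eventually hω'
  have h3 : ∀ᶠ x in nhds a, ContDiffAt ℝ ω f x ∧ ContDiffAt ℝ ω e₀.symm (f x) ∧ x ∈ N :=
    h1.and ((hf.continuousAt.eventually h2).and hN)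
  obtain ⟨S, hS, hSo, haS⟩ := eventually_nhds_iff.1 h3
  refine ⟨e₀.restrOpen S hSo, ⟨ha, haS⟩, fun x hx => (hS x hx.2).2.2, rfl,
    fun x hx => (hS x hx.2).1.contDiffWithinAt, fun y hy => ?_⟩
  have hy1 : y ∈ e₀.target := hy.1
  have hy2 : e₀.symm y ∈ S := hy.2
  have h := (hS _ hy2).2.1
  have e : f (e₀.symm y) = y := e₀.right_inv hy1
  rw [e] at h
  exact h.contDiffWithinAt

end InverseFunction

section Log

variable {n g : ℕ}

theorem contDiff_exp_mat {m : WithTop ℕ∞} : ContDiff ℝ m (NormedSpace.exp : Mat n → Mat n) :=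
  contDiff_iff_contDiffAt.2 fun x => (NormedSpace.exp_analytic (𝕂 := ℝ) x).contDiffAt

theorem contDiff_expSU {m : WithTop ℕ∞} : ContDiff ℝ m fun X : su n => (expSU X : Mat n) :=
  contDiff_exp_mat.comp (su n).subtypeL.contDiff

/-- An analytic local inverse, defined on an open set `dom` of matrices, of the exponential map of
`SU(n)`, restricted to an open neighbourhood `cod` of `0` in `𝔰𝔲(n)`. It is defined on matrices, so
that smoothness can be stated in a vector space, but is an inverse only on `dom ∩ SU(n)`. -/
structure LogChart (n : ℕ) where
  log : Mat n → su n
  dom : Set (Mat n)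
  cod : Set (su n)
  isOpen_dom : IsOpen dom
  isOpen_cod : IsOpen cod
  zero_mem : (0 : su n) ∈ cod
  contDiffOn_log : ContDiffOn ℝ ω log dom
  exp_mem : ∀ X ∈ cod, (expSU X : Mat n) ∈ dom
  log_exp : ∀ X ∈ cod, log (expSU X : Mat n) = X
  log_mem : ∀ k : SU n, (k : Mat n) ∈ dom → log (k : Mat n) ∈ cod
  exp_log : ∀ k : SU n, (k : Mat n) ∈ dom → expSU (log (k : Mat n)) = k

theorem exp_smul_one (c : ℂ) : NormedSpace.exp (c • (1 : Mat n)) = Complex.exp c • (1 : Mat n) := by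
  have h := NormedSpace.algebraMap_exp_comm (𝔸 := Mat n) c
  rw [Algebra.algebraMap_eq_smul_one, Algebra.algebraMap_eq_smul_one] at h
  rw [← h, Complex.exp_eq_exp_ℂ]

/-- A skew-Hermitian matrix of small trace whose exponential has determinant `1` is trace free. -/
theorem trace_eq_zero_of_det_exp (hn : 1 ≤ n) {X : Mat n} (hX : X.conjTranspose = -X)
    (hd : (NormedSpace.exp X).det = 1) (ht : ‖X.trace‖ < 1) : X.trace = 0 := by
  have hn0 : (n : ℂ) ≠ 0 := Nat.cast_ne_zero.2 (by omega)
  set τ := X.trace with hτ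
  have hτs : star τ = -τ := by
    rw [hτ, ← Matrix.trace_conjTranspose, hX, Matrix.trace_neg]
  set A : Mat n := X - (τ / n) • 1 with hA
  have hAsu : A ∈ su n := by
    refine ⟨?_, ?_⟩
    · rw [hA, Matrix.conjTranspose_sub, hX, Matrix.conjTranspose_smul, Matrix.conjTranspose_one,
        star_div₀, hτs, Complex.star_def, Complex.conj_natCast, neg_div, neg_smul]
      abel
    · rw [hA, Matrix.trace_sub, Matrix.trace_smul, Matrix.trace_one, Fintype.card_fin, smul_eq_mul,
        div_mul_cancel₀ _ hn0, sub_self]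
  have hexp : NormedSpace.exp X = NormedSpace.exp A * (Complex.exp (τ / n) • (1 : Mat n)) := by
    rw [← exp_smul_one, ← Matrix.exp_add_of_commute, hA, sub_add_cancel]
    exact (Commute.one_right A).smul_right _
  have hdA : (NormedSpace.exp A).det = 1 := det_exp_su ⟨A, hAsu⟩
  rw [hexp, Matrix.det_mul, hdA, one_mul, Matrix.det_smul, Matrix.det_one, mul_one,
    Fintype.card_fin, ← Complex.exp_nat_mul, mul_div_cancel₀ _ hn0, Complex.exp_eq_one_iff] at hd
  obtain ⟨m, hm⟩ := hd
  rw [hm] at ht ⊢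
  rcases eq_or_ne m 0 with rfl | hm0
  · simp
  -- the trace is an integer multiple of `2πi`, of absolute value less than one
  · exfalso
    have h1 : (1 : ℝ) ≤ ‖(m : ℂ)‖ := by
      rw [Complex.norm_intCast]
      exact_mod_cast Int.one_le_abs hm0
    have h2 : ‖(2 * Real.pi * Complex.I : ℂ)‖ = 2 * Real.pi := by
      simp [abs_of_pos Real.pi_pos]
    rw [norm_mul, h2] at ht
    nlinarith [Real.pi_gt_three]

/-- The local inverse of the matrix exponential takes values in `𝔰𝔲(n)` on special unitary matrices:
for `exp X` unitary, `Xᴴ` and `-X` have the same exponential and so agree when `X` is small, and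
then `trace_eq_zero_of_det_exp` applies. -/
theorem nonempty_logChart (hn : 1 ≤ n) : Nonempty (LogChart n) := by
  obtain ⟨P, hP⟩ := (su n).subtype.exists_leftInverse_of_injective (su n).ker_subtype
  have hP' : ∀ X : su n, P (X : Mat n) = X := fun X => LinearMap.congr_fun hP X
  have h0 : HasFDerivAt (NormedSpace.exp : Mat n → Mat n)
      ((ContinuousLinearEquiv.refl ℝ (Mat n) : Mat n ≃L[ℝ] Mat n) : Mat n →L[ℝ] Mat n) 0 :=
    (hasStrictFDerivAt_exp_zero (𝕂 := ℝ) (𝔸 := Mat n)).hasFDerivAt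
  obtain ⟨e₀, h0s, -, he₀, -, -⟩ := exists_openPartialHomeomorph_of_contDiffAt
    contDiff_exp_mat.contDiffAt h0 Filter.univ_mem
  -- a neighbourhood of `0`, on which the exponential is injective even after `star` and `-`
  have hN : {X : Mat n | star X ∈ e₀.source ∧ -X ∈ e₀.source ∧ ‖X.trace‖ < 1} ∈ nhds (0 : Mat n) := by
    have hs : e₀.source ∈ nhds (0 : Mat n) := e₀.open_source.mem_nhds h0s
    have htr : Continuous fun X : Mat n => ‖X.trace‖ := (continuous_id.matrix_trace).norm
    refine Filter.inter_mem ?_ (Filter.inter_mem ?_ ?_)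
    · exact continuous_star.continuousAt.preimage_mem_nhds (by simpa using hs)
    · exact continuous_neg.continuousAt.preimage_mem_nhds (by simpa using hs)
    · exact (isOpen_lt htr continuous_const).mem_nhds (by simp)
  obtain ⟨e, hs, hsub, he, -, hsm⟩ := exists_openPartialHomeomorph_of_contDiffAt
    contDiff_exp_mat.contDiffAt h0 (Filter.inter_mem (e₀.open_source.mem_nhds h0s) hN)
  have hinj : ∀ X ∈ e₀.source, ∀ Z ∈ e₀.source, NormedSpace.exp X = NormedSpace.exp Z → X = Z :=
    fun X hX Z hZ h => e₀.injOn hX hZ (by rw [he₀]; exact h)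
  have hmem : ∀ k : SU n, (k : Mat n) ∈ e.target → e.symm (k : Mat n) ∈ su n := by
    intro k hk
    set X := e.symm (k : Mat n) with hX
    have hXs : X ∈ e.source := e.map_target hk
    have hXk : NormedSpace.exp X = (k : Mat n) := by rw [← he]; exact e.right_inv hk
    obtain ⟨-, h1, h2, h3⟩ := hsub hXs
    have hskew : X.conjTranspose = -X := by
      refine hinj _ h1 _ h2 ?_
      change NormedSpace.exp X.conjTranspose = _
      rw [Matrix.exp_conjTranspose, hXk, Matrix.exp_neg, hXk]
      exact (Matrix.inv_eq_left_inv (SU.conjTranspose_mul k)).symm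
    exact ⟨hskew, trace_eq_zero_of_det_exp hn hskew (by rw [hXk]; exact k.2.2) h3⟩
  have hPe : ∀ k : SU n, (k : Mat n) ∈ e.target → (P (e.symm (k : Mat n)) : Mat n) = e.symm k :=
    fun k hk => congrArg Subtype.val (hP' ⟨_, hmem k hk⟩)
  have hexp : ∀ X : su n, e (X : Mat n) = expSU X := fun X => by rw [he]; rfl
  exact ⟨{
    log := fun A => P (e.symm A)
    dom := e.target
    cod := {X | (X : Mat n) ∈ e.source}
    isOpen_dom := e.open_target
    isOpen_cod := e.open_source.preimage continuous_subtype_val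
    zero_mem := hs
    contDiffOn_log := P.toContinuousLinearMap.contDiff.comp_contDiffOn hsm
    exp_mem := fun X hX => by rw [← hexp]; exact e.map_source hX
    log_exp := fun X hX => by rw [← hexp, e.left_inv hX, hP']
    log_mem := fun k hk => by
      change (P (e.symm (k : Mat n)) : Mat n) ∈ e.source
      rw [hPe k hk]
      exact e.map_target hk
    exp_log := fun k hk => by
      refine Subtype.ext ?_
      rw [← hexp, hPe k hk, e.right_inv hk] }⟩

/-- `SU(n)^{2g} → Mat^{2g}`. -/
def inclY (h : Y n g) : Fin g × Fin 2 → Mat n := fun s => (h s : Mat n)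

theorem inclY_injective : Function.Injective (inclY (n := n) (g := g)) := fun h h' e => by
  funext s
  exact Subtype.ext (congrFun e s)

theorem isEmbedding_inclY : Topology.IsEmbedding (inclY (n := n) (g := g)) :=
  ⟨⟨by
    rw [Pi.topologicalSpace, Pi.topologicalSpace, induced_iInf]
    congr 1; funext s
    rw [instTopologicalSpaceSubtype, induced_compose, induced_compose]
    rfl⟩, inclY_injective⟩

/-- Evaluation on a word is the restriction of an analytic map of matrices. -/
theorem exists_contDiff_eval (n : ℕ) (w : F g) : ∃ f : (Fin g × Fin 2 → Mat n) → Mat n,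
    ContDiff ℝ ω f ∧ ∀ h : Y n g, f (inclY h) = eval w h := by
  have hstar : ContDiff ℝ ω fun A : Mat n => A.conjTranspose :=
    (starL' ℝ : Mat n ≃L[ℝ] Mat n).contDiff
  induction w using FreeGroup.induction_on with
  | C1 => exact ⟨fun _ => 1, contDiff_const, fun h => by simp [eval_one]⟩
  | of s => exact ⟨fun A => A s, contDiff_apply ℝ _ s, fun h => by rw [eval_of]; rfl⟩
  | inv_of s _ => exact ⟨fun A => (A s).conjTranspose, hstar.comp (contDiff_apply ℝ _ s),
      fun h => by rw [eval_inv, eval_of]; rfl⟩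
  | mul v w hv hw =>
    obtain ⟨p, hp, hp'⟩ := hv
    obtain ⟨q, hq, hq'⟩ := hw
    exact ⟨fun A => p A * q A, hp.mul hq, fun h => by
      simp only [hp', hq', eval_mul, Submonoid.coe_mul]⟩

/-- Exponential coordinates `ξ ↦ h exp(ξ)` of `SU(n)^{2g}` at `h`. -/
def expY (h : Y n g) (ξ : Fin g × Fin 2 → su n) : Y n g := fun s => h s * expSU (ξ s)

theorem contDiff_inclY_expY (h : Y n g) : ContDiff ℝ ω fun ξ => inclY (expY h ξ) := by
  refine contDiff_pi.2 fun s => ?_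
  exact contDiff_const.mul (contDiff_expSU.comp (contDiff_apply ℝ _ s))

theorem expSU_zero : expSU (0 : su n) = 1 := Subtype.ext (by simp [expSU])

theorem expY_zero (h : Y n g) : expY h 0 = h := by
  funext s
  simp [expY, expSU_zero]

namespace LogChart

variable (L : LogChart n)

theorem one_mem : (1 : Mat n) ∈ L.dom := by
  have := L.exp_mem 0 L.zero_mem
  rwa [expSU_zero] at this

theorem log_one : L.log 1 = 0 := by
  have := L.log_exp 0 L.zero_mem
  rwa [expSU_zero] at this

/-- Logarithmic coordinates of `SU(n)^{2g}` at `h`, extended to matrices. -/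
def logY (h : Y n g) (A : Fin g × Fin 2 → Mat n) : Fin g × Fin 2 → su n :=
  fun s => L.log (((h s)⁻¹ : SU n).1 * A s)

/-- The domain of the logarithmic coordinates at `h`. -/
def domY (h : Y n g) : Set (Fin g × Fin 2 → Mat n) :=
  {A | ∀ s, ((h s)⁻¹ : SU n).1 * A s ∈ L.dom}

/-- The range of the logarithmic coordinates. -/
def codY (g : ℕ) : Set (Fin g × Fin 2 → su n) := {ξ | ∀ s, ξ s ∈ L.cod}

theorem isOpen_domY (h : Y n g) : IsOpen (L.domY h) := by
  simp only [domY, Set.ofPred_forall]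
  exact isOpen_iInter_of_finite fun s =>
    L.isOpen_dom.preimage (continuous_const.mul (continuous_apply s))

theorem isOpen_codY : IsOpen (L.codY g) := by
  simp only [codY, Set.ofPred_forall]
  exact isOpen_iInter_of_finite fun s => L.isOpen_cod.preimage (continuous_apply s)

theorem zero_mem_codY : 0 ∈ L.codY g := fun _ => L.zero_mem

theorem contDiffOn_logY (h : Y n g) : ContDiffOn ℝ ω (L.logY h) (L.domY h) := by
  refine contDiffOn_pi.2 fun s => ?_
  exact L.contDiffOn_log.comp (contDiff_const.mul (contDiff_apply ℝ (Mat n) s)).contDiffOn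
    fun A hA => hA s

theorem expY_mem (h : Y n g) {ξ : Fin g × Fin 2 → su n} (hξ : ξ ∈ L.codY g) :
    inclY (expY h ξ) ∈ L.domY h := fun s => by
  have : ((h s)⁻¹ : SU n).1 * inclY (expY h ξ) s = (expSU (ξ s) : Mat n) := by
    rw [inclY, expY, Submonoid.coe_mul, ← mul_assoc, SU.coe_inv_mul, one_mul]
  rw [this]
  exact L.exp_mem _ (hξ s)

theorem logY_expY (h : Y n g) {ξ : Fin g × Fin 2 → su n} (hξ : ξ ∈ L.codY g) :
    L.logY h (inclY (expY h ξ)) = ξ := by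
  funext s
  have : ((h s)⁻¹ : SU n).1 * inclY (expY h ξ) s = (expSU (ξ s) : Mat n) := by
    rw [inclY, expY, Submonoid.coe_mul, ← mul_assoc, SU.coe_inv_mul, one_mul]
  rw [logY, this]
  exact L.log_exp _ (hξ s)

theorem logY_mem (h : Y n g) {k : Y n g} (hk : inclY k ∈ L.domY h) :
    L.logY h (inclY k) ∈ L.codY g := fun s => L.log_mem ((h s)⁻¹ * k s) (hk s)

theorem expY_logY (h : Y n g) {k : Y n g} (hk : inclY k ∈ L.domY h) :
    expY h (L.logY h (inclY k)) = k := by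
  funext s
  have := L.exp_log ((h s)⁻¹ * k s) (hk s)
  rw [expY, logY]
  change h s * expSU (L.log ((h s)⁻¹ * k s : SU n)) = k s
  rw [this, mul_inv_cancel_left]

theorem inclY_mem_domY (h : Y n g) : inclY h ∈ L.domY h := by
  have := L.expY_mem h L.zero_mem_codY
  rwa [expY_zero] at this

theorem logY_self (h : Y n g) : L.logY h (inclY h) = 0 := by
  have := L.logY_expY h L.zero_mem_codY
  rwa [expY_zero] at this

/-- Along a curve in `SU(n)` through `1`, the derivative of the logarithm is the velocity. -/
theorem hasDerivAt_log {k : ℝ → SU n} {X : Mat n} (hk : HasDerivAt (fun t => (k t : Mat n)) X 0)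
    (h0 : k 0 = 1) :
    ∃ Z : su n, (Z : Mat n) = X ∧ HasDerivAt (fun t => L.log (k t : Mat n)) Z 0 := by
  have hk0 : (k 0 : Mat n) = 1 := by rw [h0]; rfl
  have hlog : DifferentiableAt ℝ L.log (k 0 : Mat n) := by
    rw [hk0]
    exact (L.contDiffOn_log.contDiffAt (L.isOpen_dom.mem_nhds L.one_mem)).differentiableAt
      (by simp)
  have h1 := hlog.hasFDerivAt.comp_hasDerivAt (0 : ℝ) hk
  set Z := fderiv ℝ L.log (k 0 : Mat n) X
  refine ⟨Z, ?_, h1⟩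
  have h2 : HasDerivAt (fun t => ((L.log (k t : Mat n) : su n) : Mat n)) (Z : Mat n) 0 :=
    (su n).subtypeL.hasFDerivAt.comp_hasDerivAt (0 : ℝ) h1
  have hexp : HasFDerivAt (NormedSpace.exp : Mat n → Mat n) (1 : Mat n →L[ℝ] Mat n)
      ((L.log (k 0 : Mat n) : su n) : Mat n) := by
    rw [hk0, L.log_one]
    exact (hasStrictFDerivAt_exp_zero (𝕂 := ℝ) (𝔸 := Mat n)).hasFDerivAt
  have h3 := hexp.comp_hasDerivAt (0 : ℝ) h2
  refine h3.unique (hk.congr_of_eventuallyEq ?_)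
  have hev : ∀ᶠ t in nhds (0 : ℝ), (k t : Mat n) ∈ L.dom :=
    hk.continuousAt.eventually (L.isOpen_dom.mem_nhds (show (k 0 : Mat n) ∈ L.dom from hk0 ▸ L.one_mem))
  filter_upwards [hev] with t ht
  exact congrArg Subtype.val (L.exp_log (k t) ht)

end LogChart

end Log

/-! ### Embedded charts -/

section EmbeddedCharts

variable {E H M : Type} [NormedAddCommGroup E] [NormedSpace ℝ E]
  [NormedAddCommGroup H] [NormedSpace ℝ H] [TopologicalSpace M]

/-- A chart of a space `M`, mapped by `ι` to a vector space, is smoothly embedded if its inverse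
is smooth as a map to the vector space, and if it extends to a smooth map on an open set of the
vector space. -/
def IsEmbeddedChart (ι : M → E) (e : OpenPartialHomeomorph M H) : Prop :=
  ContDiffOn ℝ ∞ (fun u => ι (e.symm u)) e.target ∧
  ∃ (O : Set E) (r : E → H), IsOpen O ∧ ContDiffOn ℝ ∞ r O ∧ ∀ y ∈ e.source, ι y ∈ O ∧ r (ι y) = e y

/-- The chart given by a parametrization `p` and a map `r` of the ambient space inverse to it. -/
def paramChart {ι : M → E} (hι : Topology.IsEmbedding ι) {p : H → M} {r : E → H}
    {D : Set H} {O : Set E} (hD : IsOpen D) (hO : IsOpen O)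
    (hp : ContDiffOn ℝ ∞ (fun u => ι (p u)) D) (hr : ContDiffOn ℝ ∞ r O)
    (hpr : ∀ u ∈ D, ι (p u) ∈ O ∧ r (ι (p u)) = u)
    (hrp : ∀ m, ι m ∈ O → r (ι m) ∈ D ∧ p (r (ι m)) = m) : OpenPartialHomeomorph M H where
  toFun m := r (ι m)
  invFun := p
  source := ι ⁻¹' O
  target := D
  map_source' m hm := (hrp m hm).1
  map_target' u hu := (hpr u hu).1
  left_inv' m hm := (hrp m hm).2
  right_inv' u hu := (hpr u hu).2
  open_source := hO.preimage hι.continuous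
  open_target := hD
  continuousOn_toFun := hr.continuousOn.comp hι.continuous.continuousOn fun _ hm => hm
  continuousOn_invFun := hι.isInducing.continuousOn_iff.2 hp.continuousOn

theorem isEmbeddedChart_paramChart {ι : M → E} (hι : Topology.IsEmbedding ι) {p : H → M}
    {r : E → H} {D : Set H} {O : Set E} (hD : IsOpen D) (hO : IsOpen O)
    (hp : ContDiffOn ℝ ∞ (fun u => ι (p u)) D) (hr : ContDiffOn ℝ ∞ r O)
    (hpr : ∀ u ∈ D, ι (p u) ∈ O ∧ r (ι (p u)) = u)
    (hrp : ∀ m, ι m ∈ O → r (ι m) ∈ D ∧ p (r (ι m)) = m) :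
    IsEmbeddedChart ι (paramChart hι hD hO hp hr hpr hrp) :=
  ⟨hp, O, r, hO, hr, fun _ hy => ⟨hy, rfl⟩⟩

/-- The charted space with one prescribed chart around each point. -/
abbrev chartedSpaceOfCharts (e : M → OpenPartialHomeomorph M H) (he : ∀ x, x ∈ (e x).source) :
    ChartedSpace H M where
  atlas := Set.range e
  chartAt := e
  mem_chart_source := he
  chart_mem_atlas x := ⟨x, rfl⟩

end EmbeddedCharts

section Embedded

variable {E M : Type} [NormedAddCommGroup E] [NormedSpace ℝ E] [TopologicalSpace M] {d : ℕ}
  [ChartedSpace (EuclideanSpace ℝ (Fin d)) M] {ι : M → E}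

theorem isManifold_of_isEmbeddedChart
    (hA : ∀ e ∈ atlas (EuclideanSpace ℝ (Fin d)) M, IsEmbeddedChart ι e) :
    IsManifold (𝓡 d) ∞ M := by
  refine isManifold_of_contDiffOn _ _ _ fun e e' he he' => ?_
  obtain ⟨h1, -⟩ := hA e he
  obtain ⟨-, O, r, hO, hr, h2⟩ := hA e' he'
  simp only [modelWithCornersSelf_coe, modelWithCornersSelf_coe_symm, Function.comp_id,
    Function.id_comp, Set.range_id, Set.inter_univ, Set.preimage_id]
  have hsub : (e.symm.trans e').source ⊆ e.target := fun u hu => hu.1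
  have h3 := hr.comp (h1.mono hsub) fun u hu => (h2 _ hu.2).1
  exact h3.congr fun u hu => ((h2 _ hu.2).2).symm

theorem contMDiff_of_isEmbeddedChart
    (hA : ∀ e ∈ atlas (EuclideanSpace ℝ (Fin d)) M, IsEmbeddedChart ι e) (hι : Continuous ι) :
    ContMDiff (𝓡 d) 𝓘(ℝ, E) ∞ ι := by
  have := isManifold_of_isEmbeddedChart hA
  intro x
  obtain ⟨h1, -⟩ := hA _ (chart_mem_atlas _ x)
  rw [contMDiffAt_iff]
  refine ⟨hι.continuousAt, ?_⟩
  simp only [mfld_simps]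
  exact h1.contDiffAt
    ((chartAt _ x).open_target.mem_nhds ((chartAt _ x).map_source (mem_chart_source _ x)))
    |>.contDiffWithinAt

theorem injective_mfderiv_of_isEmbeddedChart
    (hA : ∀ e ∈ atlas (EuclideanSpace ℝ (Fin d)) M, IsEmbeddedChart ι e) (hι : Continuous ι)
    (x : M) : Function.Injective (mfderiv (𝓡 d) 𝓘(ℝ, E) ι x) := by
  have := isManifold_of_isEmbeddedChart hA
  obtain ⟨-, O, r, hO, hr, h2⟩ := hA _ (chart_mem_atlas _ x)
  have hx := h2 x (mem_chart_source (EuclideanSpace ℝ (Fin d)) x)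
  have hιx : MDifferentiableAt (𝓡 d) 𝓘(ℝ, E) ι x :=
    (contMDiff_of_isEmbeddedChart hA hι x).mdifferentiableAt (by simp)
  have hrx : MDifferentiableAt 𝓘(ℝ, E) 𝓘(ℝ, EuclideanSpace ℝ (Fin d)) r (ι x) :=
    ((hr.contDiffAt (hO.mem_nhds hx.1)).differentiableAt (by simp)).mdifferentiableAt
  have hcomp := mfderiv_comp x hrx hιx
  have heq : r ∘ ι =ᶠ[nhds x] extChartAt (𝓡 d) x := by
    filter_upwards [(chartAt (EuclideanSpace ℝ (Fin d)) x).open_source.mem_nhds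
      (mem_chart_source _ x)] with y hy
    simpa using (h2 y hy).2
  have hinv := isInvertible_mfderiv_extChartAt (I := 𝓡 d) (mem_extChartAt_source (I := 𝓡 d) x)
  rw [heq.mfderiv_eq] at hcomp
  have hinj := hinv.injective
  rw [hcomp] at hinj
  exact Function.Injective.of_comp hinj

theorem mfderiv_eq_fderiv_chart {V : Type} [NormedAddCommGroup V] [NormedSpace ℝ V] {f : M → V}
    {x : M} (hf : MDifferentiableAt (𝓡 d) 𝓘(ℝ, V) f x) :
    mfderiv (𝓡 d) 𝓘(ℝ, V) f x =
      fderiv ℝ (fun u => f ((chartAt (EuclideanSpace ℝ (Fin d)) x).symm u))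
        (chartAt (EuclideanSpace ℝ (Fin d)) x x) := by
  rw [hf.mfderiv]
  simp only [mfld_simps, fderivWithin_univ]
  rfl

theorem isEmbeddedBy_of_isEmbeddedChart
    (hA : ∀ e ∈ atlas (EuclideanSpace ℝ (Fin d)) M, IsEmbeddedChart ι e)
    (hι : Topology.IsEmbedding ι) : IsEmbeddedBy d ι where
  isManifold := isManifold_of_isEmbeddedChart hA
  contMDiff := contMDiff_of_isEmbeddedChart hA hι.continuous
  injective_mfderiv := injective_mfderiv_of_isEmbeddedChart hA hι.continuous
  isEmbedding := hι

/-- A map into an embedded submanifold is smooth if it is smooth as a map to the ambient space. -/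
theorem contMDiffAt_of_comp_incl
    (hA : ∀ e ∈ atlas (EuclideanSpace ℝ (Fin d)) M, IsEmbeddedChart ι e)
    (hι : Topology.IsEmbedding ι) {H' E' N : Type} [NormedAddCommGroup E'] [NormedSpace ℝ E']
    [TopologicalSpace H'] {I : ModelWithCorners ℝ E' H'} [TopologicalSpace N] [ChartedSpace H' N]
    {f : N → M} {x : N} (hf : ContMDiffAt I 𝓘(ℝ, E) ∞ (fun y => ι (f y)) x) :
    ContMDiffAt I (𝓡 d) ∞ f x := by
  have := isManifold_of_isEmbeddedChart hA
  obtain ⟨-, O, r, hO, hr, h2⟩ := hA _ (chart_mem_atlas _ (f x))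
  have hx := h2 (f x) (mem_chart_source _ (f x))
  have hcont : ContinuousAt f x := hι.isInducing.continuousAt_iff.2 hf.continuousAt
  rw [contMDiffAt_iff_target]
  refine ⟨hcont, ?_⟩
  have h3 : ContMDiffAt 𝓘(ℝ, E) 𝓘(ℝ, EuclideanSpace ℝ (Fin d)) ∞ r (ι (f x)) :=
    (hr.contDiffAt (hO.mem_nhds hx.1)).contMDiffAt
  refine (h3.comp x hf).congr_of_eventuallyEq ?_
  filter_upwards [hcont.eventually ((chartAt (EuclideanSpace ℝ (Fin d)) (f x)).open_source.mem_nhds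
    (mem_chart_source _ (f x)))] with y hy
  simpa using (h2 _ hy).2.symm

end Embedded

/-! ### The conjugation action -/

section Conjugation

variable {n g : ℕ}

instance instIsTopologicalGroupSU : IsTopologicalGroup (SU n) where
  continuous_inv := by
    refine Continuous.subtype_mk (f := fun k : SU n => star (k : Mat n)) ?_ _
    exact continuous_star.comp continuous_subtype_val

instance instCompactSpaceSU : CompactSpace (SU n) := by
  refine isCompact_iff_compactSpace.1 (Metric.isCompact_of_isClosed_isBounded ?_ ?_)
  · have h : {A : Mat n | star A * A = 1 ∧ A * star A = 1 ∧ A.det = 1} =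
        (Matrix.specialUnitaryGroup (Fin n) ℂ : Set (Mat n)) := by
      ext A
      exact ⟨fun h => ⟨⟨h.1, h.2.1⟩, h.2.2⟩, fun h => ⟨h.1.1, h.1.2, h.2⟩⟩
    rw [← h]
    refine (isClosed_eq (continuous_star.mul continuous_id) continuous_const).inter
      ((isClosed_eq (continuous_id.mul continuous_star) continuous_const).inter
        (isClosed_eq continuous_id.matrix_det continuous_const))
  · refine (Metric.isBounded_closedBall (x := (0 : Mat n)) (r := 1)).subset fun A hA => ?_
    rw [mem_closedBall_zero_iff]
    rcases subsingleton_or_nontrivial (Mat n) with _ | _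
    · rw [Subsingleton.elim A 0, norm_zero]; exact zero_le_one
    · exact (CStarRing.norm_of_mem_unitary (show A ∈ unitary (Mat n) from hA.1)).le

/-- Simultaneous conjugation. -/
def conjY (k : SU n) (h : Y n g) : Y n g := fun s => k * h s * k⁻¹

theorem conjY_one (h : Y n g) : conjY 1 h = h := by funext s; simp [conjY]

theorem conjY_mul (k l : SU n) (h : Y n g) : conjY (k * l) h = conjY k (conjY l h) := by
  funext s; simp [conjY, mul_assoc]

theorem conjY_of_mem_center {k : SU n} (hk : k ∈ Subgroup.center (SU n)) (h : Y n g) :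
    conjY k h = h := by
  funext s
  rw [conjY, ← Subgroup.mem_center_iff.1 hk (h s), mul_inv_cancel_right]

theorem eval_conjY (w : F g) (k : SU n) (h : Y n g) :
    eval w (conjY k h) = k * eval w h * k⁻¹ := by
  have : FreeGroup.lift (conjY k h) =
      (MulAut.conj k).toMonoidHom.comp (FreeGroup.lift h) := by
    ext s; simp [conjY]
  exact DFunLike.congr_fun this w

theorem epsR_conjY {β : SU n} (hβ : β ∈ Subgroup.center (SU n)) (k : SU n) {h : Y n g}
    (hh : epsR h = β) : epsR (conjY k h) = β := by
  rw [epsR, eval_conjY]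
  change k * epsR h * k⁻¹ = β
  rw [hh, Subgroup.mem_center_iff.1 hβ k, mul_inv_cancel_right]

theorem continuous_conjY : Continuous fun p : SU n × Y n g => conjY p.1 p.2 := by
  refine continuous_pi fun s => ?_
  have h : Continuous fun p : SU n × Y n g => p.2 s := (continuous_apply s).comp continuous_snd
  exact (continuous_fst.mul h).mul continuous_fst.inv

theorem expSU_neg (X : su n) : expSU (-X) = (expSU X)⁻¹ := by
  refine Subtype.ext ?_
  have h : NormedSpace.exp (-(X : Mat n)) = (NormedSpace.exp (X : Mat n)).conjTranspose := by
    rw [← Matrix.exp_conjTranspose, X.2.1]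
  exact h

theorem contDiff_inclY_conjY_expY (h : Y n g) :
    ContDiff ℝ ω fun p : su n × (Fin g × Fin 2 → su n) =>
      inclY (conjY (expSU p.1) (expY h p.2)) := by
  refine contDiff_pi.2 fun s => ?_
  simp only [inclY, conjY, Submonoid.coe_mul, ← expSU_neg]
  exact ((contDiff_expSU.comp contDiff_fst).mul
    ((contDiff_pi.1 (contDiff_inclY_expY h) s).comp contDiff_snd)).mul
    (contDiff_expSU.comp contDiff_fst.neg)

theorem hasDerivAt_conjY (h : Y n g) (X : su n) (s : Fin g × Fin 2) :
    HasDerivAt (fun t : ℝ => (((h s)⁻¹ * conjY (expSU (t • X)) h s : SU n) : Mat n))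
      (orbitDir h X s : Mat n) 0 := by
  have h1 := hasDerivAt_exp_su X
  have h2 := hasDerivAt_exp_su (-X)
  have h3 := (((h1.mul_const (h s : Mat n)).mul h2).const_mul ((h s)⁻¹ : SU n).1)
  have e : (fun t : ℝ => (((h s)⁻¹ * conjY (expSU (t • X)) h s : SU n) : Mat n)) =
      fun t : ℝ => ((h s)⁻¹ : SU n).1 *
        (((expSU (t • X) : SU n) : Mat n) * (h s : Mat n) * ((expSU (t • -X) : SU n) : Mat n)) := by
    funext t
    simp only [conjY, Submonoid.coe_mul, smul_neg, expSU_neg]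
  have key : (orbitDir h X s : Mat n) = ((h s)⁻¹ : SU n).1 *
      ((X : Mat n) * (h s : Mat n) * (expSU ((0 : ℝ) • -X) : Mat n) +
        (expSU ((0 : ℝ) • X) : Mat n) * (h s : Mat n) * ((-X : su n) : Mat n)) := by
    rw [orbitDir_apply]
    simp only [Submodule.coe_sub, coe_Ad, inv_inv, zero_smul, expSU_zero, Submodule.coe_neg,
      OneMemClass.coe_one, mul_one, one_mul, mul_add, mul_neg]
    rw [← mul_assoc, ← mul_assoc, SU.coe_inv_mul, one_mul, sub_eq_add_neg]
  rw [e, key]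
  exact h3

end Conjugation

/-! ### Slices for the conjugation action -/

section Slice

variable {n g : ℕ} (L : LogChart n)

/-- The relation `ε_R = β` in exponential coordinates at `h`. -/
def relLog (β : SU n) (h : Y n g) (ξ : Fin g × Fin 2 → su n) : su n :=
  L.log ((β⁻¹ * epsR (expY h ξ) : SU n) : Mat n)

/-- The domain of the relation in exponential coordinates. -/
def relDom (β : SU n) (h : Y n g) : Set (Fin g × Fin 2 → su n) :=
  {ξ | ((β⁻¹ * epsR (expY h ξ) : SU n) : Mat n) ∈ L.dom}

theorem contDiff_epsR_expY (β : SU n) (h : Y n g) :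
    ContDiff ℝ ω fun ξ => ((β⁻¹ * epsR (expY h ξ) : SU n) : Mat n) := by
  obtain ⟨f, hf, hf'⟩ := exists_contDiff_eval n (surfaceRelation g)
  have e : (fun ξ => ((β⁻¹ * epsR (expY h ξ) : SU n) : Mat n)) =
      fun ξ => (β⁻¹ : SU n).1 * f (inclY (expY h ξ)) := by
    funext ξ
    rw [hf']
    rfl
  rw [e]
  exact contDiff_const.mul (hf.comp (contDiff_inclY_expY h))

theorem isOpen_relDom (β : SU n) (h : Y n g) : IsOpen (relDom L β h) :=
  L.isOpen_dom.preimage (contDiff_epsR_expY β h).continuous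

theorem contDiffOn_relLog (β : SU n) (h : Y n g) :
    ContDiffOn ℝ ω (relLog L β h) (relDom L β h) :=
  L.contDiffOn_log.comp (contDiff_epsR_expY β h).contDiffOn fun _ hξ => hξ

theorem zero_mem_relDom {β : SU n} {h : Y n g} (hh : epsR h = β) : 0 ∈ relDom L β h := by
  change ((β⁻¹ * epsR (expY h 0) : SU n) : Mat n) ∈ L.dom
  rw [expY_zero, hh, inv_mul_cancel]
  exact L.one_mem

theorem contDiffAt_relLog {β : SU n} {h : Y n g} (hh : epsR h = β) :
    ContDiffAt ℝ ω (relLog L β h) 0 :=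
  (contDiffOn_relLog L β h).contDiffAt ((isOpen_relDom L β h).mem_nhds (zero_mem_relDom L hh))

theorem fderiv_relLog {β : SU n} {h : Y n g} (hh : epsR h = β) (ξ : Fin g × Fin 2 → su n) :
    fderiv ℝ (relLog L β h) 0 ξ = Ad β⁻¹ (dEval h ξ (surfaceRelation g)) := by
  have hd : DifferentiableAt ℝ (relLog L β h) ((0 : ℝ) • ξ) := by
    rw [zero_smul]
    exact (contDiffAt_relLog L hh).differentiableAt (by simp)
  have h1 : HasDerivAt (fun t : ℝ => t • ξ) ξ 0 := by
    simpa using (hasDerivAt_id (0 : ℝ)).smul_const ξ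
  have h2 := hd.hasFDerivAt.comp_hasDerivAt (0 : ℝ) h1
  rw [zero_smul] at h2
  have h3 : HasDerivAt (fun t => (eval (surfaceRelation g) (curve h ξ t) : Mat n))
      (velocity fun t => eval (surfaceRelation g) (curve h ξ t)) 0 :=
    (differentiableAt_eval (fun s => (hasDerivAt_curve h ξ s).differentiableAt) _).hasDerivAt
  have h4 : HasDerivAt (fun t => ((β⁻¹ * eval (surfaceRelation g) (curve h ξ t) : SU n) : Mat n))
      ((β⁻¹ : SU n).1 * velocity fun t => eval (surfaceRelation g) (curve h ξ t)) 0 :=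
    h3.const_mul _
  have h0 : eval (surfaceRelation g) (curve h ξ 0) = β := by rw [curve_zero]; exact hh
  obtain ⟨Z, hZ, hZ'⟩ := L.hasDerivAt_log h4 (by rw [h0, inv_mul_cancel])
  have e1 : fderiv ℝ (relLog L β h) 0 ξ = Z := h2.unique hZ'
  rw [e1, ← hh, epsR, ← mcLeft_eval_curve]
  refine Subtype.ext ?_
  change (Z : Mat n) = ((eval (surfaceRelation g) (curve h ξ 0))⁻¹ : SU n).1 *
    velocity fun t => eval (surfaceRelation g) (curve h ξ t)
  rw [hZ, h0]

/-- The conjugation action in exponential coordinates at `h`. -/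
def conjLog (h : Y n g) (p : su n × (Fin g × Fin 2 → su n)) : Fin g × Fin 2 → su n :=
  L.logY h (inclY (conjY (expSU p.1) (expY h p.2)))

theorem conj_zero (h : Y n g) : conjY (expSU (0 : su n)) (expY h 0) = h := by
  rw [expSU_zero, conjY_one, expY_zero]

theorem contDiffAt_conjLog (h : Y n g) : ContDiffAt ℝ ω (conjLog L h) 0 := by
  refine ContDiffAt.comp (0 : su n × (Fin g × Fin 2 → su n))
    ((L.contDiffOn_logY h).contDiffAt ((L.isOpen_domY h).mem_nhds ?_))
    (contDiff_inclY_conjY_expY h).contDiffAt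
  simp only [Prod.fst_zero, Prod.snd_zero, conj_zero]
  exact L.inclY_mem_domY h

/-- Conjugation moves `h` in the orbit direction, and the exponential chart has identity derivative. -/
theorem fderiv_conjLog (h : Y n g) (X : su n) (ξ : Fin g × Fin 2 → su n) :
    fderiv ℝ (conjLog L h) 0 (X, ξ) = orbitDir h X + ξ := by
  have hd : HasFDerivAt (conjLog L h) (fderiv ℝ (conjLog L h) 0) 0 :=
    ((contDiffAt_conjLog L h).differentiableAt (by simp)).hasFDerivAt
  have e : ((X, ξ) : su n × (Fin g × Fin 2 → su n)) = (X, 0) + (0, ξ) := by simp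
  rw [e, map_add]
  congr 1
  · have h1 : HasDerivAt (fun t : ℝ => ((t • X, 0) : su n × (Fin g × Fin 2 → su n))) (X, 0) 0 := by
      have := (hasDerivAt_id (0 : ℝ)).smul_const ((X, 0) : su n × (Fin g × Fin 2 → su n))
      simpa using this
    have hd' : HasFDerivAt (conjLog L h) (fderiv ℝ (conjLog L h) 0)
        (((0 : ℝ) • X, 0) : su n × (Fin g × Fin 2 → su n)) := by
      rw [zero_smul]; exact hd
    have h2 := hd'.comp_hasDerivAt (0 : ℝ) h1
    refine h2.unique (hasDerivAt_pi.2 fun s => ?_)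
    obtain ⟨Z, hZ, hZ'⟩ := L.hasDerivAt_log (hasDerivAt_conjY h X s)
      (by rw [zero_smul, expSU_zero, conjY_one, inv_mul_cancel])
    rw [Subtype.ext hZ] at hZ'
    refine hZ'.congr_of_eventuallyEq (Filter.Eventually.of_forall fun t => ?_)
    simp only [Function.comp_apply, conjLog, LogChart.logY, expY_zero]
    rfl
  · have h1 : HasDerivAt (fun t : ℝ => ((0, t • ξ) : su n × (Fin g × Fin 2 → su n))) (0, ξ) 0 := by
      have := (hasDerivAt_id (0 : ℝ)).smul_const ((0, ξ) : su n × (Fin g × Fin 2 → su n))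
      simpa using this
    have hd' : HasFDerivAt (conjLog L h) (fderiv ℝ (conjLog L h) 0)
        ((0, (0 : ℝ) • ξ) : su n × (Fin g × Fin 2 → su n)) := by
      rw [zero_smul]; exact hd
    have h2 := hd'.comp_hasDerivAt (0 : ℝ) h1
    have h3 : HasDerivAt (fun t : ℝ => t • ξ) ξ 0 := by
      simpa using (hasDerivAt_id (0 : ℝ)).smul_const ξ
    refine h2.unique (h3.congr_of_eventuallyEq ?_)
    have hev : ∀ᶠ t in nhds (0 : ℝ), t • ξ ∈ L.codY g :=
      h3.continuousAt.eventually (L.isOpen_codY.mem_nhds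
        (show (0 : ℝ) • ξ ∈ L.codY g by rw [zero_smul]; exact L.zero_mem_codY))
    filter_upwards [hev] with t ht
    simp only [Function.comp_apply, conjLog, expSU_zero, conjY_one]
    exact L.logY_expY h ht

end Slice

section FiniteDimensional

variable {E F : Type*} [NormedAddCommGroup E] [NormedSpace ℝ E] [FiniteDimensional ℝ E]
  [NormedAddCommGroup F] [NormedSpace ℝ F] [FiniteDimensional ℝ F]

/-- The inverse function theorem between spaces of the same finite dimension. -/
theorem exists_openPartialHomeomorph_of_injective {f : E → F} {a : E} (hf : ContDiffAt ℝ ω f a)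
    (hinj : ∀ v, fderiv ℝ f a v = 0 → v = 0) (hdim : Module.finrank ℝ E = Module.finrank ℝ F)
    {N : Set E} (hN : N ∈ nhds a) :
    ∃ e : OpenPartialHomeomorph E F, a ∈ e.source ∧ e.source ⊆ N ∧ (e : E → F) = f ∧
      ContDiffOn ℝ ω f e.source ∧ ContDiffOn ℝ ω e.symm e.target := by
  have : CompleteSpace E := FiniteDimensional.complete ℝ E
  have hd := (hf.differentiableAt (by simp)).hasFDerivAt
  let J : E ≃L[ℝ] F := (LinearEquiv.ofInjectiveOfFinrankEq (fderiv ℝ f a : E →ₗ[ℝ] F)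
    ((injective_iff_map_eq_zero _).2 hinj) hdim).toContinuousLinearEquiv
  have hJ : (J : E →L[ℝ] F) = fderiv ℝ f a := by ext v; rfl
  exact exists_openPartialHomeomorph_of_contDiffAt hf (f' := J) (hJ ▸ hd) hN

end FiniteDimensional

section SliceConstruction

variable {n g : ℕ}

/-- The dimension of the moduli space. The subtraction does not truncate when the fibre is nonempty,
by `exists_slice_coordinates`; for an empty fibre the value plays no role. -/
def dimModuli (n g : ℕ) : ℕ :=
  Module.finrank ℝ (Fin g × Fin 2 → su n) - 2 * Module.finrank ℝ (su n)

/-- A slice `s` at `h` for the conjugation action on `ε_R⁻¹(β)`: the map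
`(X, η) ↦ exp(X) s(η) exp(-X)` is a local parametrization of `ε_R⁻¹(β)`, with inverse the
restriction of the map `r` on the space of tuples of matrices. The parameters `(X, η)` range over
`domX × dom`, and the parametrized part of the fibre is its intersection with the open set `rdom` of
tuples of matrices. -/
structure Slice (β : SU n) (h : Y n g) where
  s : EuclideanSpace ℝ (Fin (dimModuli n g)) → Y n g
  r : (Fin g × Fin 2 → Mat n) → su n × EuclideanSpace ℝ (Fin (dimModuli n g))
  domX : Set (su n)
  dom : Set (EuclideanSpace ℝ (Fin (dimModuli n g)))
  rdom : Set (Fin g × Fin 2 → Mat n)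
  isOpen_domX : IsOpen domX
  isOpen_dom : IsOpen dom
  isOpen_rdom : IsOpen rdom
  zero_mem_domX : 0 ∈ domX
  zero_mem_dom : 0 ∈ dom
  s_zero : s 0 = h
  contDiffOn_s : ContDiffOn ℝ ω (fun η => inclY (s η)) dom
  contDiffOn_r : ContDiffOn ℝ ω r rdom
  epsR_s : ∀ η ∈ dom, epsR (s η) = β
  mem_rdom : ∀ X ∈ domX, ∀ η ∈ dom, inclY (conjY (expSU X) (s η)) ∈ rdom
  r_param : ∀ X ∈ domX, ∀ η ∈ dom, r (inclY (conjY (expSU X) (s η))) = (X, η)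
  r_mem : ∀ k : Y n g, epsR k = β → inclY k ∈ rdom →
    (r (inclY k)).1 ∈ domX ∧ (r (inclY k)).2 ∈ dom
  param_r : ∀ k : Y n g, epsR k = β → inclY k ∈ rdom →
    conjY (expSU (r (inclY k)).1) (s (r (inclY k)).2) = k

theorem adRep_bijective (k : SU n) : Function.Bijective (adRep n k) :=
  ⟨Function.LeftInverse.injective (Representation.inv_self_apply (adRep n) k),
    Function.RightInverse.surjective (Representation.self_inv_apply (adRep n) k)⟩

/-- Slice coordinates for the exponential chart at `h`: a linear projection `P` onto the orbit
direction, the relation, and linear coordinates `q` on the common kernel of the differentials. -/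
theorem exists_slice_coordinates (L : LogChart n) {β : SU n} {h : Y n g} (hh : epsR h = β)
    (hsurj : Function.Surjective (dEvalL h (surfaceRelation g)))
    (hinj : Function.Injective (orbitDir h))
    (horb : ∀ X, dEval h (orbitDir h X) (surfaceRelation g) = 0) :
    (Module.finrank ℝ (Fin g × Fin 2 → su n) = 2 * Module.finrank ℝ (su n) + dimModuli n g) ∧
    ∃ (P : (Fin g × Fin 2 → su n) →L[ℝ] su n)
      (q : (Fin g × Fin 2 → su n) →L[ℝ] EuclideanSpace ℝ (Fin (dimModuli n g))),
      (∀ X, P (orbitDir h X) = X) ∧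
      ∀ v, P v = 0 → fderiv ℝ (relLog L β h) 0 v = 0 → q v = 0 → v = 0 := by
  obtain ⟨P₀, hP₀⟩ := (orbitDir h).exists_leftInverse_of_injective (LinearMap.ker_eq_bot.2 hinj)
  set f' := fderiv ℝ (relLog L β h) 0 with hf'
  have hf'v : ∀ v, f' v = adRep n β⁻¹ (dEval h v (surfaceRelation g)) := fun v =>
    fderiv_relLog L hh v
  have hP : ∀ X, P₀ (orbitDir h X) = X := fun X => LinearMap.congr_fun hP₀ X
  have hf'orb : ∀ X, f' (orbitDir h X) = 0 := fun X => by rw [hf'v, horb, map_zero]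
  set J : (Fin g × Fin 2 → su n) →ₗ[ℝ] su n × su n := P₀.prod (f' : (Fin g × Fin 2 → su n) →ₗ[ℝ] su n)
    with hJ
  have hJsurj : Function.Surjective J := by
    rintro ⟨a, b⟩
    obtain ⟨c, hc⟩ := (adRep_bijective (n := n) β⁻¹).2 b
    obtain ⟨ξ, hξ⟩ := hsurj c
    refine ⟨ξ + orbitDir h (a - P₀ ξ), ?_⟩
    have h1 : f' ξ = b := by rw [hf'v, ← dEvalL_apply, hξ, hc]
    refine Prod.ext ?_ ?_
    · change P₀ (ξ + orbitDir h (a - P₀ ξ)) = a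
      rw [map_add, hP]; abel
    · change f' (ξ + orbitDir h (a - P₀ ξ)) = b
      rw [map_add, hf'orb, add_zero, h1]
  have hrank := J.finrank_range_add_finrank_ker
  rw [LinearMap.range_eq_top.2 hJsurj, finrank_top, Module.finrank_prod] at hrank
  have hker : Module.finrank ℝ J.ker = dimModuli n g := by
    rw [dimModuli, ← hrank]; omega
  refine ⟨by rw [← hrank, hker]; ring, ?_⟩
  obtain ⟨q₀, hq₀⟩ : ∃ q₀ : (Fin g × Fin 2 → su n) →ₗ[ℝ] J.ker,
      q₀ ∘ₗ J.ker.subtype = LinearMap.id :=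
    LinearMap.exists_leftInverse_of_injective (K := ℝ) (V := J.ker)
      (V' := Fin g × Fin 2 → su n) _ (Submodule.ker_subtype _)
  have : Module.Free ℝ J.ker := Module.Free.of_divisionRing ℝ J.ker
  have κ : J.ker ≃ₗ[ℝ] EuclideanSpace ℝ (Fin (dimModuli n g)) :=
    LinearEquiv.ofFinrankEq _ _ (by rw [hker, finrank_euclideanSpace, Fintype.card_fin])
  refine ⟨P₀.toContinuousLinearMap, (κ.toLinearMap.comp q₀).toContinuousLinearMap, hP,
    fun v h1 h2 h3 => ?_⟩
  have hv : v ∈ J.ker := LinearMap.mem_ker.2 (Prod.ext h1 h2)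
  have h4 : q₀ v = ⟨v, hv⟩ := LinearMap.congr_fun hq₀ ⟨v, hv⟩
  have h5 : κ (q₀ v) = 0 := h3
  rw [h4, LinearEquiv.map_eq_zero_iff] at h5
  exact congrArg Subtype.val h5

set_option maxHeartbeats 1000000 in
/-- With `f = log(β⁻¹ε_R)`, the projection `P` to the orbit direction and the complementary coordinates
`q` of `exists_slice_coordinates`, the map `Φ = (P, f, q)` is a local diffeomorphism, and `σ(λ, η) = Φ⁻¹(0, λ, η)`
parametrizes a submanifold transverse to the orbit, on which `λ` is the logarithm of `β⁻¹ε_R`. Then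
`(X, λ, η) ↦ exp(X) σ(λ, η) exp(-X)` is again a local diffeomorphism, and the part of it in
`ε_R⁻¹(β)` is given by `λ = 0`. -/
theorem nonempty_slice (L : LogChart n) {β : SU n} (hβ : β ∈ Subgroup.center (SU n)) {h : Y n g}
    (hh : epsR h = β)
    (hsurj : Function.Surjective (dEvalL h (surfaceRelation g)))
    (hinj : Function.Injective (orbitDir h))
    (horb : ∀ X, dEval h (orbitDir h X) (surfaceRelation g) = 0) : Nonempty (Slice β h) := by
  obtain ⟨hdim, P, q, hP, hker⟩ := exists_slice_coordinates L hh hsurj hinj horb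
  set f := relLog L β h with hf
  have hf0 : f 0 = 0 := by
    rw [hf, relLog, expY_zero, hh, inv_mul_cancel]; exact L.log_one
  have hfd := contDiffAt_relLog L hh
  -- the chart `(P, f, q)` of the Lie algebra
  set Φ : (Fin g × Fin 2 → su n) → su n × su n × EuclideanSpace ℝ (Fin (dimModuli n g)) :=
    fun ξ => (P ξ, f ξ, q ξ) with hΦ
  have hΦ' : HasFDerivAt Φ (P.prod ((fderiv ℝ f 0).prod q)) 0 :=
    P.hasFDerivAt.prodMk ((hfd.differentiableAt (by simp)).hasFDerivAt.prodMk q.hasFDerivAt)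
  have hΦ0 : Φ 0 = 0 := by simp [hΦ, hf0]
  have hN1 : relDom L β h ∈ nhds (0 : Fin g × Fin 2 → su n) :=
    (isOpen_relDom L β h).mem_nhds (zero_mem_relDom L hh)
  obtain ⟨e₁, h0₁, hN₁, he₁, -, hs₁⟩ := exists_openPartialHomeomorph_of_injective
    (f := Φ) (a := 0) (P.contDiff.contDiffAt.prodMk (hfd.prodMk q.contDiff.contDiffAt))
    (fun v hv => by
      rw [hΦ'.fderiv] at hv
      exact hker v (congrArg Prod.fst hv) (congrArg (fun p => p.2.1) hv)
        (congrArg (fun p => p.2.2) hv))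
    (by rw [Module.finrank_prod, Module.finrank_prod, finrank_euclideanSpace, Fintype.card_fin,
          hdim]; ring) hN1
  have h0t : (0 : su n × su n × EuclideanSpace ℝ (Fin (dimModuli n g))) ∈ e₁.target := by
    have := e₁.map_source h0₁
    rwa [he₁, hΦ0] at this
  have hsymm0 : e₁.symm 0 = 0 := by
    have := e₁.left_inv h0₁
    rwa [he₁, hΦ0] at this
  have hright : ∀ p ∈ e₁.target, Φ (e₁.symm p) = p := fun p hp => by
    rw [← he₁]; exact e₁.right_inv hp
  have hs₁d : ContDiffAt ℝ ω e₁.symm 0 := hs₁.contDiffAt (e₁.open_target.mem_nhds h0t)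
  set D := fderiv ℝ e₁.symm 0 with hD
  have hDd : HasFDerivAt e₁.symm D 0 := (hs₁d.differentiableAt (by simp)).hasFDerivAt
  have hΦD : ∀ v, (P (D v), fderiv ℝ f 0 (D v), q (D v)) = v := by
    have h1 : HasFDerivAt (fun p => Φ (e₁.symm p)) ((P.prod ((fderiv ℝ f 0).prod q)).comp D) 0 := by
      have h0 : HasFDerivAt Φ (P.prod ((fderiv ℝ f 0).prod q)) (e₁.symm 0) := by
        rw [hsymm0]; exact hΦ'
      exact h0.comp _ hDd
    have h2 : (fun p => Φ (e₁.symm p)) =ᶠ[nhds 0] id := by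
      filter_upwards [e₁.open_target.mem_nhds h0t] with p hp using hright p hp
    have h3 := h1.unique ((hasFDerivAt_id 0).congr_of_eventuallyEq h2)
    intro v
    exact DFunLike.congr_fun h3 v
  -- the slice, before restricting to the fibre, and its translates
  set σ : su n × EuclideanSpace ℝ (Fin (dimModuli n g)) → (Fin g × Fin 2 → su n) :=
    fun p => e₁.symm (0, p) with hσ
  set Ψ : su n × su n × EuclideanSpace ℝ (Fin (dimModuli n g)) → (Fin g × Fin 2 → su n) :=
    fun p => conjLog L h (p.1, σ p.2) with hΨ
  have hσ0 : σ 0 = 0 := hsymm0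
  have hin : ContDiff ℝ ω fun p : su n × EuclideanSpace ℝ (Fin (dimModuli n g)) => ((0 : su n), p) :=
    contDiff_const.prodMk contDiff_id
  have hσd : ContDiffAt ℝ ω σ 0 := ContDiffAt.comp (0 : su n × EuclideanSpace ℝ (Fin (dimModuli n g))) hs₁d
    hin.contDiffAt
  have hpair : ContDiffAt ℝ ω
      (fun p : su n × su n × EuclideanSpace ℝ (Fin (dimModuli n g)) => (p.1, σ p.2)) 0 :=
    contDiffAt_fst.prodMk
      (ContDiffAt.comp (0 : su n × su n × EuclideanSpace ℝ (Fin (dimModuli n g)))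
        (g := σ) (f := Prod.snd) hσd contDiffAt_snd)
  have hpair0 : ((0 : su n × su n × EuclideanSpace ℝ (Fin (dimModuli n g))).1,
      σ (0 : su n × su n × EuclideanSpace ℝ (Fin (dimModuli n g))).2) = 0 := Prod.ext rfl hσ0
  have hΨd : ContDiffAt ℝ ω Ψ 0 := by
    have h0 := contDiffAt_conjLog L h
    rw [← hpair0] at h0
    exact ContDiffAt.comp (0 : su n × su n × EuclideanSpace ℝ (Fin (dimModuli n g)))
      (g := conjLog L h) h0 hpair
  have hΨ' : ∀ X p, fderiv ℝ Ψ 0 (X, p) = orbitDir h X + D (0, p) := by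
    have h1 : HasFDerivAt σ (D.comp ((0 : _ →L[ℝ] su n).prod (.id ℝ _))) 0 :=
      HasFDerivAt.comp (0 : su n × EuclideanSpace ℝ (Fin (dimModuli n g))) hDd
        ((hasFDerivAt_const (0 : su n) _).prodMk (hasFDerivAt_id _))
    have h2 : HasFDerivAt (fun p : su n × su n × EuclideanSpace ℝ (Fin (dimModuli n g)) => (p.1, σ p.2)) _ 0 :=
      hasFDerivAt_fst.prodMk (HasFDerivAt.comp (0 : su n × su n × EuclideanSpace ℝ (Fin (dimModuli n g)))
        (g := σ) (f := Prod.snd) h1 hasFDerivAt_snd)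
    have h3 : HasFDerivAt (conjLog L h) (fderiv ℝ (conjLog L h) 0)
        ((0 : su n × su n × EuclideanSpace ℝ (Fin (dimModuli n g))).1,
          σ (0 : su n × su n × EuclideanSpace ℝ (Fin (dimModuli n g))).2) := by
      rw [hpair0]
      exact ((contDiffAt_conjLog L h).differentiableAt (by simp)).hasFDerivAt
    have h4 := HasFDerivAt.comp (0 : su n × su n × EuclideanSpace ℝ (Fin (dimModuli n g))) h3 h2
    intro X p
    have h5 : fderiv ℝ Ψ 0 = _ := h4.fderiv
    rw [h5]
    exact fderiv_conjLog L h X (D (0, p))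
  have hN2 : {p : su n × su n × EuclideanSpace ℝ (Fin (dimModuli n g)) | p.2.1 ∈ L.cod ∧
      ((0, p.2) : su n × su n × EuclideanSpace ℝ (Fin (dimModuli n g))) ∈ e₁.target ∧
      inclY (conjY (expSU p.1) (expY h (σ p.2))) ∈ L.domY h} ∈ nhds 0 := by
    refine Filter.inter_mem ?_ (Filter.inter_mem ?_ ?_)
    · exact (L.isOpen_cod.preimage (continuous_fst.comp continuous_snd)).mem_nhds L.zero_mem
    · exact (e₁.open_target.preimage (continuous_const.prodMk continuous_snd)).mem_nhds h0t
    · have hc := ContinuousAt.comp (x := (0 : su n × su n × EuclideanSpace ℝ (Fin (dimModuli n g))))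
        (g := fun p : su n × (Fin g × Fin 2 → su n) => inclY (conjY (expSU p.1) (expY h p.2)))
        (contDiff_inclY_conjY_expY h).continuous.continuousAt hpair.continuousAt
      refine hc.preimage_mem_nhds ((L.isOpen_domY h).mem_nhds ?_)
      change inclY (conjY (expSU (0 : su n)) (expY h (σ 0))) ∈ L.domY h
      rw [hσ0, conj_zero]
      exact L.inclY_mem_domY h
  obtain ⟨e₂, h0₂, hN₂, he₂, -, hs₂⟩ := exists_openPartialHomeomorph_of_injective
    (f := Ψ) (a := 0) hΨd
    (fun v hv => by
      obtain ⟨X, p⟩ := v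
      rw [hΨ'] at hv
      have h1 := congrArg P hv
      have h2 := hΦD (0, p)
      have h3 : P (D (0, p)) = 0 := congrArg Prod.fst h2
      rw [map_add, hP, h3, add_zero, map_zero] at h1
      rw [h1, map_zero, zero_add] at hv
      rw [hv] at h2
      rw [h1, ← h2]
      simp)
    (by rw [Module.finrank_prod, Module.finrank_prod, finrank_euclideanSpace, Fintype.card_fin,
          hdim]; ring) hN2
  have hexp₂ : ∀ p ∈ e₂.source, expY h (e₂ p) = conjY (expSU p.1) (expY h (σ p.2)) :=
    fun p hp => by rw [he₂]; exact L.expY_logY h (hN₂ hp).2.2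
  have hfσ : ∀ p ∈ e₂.source, f (σ p.2) = p.2.1 := fun p hp =>
    congrArg (fun q => q.2.1) (hright _ (hN₂ hp).2.1)
  have heps : ∀ p ∈ e₂.source, expSU p.2.1 = β⁻¹ * epsR (expY h (σ p.2)) := fun p hp => by
    rw [← hfσ p hp]
    exact L.exp_log _ (hN₁ (e₁.map_target (hN₂ hp).2.1))
  -- a product neighbourhood
  obtain ⟨A, hA, B, hB, hAB⟩ := mem_nhds_prod_iff.1 (e₂.open_source.mem_nhds h0₂)
  obtain ⟨B₁, hB₁, B₂, hB₂, hBB⟩ := mem_nhds_prod_iff.1 hB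
  obtain ⟨DX, hDX, hDXo, h0X⟩ := mem_nhds_iff.1 hA
  obtain ⟨Dη, hDη, hDηo, h0η⟩ := mem_nhds_iff.1 hB₂
  have hmem : ∀ X ∈ DX, ∀ η ∈ Dη, (X, 0, η) ∈ e₂.source := fun X hX η hη =>
    hAB ⟨hDX hX, hBB ⟨mem_of_mem_nhds hB₁, hDη hη⟩⟩
  set Oη : Set (su n × su n × EuclideanSpace ℝ (Fin (dimModuli n g))) := {p | p.1 ∈ DX ∧ p.2.2 ∈ Dη} with hOη
  have hOηo : IsOpen Oη := (hDXo.preimage continuous_fst).inter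
    (hDηo.preimage (continuous_snd.comp continuous_snd))
  set W : Set (Fin g × Fin 2 → su n) := e₂.target ∩ e₂.symm ⁻¹' Oη with hW
  have hWo : IsOpen W := e₂.continuousOn_symm.isOpen_inter_preimage e₂.open_target hOηo
  refine ⟨{
    s := fun η => expY h (σ (0, η))
    r := fun A => ((e₂.symm (L.logY h A)).1, (e₂.symm (L.logY h A)).2.2)
    domX := DX
    dom := Dη
    rdom := L.domY h ∩ L.logY h ⁻¹' W
    isOpen_domX := hDXo
    isOpen_dom := hDηo
    isOpen_rdom := (L.contDiffOn_logY h).continuousOn.isOpen_inter_preimage (L.isOpen_domY h) hWo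
    zero_mem_domX := h0X
    zero_mem_dom := h0η
    s_zero := by
      change expY h (σ 0) = h
      rw [hσ0, expY_zero]
    contDiffOn_s := ?_
    contDiffOn_r := ?_
    epsR_s := ?_
    mem_rdom := ?_
    r_param := ?_
    r_mem := ?_
    param_r := ?_ }⟩
  · refine (contDiff_inclY_expY h).comp_contDiffOn (hs₁.comp
      (contDiff_const.prodMk (contDiff_const.prodMk contDiff_id)).contDiffOn fun η hη => ?_)
    exact (hN₂ (hmem 0 h0X η hη)).2.1
  · have h1 : ContDiffOn ℝ ω (fun A => e₂.symm (L.logY h A)) (L.domY h ∩ L.logY h ⁻¹' W) :=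
      hs₂.comp ((L.contDiffOn_logY h).mono Set.inter_subset_left) fun A hA => hA.2.1
    exact (contDiff_fst.comp_contDiffOn h1).prodMk
      ((contDiff_snd.comp contDiff_snd).comp_contDiffOn h1)
  · intro η hη
    have := heps _ (hmem 0 h0X η hη)
    rw [expSU_zero] at this
    exact (inv_mul_eq_one.1 this.symm).symm
  · intro X hX η hη
    have hp := hmem X hX η hη
    refine ⟨(hN₂ hp).2.2, ?_⟩
    have h1 : L.logY h (inclY (conjY (expSU X) (expY h (σ (0, η))))) = e₂ (X, 0, η) := by
      rw [he₂]; rfl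
    change L.logY h (inclY (conjY (expSU X) (expY h (σ (0, η))))) ∈ W
    rw [h1]
    refine ⟨e₂.map_source hp, ?_⟩
    change e₂.symm (e₂ (X, 0, η)) ∈ Oη
    rw [e₂.left_inv hp]
    exact ⟨hX, hη⟩
  · intro X hX η hη
    have h1 : L.logY h (inclY (conjY (expSU X) (expY h (σ (0, η))))) = e₂ (X, 0, η) := by
      rw [he₂]; rfl
    simp only [h1, e₂.left_inv (hmem X hX η hη)]
  · exact fun k _ hk => hk.2.2
  · intro k hkβ hk
    set p := e₂.symm (L.logY h (inclY k)) with hp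
    have hps : p ∈ e₂.source := e₂.map_target hk.2.1
    have h1 : conjY (expSU p.1) (expY h (σ p.2)) = k := by
      rw [← hexp₂ p hps, hp, e₂.right_inv hk.2.1, L.expY_logY h hk.1]
    have h2 : epsR (expY h (σ p.2)) = β := by
      have := epsR_conjY hβ (expSU p.1)⁻¹ hkβ
      rwa [← h1, ← conjY_mul, inv_mul_cancel, conjY_one] at this
    -- the middle coordinate is the logarithm of `β⁻¹ε_R`, which vanishes on the fibre
    have h3 : p.2.1 = 0 := by
      have h4 := heps p hps
      rw [h2, inv_mul_cancel] at h4
      rw [← L.log_exp _ (hN₂ hps).1, h4]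
      exact L.log_one
    have h5 : p.2 = (0, p.2.2) := Prod.ext h3 rfl
    rw [h5] at h1
    exact h1

end SliceConstruction

section Separation

variable {n g : ℕ} {β : SU n} {h : Y n g}

/-- Different points of the slice are in different orbits. -/
def Slice.Separating (S : Slice β h) : Prop :=
  ∀ η ∈ S.dom, ∀ η' ∈ S.dom, ∀ k, conjY k (S.s η) = S.s η' → η = η'

/-- Restriction of a slice to an open neighbourhood of its centre. -/
def Slice.restrict (S : Slice β h) {V : Set (EuclideanSpace ℝ (Fin (dimModuli n g)))}
    (hV : IsOpen V) (h0 : 0 ∈ V) : Slice β h where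
  s := S.s
  r := S.r
  domX := S.domX
  dom := S.dom ∩ V
  rdom := S.rdom ∩ S.r ⁻¹' (Prod.snd ⁻¹' V)
  isOpen_domX := S.isOpen_domX
  isOpen_dom := S.isOpen_dom.inter hV
  isOpen_rdom := S.contDiffOn_r.continuousOn.isOpen_inter_preimage S.isOpen_rdom
    (hV.preimage continuous_snd)
  zero_mem_domX := S.zero_mem_domX
  zero_mem_dom := ⟨S.zero_mem_dom, h0⟩
  s_zero := S.s_zero
  contDiffOn_s := S.contDiffOn_s.mono Set.inter_subset_left
  contDiffOn_r := S.contDiffOn_r.mono Set.inter_subset_left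
  epsR_s := fun η hη => S.epsR_s η hη.1
  mem_rdom := fun X hX η hη => ⟨S.mem_rdom X hX η hη.1, by
    rw [Set.mem_preimage, S.r_param X hX η hη.1]; exact hη.2⟩
  r_param := fun X hX η hη => S.r_param X hX η hη.1
  r_mem := fun k hk hk' => ⟨(S.r_mem k hk hk'.1).1, (S.r_mem k hk hk'.1).2, hk'.2⟩
  param_r := fun k hk hk' => S.param_r k hk hk'.1

theorem Slice.continuousOn_s (S : Slice β h) : ContinuousOn S.s S.dom :=
  isEmbedding_inclY.isInducing.continuousOn_iff.2 S.contDiffOn_s.continuousOn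

/-- If `conj_k` maps one point of the slice near `h` to another, then `k` is close to the stabilizer of
`h`, by compactness of `SU(n)`. The stabilizer is central, so `k` is a small element up to a central
one, and the parametrization by the slice shows that the two points are equal. -/
theorem exists_separating_slice (L : LogChart n) (S : Slice β h)
    (hstab : ∀ k, conjY k h = h → k ∈ Subgroup.center (SU n)) :
    ∃ S : Slice β h, S.Separating := by
  have hdom := S.isOpen_dom.mem_nhds S.zero_mem_dom
  have hs0 : ContinuousAt S.s 0 := S.continuousOn_s.continuousAt hdom
  have key : ∀ k ∈ (Set.univ : Set (SU n)),
      ∀ᶠ z : (EuclideanSpace ℝ (Fin (dimModuli n g)) × EuclideanSpace ℝ (Fin (dimModuli n g))) ×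
        SU n in nhds ((0, 0), k), conjY z.2 (S.s z.1.1) = S.s z.1.2 → z.1.1 = z.1.2 := by
    intro k _
    have hs1 : Filter.Tendsto (fun z : (EuclideanSpace ℝ (Fin (dimModuli n g)) ×
        EuclideanSpace ℝ (Fin (dimModuli n g))) × SU n => S.s z.1.1) (nhds ((0, 0), k))
        (nhds h) := by
      have := hs0.tendsto
      rw [S.s_zero] at this
      exact this.comp ((continuous_fst.comp continuous_fst).tendsto ((0, 0), k))
    have hs2 : Filter.Tendsto (fun z : (EuclideanSpace ℝ (Fin (dimModuli n g)) ×
        EuclideanSpace ℝ (Fin (dimModuli n g))) × SU n => S.s z.1.2) (nhds ((0, 0), k))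
        (nhds h) := by
      have := hs0.tendsto
      rw [S.s_zero] at this
      exact this.comp ((continuous_snd.comp continuous_fst).tendsto ((0, 0), k))
    by_cases hk : conjY k h = h
    · -- near a central element `k`, use that conjugation by `exp(X) k` is conjugation by `exp(X)`
      have hkc := hstab k hk
      have hq : Continuous fun z : (EuclideanSpace ℝ (Fin (dimModuli n g)) ×
          EuclideanSpace ℝ (Fin (dimModuli n g))) × SU n => ((z.2 * k⁻¹ : SU n) : Mat n) :=
        continuous_subtype_val.comp (continuous_snd.mul continuous_const)
      have hq1 : ((k * k⁻¹ : SU n) : Mat n) = 1 := by rw [mul_inv_cancel]; rfl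
      have e1 : ∀ᶠ z : (EuclideanSpace ℝ (Fin (dimModuli n g)) ×
          EuclideanSpace ℝ (Fin (dimModuli n g))) × SU n in nhds ((0, 0), k),
          ((z.2 * k⁻¹ : SU n) : Mat n) ∈ L.dom :=
        hq.continuousAt.eventually (L.isOpen_dom.mem_nhds
          (show ((k * k⁻¹ : SU n) : Mat n) ∈ L.dom by rw [hq1]; exact L.one_mem))
      have e2 : ∀ᶠ z : (EuclideanSpace ℝ (Fin (dimModuli n g)) ×
          EuclideanSpace ℝ (Fin (dimModuli n g))) × SU n in nhds ((0, 0), k),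
          L.log ((z.2 * k⁻¹ : SU n) : Mat n) ∈ S.domX := by
        have hl : ContinuousAt L.log ((k * k⁻¹ : SU n) : Mat n) :=
          L.contDiffOn_log.continuousOn.continuousAt
            (L.isOpen_dom.mem_nhds (by rw [hq1]; exact L.one_mem))
        have hc := ContinuousAt.comp (x := (((0, 0), k) : (EuclideanSpace ℝ (Fin (dimModuli n g)) ×
          EuclideanSpace ℝ (Fin (dimModuli n g))) × SU n)) (g := L.log) hl hq.continuousAt
        refine hc.eventually (S.isOpen_domX.mem_nhds ?_)
        simp only [Function.comp_apply, hq1, L.log_one]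
        exact S.zero_mem_domX
      have e3 : ∀ᶠ z : (EuclideanSpace ℝ (Fin (dimModuli n g)) ×
          EuclideanSpace ℝ (Fin (dimModuli n g))) × SU n in nhds ((0, 0), k),
          z.1.1 ∈ S.dom ∧ z.1.2 ∈ S.dom :=
        (((continuous_fst.comp continuous_fst).tendsto ((0, 0), k)).eventually
          (show ∀ᶠ η in nhds (0 : EuclideanSpace ℝ (Fin (dimModuli n g))), η ∈ S.dom from hdom)).and
        (((continuous_snd.comp continuous_fst).tendsto ((0, 0), k)).eventually
          (show ∀ᶠ η in nhds (0 : EuclideanSpace ℝ (Fin (dimModuli n g))), η ∈ S.dom from hdom))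
      filter_upwards [e1, e2, e3] with z h1 h2 h3 hz
      have h4 : z.2 = expSU (L.log ((z.2 * k⁻¹ : SU n) : Mat n)) * k := by
        rw [L.exp_log _ h1, inv_mul_cancel_right]
      rw [h4, conjY_mul, conjY_of_mem_center hkc] at hz
      have h5 := S.r_param _ h2 _ h3.1
      have h6 := S.r_param 0 S.zero_mem_domX _ h3.2
      rw [expSU_zero, conjY_one] at h6
      rw [hz, h6] at h5
      exact (congrArg Prod.snd h5).symm
    · have h1 := (continuous_conjY.tendsto (k, h)).comp
        ((continuous_snd.tendsto (((0, 0), k) : (EuclideanSpace ℝ (Fin (dimModuli n g)) ×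
          EuclideanSpace ℝ (Fin (dimModuli n g))) × SU n)).prodMk_nhds hs1)
      have h2 : ∀ᶠ p : Y n g × Y n g in nhds (conjY k h, h), p.1 ≠ p.2 :=
        (isOpen_ne_fun continuous_fst continuous_snd).mem_nhds hk
      filter_upwards [(h1.prodMk_nhds hs2).eventually h2] with z hz hz'
      exact absurd hz' hz
  obtain ⟨V₁, hV₁, V₂, hV₂, hV⟩ := mem_nhds_prod_iff.1
    (isCompact_univ.eventually_forall_of_forall_eventually (x₀ := (0, 0))
      (P := fun z k => conjY k (S.s z.1) = S.s z.2 → z.1 = z.2) key)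
  obtain ⟨V, hVsub, hVo, h0V⟩ := mem_nhds_iff.1 (Filter.inter_mem hV₁ hV₂)
  refine ⟨S.restrict hVo h0V, fun η hη η' hη' k hk => ?_⟩
  exact hV (show (η, η') ∈ V₁ ×ˢ V₂ from ⟨(hVsub hη.2).1, (hVsub hη'.2).2⟩) k (Set.mem_univ _) hk

end Separation

/-! ### The topology of the moduli space -/

section Topology

variable {n g : ℕ} {β : SU n}

theorem proj_eq_iff (hβ : β ∈ Subgroup.center (SU n)) {h h' : Yfib n g β} :
    Moduli.proj h = Moduli.proj h' ↔ ∃ k, conjY k h.1 = h'.1 := by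
  rw [Moduli.proj, Moduli.proj, Quotient.eq]
  constructor
  · rintro ⟨k, -, hk⟩
    exact ⟨k, funext hk⟩
  · rintro ⟨k, hk⟩
    refine ⟨k, ?_, congrFun hk⟩
    rw [Subgroup.mem_centralizer_iff]
    rintro _ rfl
    exact (Subgroup.mem_center_iff.1 hβ k).symm

/-- Conjugation on the fibre over a central element. -/
def conjFib (hβ : β ∈ Subgroup.center (SU n)) (k : SU n) (h : Yfib n g β) : Yfib n g β :=
  ⟨conjY k h.1, epsR_conjY hβ k h.2⟩

theorem continuous_conjFib (hβ : β ∈ Subgroup.center (SU n)) (k : SU n) :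
    Continuous (conjFib (g := g) hβ k) :=
  (continuous_conjY.comp (continuous_const.prodMk continuous_subtype_val)).subtype_mk _

theorem proj_conjFib (hβ : β ∈ Subgroup.center (SU n)) (k : SU n) (h : Yfib n g β) :
    Moduli.proj (conjFib hβ k h) = Moduli.proj h :=
  ((proj_eq_iff hβ).2 ⟨k, rfl⟩).symm

theorem isOpenQuotientMap_proj (hβ : β ∈ Subgroup.center (SU n)) :
    IsOpenQuotientMap (Moduli.proj (n := n) (g := g) (t := β)) where
  surjective := Quotient.mk_surjective
  continuous := continuous_quot_mk
  isOpenMap := by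
    intro U hU
    refine isOpen_coinduced.2 ?_
    have e : (Quot.mk (conjSetoid n g β) : Yfib n g β → Moduli n g β) ⁻¹' (Moduli.proj '' U) =
        ⋃ k : SU n, conjFib hβ k ⁻¹' U := by
      ext h
      simp only [Set.mem_preimage, Set.mem_iUnion]
      constructor
      · rintro ⟨h', hh', e⟩
        obtain ⟨k, hk⟩ := (proj_eq_iff hβ).1 e.symm
        exact ⟨k, by rwa [show conjFib hβ k h = h' from Subtype.ext hk]⟩
      · rintro ⟨k, hk⟩
        exact ⟨_, hk, proj_conjFib hβ k h⟩
    exact e ▸ isOpen_iUnion fun k => hU.preimage (continuous_conjFib hβ k)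

theorem isClosed_conj : IsClosed {q : Y n g × Y n g | ∃ k, conjY k q.1 = q.2} := by
  have hc1 : Continuous fun p : SU n × (Y n g × Y n g) => conjY p.1 p.2.1 :=
    Continuous.comp (g := fun p : SU n × Y n g => conjY p.1 p.2)
      (f := fun p : SU n × (Y n g × Y n g) => (p.1, p.2.1)) continuous_conjY
      (continuous_fst.prodMk (continuous_fst.comp continuous_snd))
  have hc2 : Continuous fun p : SU n × (Y n g × Y n g) => p.2.2 :=
    continuous_snd.comp continuous_snd
  have hc := isClosedMap_snd_of_compactSpace _ (isClosed_eq hc1 hc2)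
  convert hc using 1
  ext q
  constructor
  · rintro ⟨k, hk⟩
    exact ⟨(k, q), hk, rfl⟩
  · rintro ⟨⟨k, _⟩, hk, rfl⟩
    exact ⟨k, hk⟩

theorem t2Space_moduli (hβ : β ∈ Subgroup.center (SU n)) : T2Space (Moduli n g β) := by
  rw [t2Space_iff_of_isOpenQuotientMap (isOpenQuotientMap_proj hβ)]
  have hc : Continuous fun q : Yfib n g β × Yfib n g β => ((q.1.1, q.2.1) : Y n g × Y n g) :=
    (continuous_subtype_val.comp continuous_fst).prodMk
      (continuous_subtype_val.comp continuous_snd)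
  convert isClosed_conj.preimage hc using 1
  ext q
  exact proj_eq_iff hβ

theorem secondCountableTopology_moduli (hβ : β ∈ Subgroup.center (SU n)) :
    SecondCountableTopology (Moduli n g β) :=
  (isOpenQuotientMap_proj hβ).isQuotientMap.secondCountableTopology
    (isOpenQuotientMap_proj hβ).isOpenMap

end Topology

/-! ### The extended moduli space near the zero level -/

section Extended

variable {n g : ℕ} (L : LogChart n) (β : SU n)

theorem isEmbedding_extIncl : Topology.IsEmbedding (ExtModuli.incl (n := n) (g := g) (β := β)) :=
  (isEmbedding_inclY.prodMap Topology.IsEmbedding.id).comp Topology.IsEmbedding.subtypeVal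

/-- The part of the extended moduli space where `Λ` is in the injectivity domain of `exp`: there
`Λ = log(β⁻¹ ε_R(h))`, and the extended moduli space is an open part of `SU(n)^{2g}`. -/
def extOpens (g : ℕ) : Opens (ExtModuli n g β) :=
  ⟨{p | p.1.2 ∈ L.cod}, L.isOpen_cod.preimage (continuous_snd.comp continuous_subtype_val)⟩

variable {L β}

theorem isEmbedding_extOpens :
    Topology.IsEmbedding fun x : extOpens L β g => ExtModuli.incl (x : ExtModuli n g β) :=
  (isEmbedding_extIncl β).comp Topology.IsEmbedding.subtypeVal

theorem extOpens_exp_mem (x : extOpens L β g) : ((β⁻¹ * epsR x.1.1.1 : SU n) : Mat n) ∈ L.dom := by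
  rw [x.1.2, inv_mul_cancel_left]
  exact L.exp_mem _ x.2

theorem extOpens_log (x : extOpens L β g) :
    L.log ((β⁻¹ * epsR x.1.1.1 : SU n) : Mat n) = x.1.1.2 := by
  rw [x.1.2, inv_mul_cancel_left]
  exact L.log_exp _ x.2

/-- The point of the extended moduli space over `h exp(ξ)`. -/
def extPoint (h : Y n g) {ξ : Fin g × Fin 2 → su n} (hξ : ξ ∈ relDom L β h) : extOpens L β g :=
  ⟨⟨(expY h ξ, relLog L β h ξ), by
    have := L.exp_log _ hξ
    change epsR (expY h ξ) = β * expSU (relLog L β h ξ)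
    rw [relLog, this, mul_inv_cancel_left]⟩, L.log_mem _ hξ⟩

/-- Linear coordinates on `𝔰𝔲(n)^{2g}`. -/
def tanCoord (n g : ℕ) : EuclideanSpace ℝ (Fin (Module.finrank ℝ (Fin g × Fin 2 → su n))) ≃L[ℝ]
    (Fin g × Fin 2 → su n) := toEuclidean.symm

open Classical in
/-- The exponential parametrization of the extended moduli space around a point. -/
def extParam (x : extOpens L β g)
    (u : EuclideanSpace ℝ (Fin (Module.finrank ℝ (Fin g × Fin 2 → su n)))) : extOpens L β g :=
  if h : tanCoord n g u ∈ relDom L β x.1.1.1 then extPoint _ h else x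

theorem incl_extParam (x : extOpens L β g)
    {u : EuclideanSpace ℝ (Fin (Module.finrank ℝ (Fin g × Fin 2 → su n)))}
    (hu : tanCoord n g u ∈ relDom L β x.1.1.1) :
    ExtModuli.incl (extParam x u).1 =
      (inclY (expY x.1.1.1 (tanCoord n g u)), relLog L β x.1.1.1 (tanCoord n g u)) := by
  rw [extParam, dif_pos hu]
  rfl

/-- The domain of the exponential parametrization. -/
def extParamDom (x : extOpens L β g) :
    Set (EuclideanSpace ℝ (Fin (Module.finrank ℝ (Fin g × Fin 2 → su n)))) :=
  tanCoord n g ⁻¹' (L.codY g ∩ relDom L β x.1.1.1)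

theorem isOpen_extParamDom (x : extOpens L β g) : IsOpen (extParamDom x) :=
  (L.isOpen_codY.inter (isOpen_relDom L β _)).preimage (tanCoord n g).continuous

theorem contDiffOn_extParam (x : extOpens L β g) :
    ContDiffOn ℝ ∞ (fun u => ExtModuli.incl (extParam x u).1) (extParamDom x) := by
  have h1 : ContDiffOn ℝ ∞ (fun u => (inclY (expY x.1.1.1 (tanCoord n g u)),
      relLog L β x.1.1.1 (tanCoord n g u))) (extParamDom x) :=
    (((contDiff_inclY_expY x.1.1.1).comp (tanCoord n g).contDiff).contDiffOn.prodMk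
      ((contDiffOn_relLog L β x.1.1.1).comp (tanCoord n g).contDiff.contDiffOn
        fun u hu => hu.2)).of_le le_top
  exact h1.congr fun u hu => incl_extParam x hu.2

/-- Logarithmic coordinates on the extended moduli space. -/
def extChart (x : extOpens L β g) : OpenPartialHomeomorph (extOpens L β g)
    (EuclideanSpace ℝ (Fin (Module.finrank ℝ (Fin g × Fin 2 → su n)))) :=
  paramChart isEmbedding_extOpens (p := extParam x)
    (r := fun z => (tanCoord n g).symm (L.logY x.1.1.1 z.1))
    (D := extParamDom x) (O := L.domY x.1.1.1 ×ˢ Set.univ)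
    (isOpen_extParamDom x) ((L.isOpen_domY _).prod isOpen_univ) (contDiffOn_extParam x)
    ((tanCoord n g).symm.contDiff.comp_contDiffOn
      (((L.contDiffOn_logY x.1.1.1).of_le le_top).comp contDiff_fst.contDiffOn fun z hz => hz.1))
    (fun u hu => by
      rw [incl_extParam x hu.2]
      refine ⟨⟨L.expY_mem _ hu.1, Set.mem_univ _⟩, ?_⟩
      change (tanCoord n g).symm (L.logY _ (inclY (expY _ _))) = u
      rw [L.logY_expY _ hu.1, ContinuousLinearEquiv.symm_apply_apply])
    (fun m hm => by
      have h1 : expY x.1.1.1 (L.logY x.1.1.1 (inclY m.1.1.1)) = m.1.1.1 := L.expY_logY _ hm.1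
      have h2 : tanCoord n g ((tanCoord n g).symm (L.logY x.1.1.1 (inclY m.1.1.1))) =
        L.logY x.1.1.1 (inclY m.1.1.1) := ContinuousLinearEquiv.apply_symm_apply _ _
      have h3 : L.logY x.1.1.1 (inclY m.1.1.1) ∈ relDom L β x.1.1.1 := by
        change ((β⁻¹ * epsR (expY _ _) : SU n) : Mat n) ∈ L.dom
        rw [h1]
        exact extOpens_exp_mem m
      have h4 : (tanCoord n g).symm (L.logY x.1.1.1 (inclY m.1.1.1)) ∈ extParamDom x := by
        change tanCoord n g _ ∈ L.codY g ∩ relDom L β x.1.1.1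
        rw [h2]
        exact ⟨L.logY_mem _ hm.1, h3⟩
      refine ⟨h4, isEmbedding_extOpens.injective ?_⟩
      change ExtModuli.incl (extParam x ((tanCoord n g).symm (L.logY x.1.1.1 (inclY m.1.1.1)))).1 =
        (inclY m.1.1.1, m.1.1.2)
      rw [incl_extParam x h4.2, h2, h1, relLog, h1, extOpens_log])

theorem mem_extChart_source (x : extOpens L β g) : x ∈ (extChart x).source :=
  show _ ∈ L.domY x.1.1.1 ×ˢ Set.univ from ⟨L.inclY_mem_domY _, Set.mem_univ _⟩

theorem extChart_self (x : extOpens L β g) : extChart x x = 0 := by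
  change (tanCoord n g).symm (L.logY x.1.1.1 (inclY x.1.1.1)) = 0
  rw [L.logY_self, map_zero]

/-- Near the zero level `X_β` is the graph of `log(β⁻¹ε_R)` over an open subset of `SU(n)^{2g}`. In
these coordinates the moment map is twice this function, whose differential is onto by
irreducibility. -/
theorem isRegularValue_momentMap (L : LogChart n) (B : InvariantInnerProduct n)
    (hirr : ∀ h : Y n g, epsR h = β → HasTrivialStabilizer h) :
    IsRegularValue (ExtModuli.incl (n := n) (g := g) (β := β)) momentMap 0 := by
  let _ := chartedSpaceOfCharts (extChart (L := L) (β := β) (g := g)) mem_extChart_source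
  have hA : ∀ e ∈ atlas (EuclideanSpace ℝ (Fin (Module.finrank ℝ (Fin g × Fin 2 → su n))))
      (extOpens L β g), IsEmbeddedChart (fun x : extOpens L β g => ExtModuli.incl x.1) e := by
    rintro _ ⟨x, rfl⟩
    exact isEmbeddedChart_paramChart _ _ _ _ _ _ _
  have hE := isEmbeddedBy_of_isEmbeddedChart hA isEmbedding_extOpens
  have hsmooth : ContMDiff (𝓡 (Module.finrank ℝ (Fin g × Fin 2 → su n))) 𝓘(ℝ, su n) ∞
      (fun x : extOpens L β g => momentMap x.1) := by
    have h1 : ContDiff ℝ ∞ fun z : (Fin g × Fin 2 → Mat n) × su n => (2 : ℝ) • z.2 :=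
      contDiff_snd.const_smul 2
    exact h1.contMDiff.comp hE.contMDiff
  refine ⟨extOpens L β g, _, inferInstance, ?_, hE, hsmooth, ?_⟩
  · intro p hp
    have h1 : (2 : ℝ) • p.1.2 = 0 := hp
    have h2 : p.1.2 = 0 := (smul_eq_zero.1 h1).resolve_left two_ne_zero
    change p.1.2 ∈ L.cod
    rw [h2]
    exact L.zero_mem
  · intro x hx
    have h1 : (2 : ℝ) • x.1.1.2 = 0 := hx
    have h2 : x.1.1.2 = 0 := (smul_eq_zero.1 h1).resolve_left two_ne_zero
    have hh : epsR x.1.1.1 = β := by rw [x.1.2, h2, expSU_zero, mul_one]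
    rw [mfderiv_eq_fderiv_chart ((hsmooth x).mdifferentiableAt (by simp))]
    change Function.Surjective (fderiv ℝ (fun u => momentMap (extParam x u).1) (extChart x x))
    rw [extChart_self]
    have h3 : (fun u => momentMap (extParam x u).1) =ᶠ[nhds 0]
        fun u => (2 : ℝ) • relLog L β x.1.1.1 (tanCoord n g u) := by
      have h0 : (0 : EuclideanSpace ℝ (Fin (Module.finrank ℝ (Fin g × Fin 2 → su n)))) ∈
          extParamDom x := by
        rw [← extChart_self x]
        exact (extChart x).map_source (mem_extChart_source x)
      filter_upwards [(isOpen_extParamDom x).mem_nhds h0] with u hu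
      exact congrArg (fun z => (2 : ℝ) • z.2) (incl_extParam x hu.2)
    have h4 : HasFDerivAt (relLog L β x.1.1.1) (fderiv ℝ (relLog L β x.1.1.1) 0)
        (tanCoord n g 0) := by
      rw [map_zero]
      exact ((contDiffAt_relLog L hh).differentiableAt (by simp)).hasFDerivAt
    have h5 := (h4.comp 0 (tanCoord n g).hasFDerivAt).const_smul (2 : ℝ)
    have h6 := h5.congr_of_eventuallyEq h3
    rw [h6.fderiv]
    intro Z
    obtain ⟨c, hc⟩ := (adRep_bijective (n := n) β⁻¹).2 ((2 : ℝ)⁻¹ • Z)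
    obtain ⟨ξ, hξ⟩ := dEvalL_surjective B (hirr _ hh) c
    refine ⟨(tanCoord n g).symm ξ, ?_⟩
    change (2 : ℝ) • fderiv ℝ (relLog L β x.1.1.1) 0 (tanCoord n g ((tanCoord n g).symm ξ)) = Z
    rw [ContinuousLinearEquiv.apply_symm_apply, fderiv_relLog L hh, ← dEvalL_apply, hξ,
      ← adRep_apply, hc, smul_inv_smul₀ two_ne_zero]

end Extended

/-! ### Charts of the fibre and of the moduli space -/

section Charts

variable {n g : ℕ} {β : SU n}

theorem isEmbedding_fibIncl :
    Topology.IsEmbedding (Yfib.incl (n := n) (g := g) (t := β)) :=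
  isEmbedding_inclY.comp Topology.IsEmbedding.subtypeVal

namespace Slice

variable {h : Yfib n g β} (S : Slice β h.1)

open Classical in
/-- The slice as a map to the fibre. -/
def sFib (η : EuclideanSpace ℝ (Fin (dimModuli n g))) : Yfib n g β :=
  if hη : η ∈ S.dom then ⟨S.s η, S.epsR_s η hη⟩ else h

theorem coe_sFib {η : EuclideanSpace ℝ (Fin (dimModuli n g))} (hη : η ∈ S.dom) :
    (S.sFib η).1 = S.s η := by rw [sFib, dif_pos hη]

theorem sFib_zero : S.sFib 0 = h := Subtype.ext (by rw [S.coe_sFib S.zero_mem_dom, S.s_zero])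

theorem contDiffOn_sFib : ContDiffOn ℝ ∞ (fun η => Yfib.incl (S.sFib η)) S.dom :=
  (S.contDiffOn_s.of_le le_top).congr fun η hη => by
    change inclY (S.sFib η).1 = _
    rw [S.coe_sFib hη]

/-- Points of the fibre near the slice are conjugate to points of the slice. -/
theorem conjFib_sFib (hβ : β ∈ Subgroup.center (SU n)) {y : Yfib n g β}
    (hy : Yfib.incl y ∈ S.rdom) :
    conjFib hβ (expSU (S.r (Yfib.incl y)).1) (S.sFib (S.r (Yfib.incl y)).2) = y := by
  refine Subtype.ext ?_
  change conjY _ (S.sFib _).1 = y.1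
  have h2 : (S.r (Yfib.incl y)).2 ∈ S.dom := (S.r_mem y.1 y.2 hy).2
  rw [S.coe_sFib h2]
  exact S.param_r y.1 y.2 hy

theorem incl_sFib_mem {η : EuclideanSpace ℝ (Fin (dimModuli n g))} (hη : η ∈ S.dom) :
    Yfib.incl (S.sFib η) ∈ S.rdom ∧ S.r (Yfib.incl (S.sFib η)) = (0, η) := by
  have h1 := S.mem_rdom 0 S.zero_mem_domX η hη
  have h2 := S.r_param 0 S.zero_mem_domX η hη
  rw [expSU_zero, conjY_one, ← S.coe_sFib hη] at h1 h2
  exact ⟨h1, h2⟩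

end Slice

/-- Linear coordinates on the model space of the fibre. -/
def fibCoord (n g : ℕ) : EuclideanSpace ℝ (Fin (Module.finrank ℝ
    (su n × EuclideanSpace ℝ (Fin (dimModuli n g))))) ≃L[ℝ]
    su n × EuclideanSpace ℝ (Fin (dimModuli n g)) := toEuclidean.symm

variable {h : Yfib n g β}

section
variable (hβ : β ∈ Subgroup.center (SU n)) (S : Slice β h.1)

/-- The parametrization `(X, η) ↦ exp(X) s(η) exp(-X)` of the fibre. -/
def fibParam (u : EuclideanSpace ℝ (Fin (Module.finrank ℝ
    (su n × EuclideanSpace ℝ (Fin (dimModuli n g)))))) : Yfib n g β :=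
  conjFib hβ (expSU (fibCoord n g u).1) (S.sFib (fibCoord n g u).2)

theorem incl_fibParam {u : EuclideanSpace ℝ (Fin (Module.finrank ℝ
    (su n × EuclideanSpace ℝ (Fin (dimModuli n g)))))} (hu : (fibCoord n g u).2 ∈ S.dom) :
    Yfib.incl (fibParam hβ S u) =
      inclY (conjY (expSU (fibCoord n g u).1) (S.s (fibCoord n g u).2)) := by
  rw [← S.coe_sFib hu]
  rfl

theorem contDiffOn_fibParam : ContDiffOn ℝ ∞ (fun u => Yfib.incl (fibParam hβ S u))
    (fibCoord n g ⁻¹' (S.domX ×ˢ S.dom)) := by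
  have h1 : ContDiffOn ℝ ω (fun p : su n × EuclideanSpace ℝ (Fin (dimModuli n g)) =>
      inclY (conjY (expSU p.1) (S.s p.2))) (S.domX ×ˢ S.dom) := by
    refine contDiffOn_pi.2 fun s => ?_
    simp only [inclY, conjY, Submonoid.coe_mul, ← expSU_neg]
    have h2 : ContDiffOn ℝ ω (fun p : su n × EuclideanSpace ℝ (Fin (dimModuli n g)) =>
        (S.s p.2 s : Mat n)) (S.domX ×ˢ S.dom) :=
      (contDiffOn_pi.1 S.contDiffOn_s s).comp contDiff_snd.contDiffOn fun p hp => hp.2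
    exact ((contDiff_expSU.comp contDiff_fst).contDiffOn.mul h2).mul
      (contDiff_expSU.comp contDiff_fst.neg).contDiffOn
  exact ((h1.comp (fibCoord n g).contDiff.contDiffOn fun u hu => hu).of_le le_top).congr
    fun u hu => incl_fibParam hβ S hu.2

/-- The chart of the fibre given by a slice. -/
def fibChart : OpenPartialHomeomorph (Yfib n g β) (EuclideanSpace ℝ (Fin (Module.finrank ℝ
    (su n × EuclideanSpace ℝ (Fin (dimModuli n g)))))) :=
  paramChart isEmbedding_fibIncl (p := fibParam hβ S)
    (r := fun A => (fibCoord n g).symm (S.r A))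
    (D := fibCoord n g ⁻¹' (S.domX ×ˢ S.dom)) (O := S.rdom)
    ((S.isOpen_domX.prod S.isOpen_dom).preimage (fibCoord n g).continuous) S.isOpen_rdom
    (contDiffOn_fibParam hβ S)
    ((fibCoord n g).symm.contDiff.comp_contDiffOn (S.contDiffOn_r.of_le le_top))
    (fun u hu => by
      rw [incl_fibParam hβ S hu.2]
      refine ⟨S.mem_rdom _ hu.1 _ hu.2, ?_⟩
      rw [S.r_param _ hu.1 _ hu.2]
      exact (fibCoord n g).symm_apply_apply u)
    (fun y hy => by
      have h1 : fibCoord n g ((fibCoord n g).symm (S.r (Yfib.incl y))) = S.r (Yfib.incl y) :=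
        (fibCoord n g).apply_symm_apply _
      refine ⟨?_, ?_⟩
      · change fibCoord n g _ ∈ S.domX ×ˢ S.dom
        rw [h1]
        exact S.r_mem y.1 y.2 hy
      · rw [fibParam, h1]
        exact S.conjFib_sFib hβ hy)

theorem isEmbeddedChart_fibChart : IsEmbeddedChart Yfib.incl (fibChart hβ S) :=
  isEmbeddedChart_paramChart _ _ _ _ _ _ _

theorem mem_fibChart_source : h ∈ (fibChart hβ S).source := by
  have := (S.incl_sFib_mem S.zero_mem_dom).1
  rwa [S.sFib_zero] at this

end

theorem isOpen_image_proj_sFib (hβ : β ∈ Subgroup.center (SU n)) (S : Slice β h.1)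
    {W : Set (EuclideanSpace ℝ (Fin (dimModuli n g)))} (hW : IsOpen W)
    (hWS : W ⊆ S.dom) : IsOpen ((fun η => Moduli.proj (S.sFib η)) '' W) := by
  have e : (fun η => Moduli.proj (S.sFib η)) '' W =
      Moduli.proj '' (Yfib.incl ⁻¹' (S.rdom ∩ S.r ⁻¹' (Prod.snd ⁻¹' W))) := by
    ext m
    constructor
    · rintro ⟨η, hη, rfl⟩
      obtain ⟨h1, h2⟩ := S.incl_sFib_mem (hWS hη)
      exact ⟨_, ⟨h1, by rw [Set.mem_preimage, h2]; exact hη⟩, rfl⟩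
    · rintro ⟨y, hy, rfl⟩
      refine ⟨_, hy.2, ?_⟩
      have h1 := S.conjFib_sFib hβ hy.1
      change Moduli.proj (S.sFib (S.r (Yfib.incl y)).2) = Moduli.proj y
      rw [← proj_conjFib hβ (expSU (S.r (Yfib.incl y)).1), h1]
  rw [e]
  exact (isOpenQuotientMap_proj hβ).isOpenMap _
    ((S.contDiffOn_r.continuousOn.isOpen_inter_preimage S.isOpen_rdom
      (hW.preimage continuous_snd)).preimage isEmbedding_fibIncl.continuous)

theorem injOn_proj_sFib (hβ : β ∈ Subgroup.center (SU n)) {S : Slice β h.1} (hS : S.Separating) :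
    Set.InjOn (fun η => Moduli.proj (S.sFib η)) S.dom := by
  intro η hη η' hη' e
  obtain ⟨k, hk⟩ := (proj_eq_iff hβ).1 e
  rw [S.coe_sFib hη, S.coe_sFib hη'] at hk
  exact hS η hη η' hη' k hk

variable (hβ : β ∈ Subgroup.center (SU n)) {S : Slice β h.1}

/-- The local parametrization of the moduli space given by a separating slice. -/
def modParam (hS : S.Separating) : OpenPartialHomeomorph
    (EuclideanSpace ℝ (Fin (dimModuli n g))) (Moduli n g β) :=
  OpenPartialHomeomorph.ofContinuousOpenRestrict (injOn_proj_sFib hβ hS).toPartialEquiv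
    ((isOpenQuotientMap_proj hβ).continuous.comp_continuousOn
      (isEmbedding_fibIncl.isInducing.continuousOn_iff.2 S.contDiffOn_sFib.continuousOn))
    (by
      intro W hW
      change Set S.dom at W
      change IsOpen ((((fun η => Moduli.proj (S.sFib η)) ∘ Subtype.val) : S.dom → _) '' W)
      rw [Set.image_comp]
      exact isOpen_image_proj_sFib hβ S (S.isOpen_dom.isOpenMap_subtype_val W hW)
        (Subtype.coe_image_subset _ _))
    S.isOpen_dom

/-- The chart of the moduli space given by a separating slice. -/
def modChart (hS : S.Separating) : OpenPartialHomeomorph (Moduli n g β)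
    (EuclideanSpace ℝ (Fin (dimModuli n g))) := (modParam hβ hS).symm

theorem modChart_symm (hS : S.Separating) (η : EuclideanSpace ℝ (Fin (dimModuli n g))) :
    (modChart hβ hS).symm η = Moduli.proj (S.sFib η) := rfl

/-- On the moduli space, the slice coordinates of a point of the fibre do not depend on the point
in its orbit. -/
theorem modChart_proj (hS : S.Separating) {y : Yfib n g β} (hy : Yfib.incl y ∈ S.rdom) :
    Moduli.proj y ∈ (modChart hβ hS).source ∧
      modChart hβ hS (Moduli.proj y) = (S.r (Yfib.incl y)).2 := by
  have h0 : (S.r (Yfib.incl y)).2 ∈ (modChart hβ hS).target := (S.r_mem y.1 y.2 hy).2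
  have h1 : (modChart hβ hS).symm (S.r (Yfib.incl y)).2 = Moduli.proj y := by
    rw [modChart_symm, ← proj_conjFib hβ (expSU (S.r (Yfib.incl y)).1), S.conjFib_sFib hβ hy]
  rw [← h1]
  exact ⟨(modChart hβ hS).map_target h0, (modChart hβ hS).right_inv h0⟩

theorem exists_of_mem_modChart_source (hS : S.Separating) {y : Yfib n g β}
    (hy : Moduli.proj y ∈ (modChart hβ hS).source) :
    ∃ k : SU n, conjFib hβ k y = S.sFib (modChart hβ hS (Moduli.proj y)) := by
  have h1 := (modChart hβ hS).left_inv hy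
  rw [modChart_symm] at h1
  obtain ⟨k, hk⟩ := (proj_eq_iff hβ).1 h1.symm
  exact ⟨k, Subtype.ext hk⟩

theorem proj_mem_modChart_source (hS : S.Separating) :
    Moduli.proj h ∈ (modChart hβ hS).source := by
  have := (S.incl_sFib_mem S.zero_mem_dom).1
  rw [S.sFib_zero] at this
  exact (modChart_proj hβ hS this).1

/-- Conjugation by `k` as a linear map of tuples of matrices. -/
def conjMat (k : SU n) (A : Fin g × Fin 2 → Mat n) : Fin g × Fin 2 → Mat n :=
  fun s => (k : Mat n) * A s * ((k⁻¹ : SU n) : Mat n)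

theorem contDiff_conjMat {m : WithTop ℕ∞} (k : SU n) : ContDiff ℝ m (conjMat (g := g) k) :=
  contDiff_pi.2 fun s => (contDiff_const.mul (contDiff_apply ℝ (Mat n) s)).mul contDiff_const

theorem incl_conjFib (k : SU n) (y : Yfib n g β) :
    Yfib.incl (conjFib hβ k y) = conjMat k (Yfib.incl y) := rfl

theorem isManifold_moduli [ChartedSpace (EuclideanSpace ℝ (Fin (dimModuli n g))) (Moduli n g β)]
    (hM : ∀ e ∈ atlas (EuclideanSpace ℝ (Fin (dimModuli n g))) (Moduli n g β),
      ∃ (h : Yfib n g β) (S : Slice β h.1) (hS : S.Separating), e = modChart hβ hS) :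
    IsManifold (𝓡 (dimModuli n g)) ∞ (Moduli n g β) := by
  refine isManifold_of_contDiffOn _ _ _ fun e e' he he' => ?_
  obtain ⟨h, S, hS, rfl⟩ := hM e he
  obtain ⟨h', S', hS', rfl⟩ := hM e' he'
  simp only [modelWithCornersSelf_coe, modelWithCornersSelf_coe_symm, Function.comp_id,
    Function.id_comp, Set.range_id, Set.inter_univ, Set.preimage_id]
  intro η hη
  have hη1 : η ∈ S.dom := hη.1
  have hη2 : Moduli.proj (S.sFib η) ∈ (modChart hβ hS').source := hη.2
  obtain ⟨k, hk⟩ := exists_of_mem_modChart_source hβ hS' hη2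
  -- near `η` the transition map is `r'` after conjugation by `k`
  have hA : ContDiffAt ℝ ∞ (fun ζ => conjMat k (Yfib.incl (S.sFib ζ))) η :=
    (contDiff_conjMat k).contDiffAt.comp η
      (S.contDiffOn_sFib.contDiffAt (S.isOpen_dom.mem_nhds hη1))
  have hmem : conjMat k (Yfib.incl (S.sFib η)) ∈ S'.rdom := by
    rw [← incl_conjFib hβ, hk]
    exact (S'.incl_sFib_mem ((modChart hβ hS').map_source hη2)).1
  have hr : ContDiffAt ℝ ∞ (fun ζ => (S'.r (conjMat k (Yfib.incl (S.sFib ζ)))).2) η :=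
    contDiff_snd.contDiffAt.comp η (((S'.contDiffOn_r.of_le le_top).contDiffAt
      (S'.isOpen_rdom.mem_nhds hmem)).comp η hA)
  refine (hr.congr_of_eventuallyEq ?_).contDiffWithinAt
  filter_upwards [hA.continuousAt.eventually (S'.isOpen_rdom.mem_nhds hmem)] with ζ hζ
  rw [← incl_conjFib hβ] at hζ
  change modChart hβ hS' (Moduli.proj (S.sFib ζ)) = _
  rw [← proj_conjFib hβ k, (modChart_proj hβ hS' hζ).2, incl_conjFib]

theorem contMDiff_conjFib {m : ℕ} [ChartedSpace (EuclideanSpace ℝ (Fin m)) (Yfib n g β)]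
    (hY : ∀ e ∈ atlas (EuclideanSpace ℝ (Fin m)) (Yfib n g β), IsEmbeddedChart Yfib.incl e)
    (k : SU n) : ContMDiff (𝓡 m) (𝓡 m) ∞ (conjFib (g := g) hβ k) := by
  intro y
  refine contMDiffAt_of_comp_incl hY isEmbedding_fibIncl ?_
  exact (contDiff_conjMat k).contMDiff.contMDiffAt.comp y
    (contMDiff_of_isEmbeddedChart hY isEmbedding_fibIncl.continuous y)

end Charts

/-! ### The quotient map -/

section Submersion

variable {n g m : ℕ} {β : SU n} [ChartedSpace (EuclideanSpace ℝ (Fin m)) (Yfib n g β)]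

theorem Slice.contMDiffAt_sFib {h : Yfib n g β} (S : Slice β h.1)
    (hY : ∀ e ∈ atlas (EuclideanSpace ℝ (Fin m)) (Yfib n g β), IsEmbeddedChart Yfib.incl e)
    {η : EuclideanSpace ℝ (Fin (dimModuli n g))} (hη : η ∈ S.dom) :
    ContMDiffAt (𝓡 (dimModuli n g)) (𝓡 m) ∞ S.sFib η :=
  contMDiffAt_of_comp_incl hY isEmbedding_fibIncl
    (S.contDiffOn_sFib.contDiffAt (S.isOpen_dom.mem_nhds hη)).contMDiffAt

variable [ChartedSpace (EuclideanSpace ℝ (Fin (dimModuli n g))) (Moduli n g β)]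

theorem contMDiff_proj (hβ : β ∈ Subgroup.center (SU n))
    (hY : ∀ e ∈ atlas (EuclideanSpace ℝ (Fin m)) (Yfib n g β), IsEmbeddedChart Yfib.incl e)
    (hM : ∀ e ∈ atlas (EuclideanSpace ℝ (Fin (dimModuli n g))) (Moduli n g β),
      ∃ (h : Yfib n g β) (S : Slice β h.1) (hS : S.Separating), e = modChart hβ hS) :
    ContMDiff (𝓡 m) (𝓡 (dimModuli n g)) ∞ (Moduli.proj (n := n) (g := g) (t := β)) := by
  have := isManifold_moduli hβ hM
  intro y
  obtain ⟨h, S, hS, he⟩ := hM _ (chart_mem_atlas _ (Moduli.proj y))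
  have hy : Moduli.proj y ∈ (modChart hβ hS).source := he ▸ mem_chart_source _ _
  obtain ⟨k, hk⟩ := exists_of_mem_modChart_source hβ hS hy
  have hmem : conjMat k (Yfib.incl y) ∈ S.rdom := by
    rw [← incl_conjFib hβ, hk]
    exact (S.incl_sFib_mem ((modChart hβ hS).map_source hy)).1
  have hcont := (isOpenQuotientMap_proj (n := n) (g := g) hβ).continuous.continuousAt (x := y)
  rw [contMDiffAt_iff_target]
  refine ⟨hcont, ?_⟩
  have hA : ContMDiffAt (𝓡 m) 𝓘(ℝ, Fin g × Fin 2 → Mat n) ∞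
      (fun z : Yfib n g β => conjMat k (Yfib.incl z)) y :=
    (contDiff_conjMat k).contMDiff.contMDiffAt.comp y
      (contMDiff_of_isEmbeddedChart hY isEmbedding_fibIncl.continuous y)
  have hr : ContDiffAt ℝ ∞ (fun A => (S.r A).2) (conjMat k (Yfib.incl y)) :=
    contDiff_snd.contDiffAt.comp _ ((S.contDiffOn_r.of_le le_top).contDiffAt
      (S.isOpen_rdom.mem_nhds hmem))
  refine (hr.contMDiffAt.comp y hA).congr_of_eventuallyEq ?_
  filter_upwards [hA.continuousAt.eventually (S.isOpen_rdom.mem_nhds hmem)] with z hz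
  rw [← incl_conjFib hβ] at hz
  simp only [extChartAt, he, Function.comp_apply, mfld_simps]
  rw [← proj_conjFib hβ k, (modChart_proj hβ hS hz).2, incl_conjFib]

/-- The quotient map is a submersion, because through every point of the fibre there is a smooth
local section: a slice, moved by a conjugation. -/
theorem surjective_mfderiv_proj (hβ : β ∈ Subgroup.center (SU n))
    (hY : ∀ e ∈ atlas (EuclideanSpace ℝ (Fin m)) (Yfib n g β), IsEmbeddedChart Yfib.incl e)
    (hM : ∀ e ∈ atlas (EuclideanSpace ℝ (Fin (dimModuli n g))) (Moduli n g β),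
      ∃ (h : Yfib n g β) (S : Slice β h.1) (hS : S.Separating), e = modChart hβ hS)
    (y : Yfib n g β) :
    Function.Surjective (mfderiv (𝓡 m) (𝓡 (dimModuli n g)) Moduli.proj y) := by
  have := isManifold_moduli hβ hM
  obtain ⟨h, S, hS, he⟩ := hM _ (chart_mem_atlas _ (Moduli.proj y))
  have hy : Moduli.proj y ∈ (modChart hβ hS).source := he ▸ mem_chart_source _ _
  obtain ⟨k, hk⟩ := exists_of_mem_modChart_source hβ hS hy
  set η := modChart hβ hS (Moduli.proj y) with hη
  have hηS : η ∈ S.dom := (modChart hβ hS).map_source hy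
  have hback : conjFib hβ k⁻¹ (S.sFib η) = y := by
    rw [← hk]
    refine Subtype.ext ?_
    change conjY k⁻¹ (conjY k y.1) = y.1
    rw [← conjY_mul, inv_mul_cancel, conjY_one]
  have hsec : MDifferentiableAt (𝓡 (dimModuli n g)) (𝓡 m)
      (fun ζ => conjFib hβ k⁻¹ (S.sFib ζ)) η :=
    (((contMDiff_conjFib hβ hY k⁻¹).contMDiffAt).comp η (S.contMDiffAt_sFib hY hηS)).mdifferentiableAt
      (by simp)
  have hq : MDifferentiableAt (𝓡 m) (𝓡 (dimModuli n g)) Moduli.proj (conjFib hβ k⁻¹ (S.sFib η)) :=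
    (contMDiff_proj hβ hY hM _).mdifferentiableAt (by simp)
  have hcomp := mfderiv_comp η hq hsec
  have heq : Moduli.proj ∘ (fun ζ => conjFib hβ k⁻¹ (S.sFib ζ)) =
      (extChartAt (𝓡 (dimModuli n g)) (Moduli.proj y)).symm := by
    funext ζ
    simp only [extChartAt, he, Function.comp_apply, mfld_simps]
    rw [proj_conjFib, modChart_symm]
  rw [heq, hback] at hcomp
  have hinv := isInvertible_mfderivWithin_extChartAt_symm (I := 𝓡 (dimModuli n g))
    (x := Moduli.proj y) (y := η) (by simpa [extChartAt, he] using (show η ∈ (modChart hβ hS).target from hηS))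
  rw [ModelWithCorners.range_eq_univ, mfderivWithin_univ] at hinv
  have hs := hinv.surjective
  intro v
  obtain ⟨w, hw⟩ := hs v
  refine ⟨mfderiv (𝓡 (dimModuli n g)) (𝓡 m) (fun ζ => conjFib hβ k⁻¹ (S.sFib ζ)) η w, ?_⟩
  rw [← hw]
  exact (DFunLike.congr_fun hcomp w).symm

theorem isSmoothSubmersion_proj (hβ : β ∈ Subgroup.center (SU n))
    (hY : ∀ e ∈ atlas (EuclideanSpace ℝ (Fin m)) (Yfib n g β), IsEmbeddedChart Yfib.incl e)
    (hM : ∀ e ∈ atlas (EuclideanSpace ℝ (Fin (dimModuli n g))) (Moduli n g β),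
      ∃ (h : Yfib n g β) (S : Slice β h.1) (hS : S.Separating), e = modChart hβ hS) :
    IsSmoothSubmersion m (dimModuli n g) (Moduli.proj (n := n) (g := g) (t := β)) where
  surjective := Quotient.mk_surjective
  contMDiff := contMDiff_proj hβ hY hM
  surjective_mfderiv := surjective_mfderiv_proj hβ hY hM

end Submersion

/-! ### Tangent spaces of the fibre and of the orbits -/

section TangentSpaces

variable {n g m : ℕ} {β : SU n}

/-- Left translation `ξ ↦ h ξ` as a linear map. -/
def leftTranslateL (h : Y n g) :
    (Fin g × Fin 2 → su n) →ₗ[ℝ] (Fin g × Fin 2 → Mat n) where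
  toFun := leftTranslate h
  map_add' ξ ζ := by funext s; simp [leftTranslate, mul_add]
  map_smul' c ξ := by funext s; simp [leftTranslate]

theorem leftTranslate_injective (h : Y n g) : Function.Injective (leftTranslate h) := by
  intro ξ ζ e
  funext s
  refine Subtype.ext ?_
  have := congrArg (fun A => ((h s)⁻¹ : SU n).1 * A) (congrFun e s)
  simpa only [leftTranslate, ← mul_assoc, SU.coe_inv_mul, one_mul] using this

/-- The velocity of a curve in the fibre is `h ξ` with `ξ` in the kernel of the derivative of
`ε_R`. -/
theorem exists_leftTranslate_of_hasDerivAt {c : ℝ → Yfib n g β} {v : Fin g × Fin 2 → Mat n}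
    (hc : HasDerivAt (fun t => Yfib.incl (c t)) v 0) :
    ∃ ξ, v = leftTranslate (c 0).1 ξ ∧ dEval (c 0).1 ξ (surfaceRelation g) = 0 := by
  have hs : ∀ s, HasDerivAt (fun t => ((c t).1 s : Mat n)) (v s) 0 := hasDerivAt_pi.1 hc
  refine ⟨fun s => mcLeft fun t => (c t).1 s, ?_, ?_⟩
  · funext s
    change v s = ((c 0).1 s : Mat n) * ((((c 0).1 s)⁻¹ : SU n).1 * velocity fun t => (c t).1 s)
    rw [← mul_assoc, SU.coe_mul_inv, one_mul]
    exact (hs s).deriv.symm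
  · rw [← mcRight_eval (c := fun t => (c t).1) (fun s => (hs s).differentiableAt)]
    have e : (fun t => eval (surfaceRelation g) (c t).1) = fun _ => β := funext fun t => (c t).2
    rw [e]
    refine Subtype.ext ?_
    simp [mcRight, velocity]

theorem exists_leftTranslate_of_differentiableAt {H : Type} [NormedAddCommGroup H]
    [NormedSpace ℝ H] {f : H → Yfib n g β} {η : H}
    (hf : DifferentiableAt ℝ (fun η => Yfib.incl (f η)) η) (w : H) :
    ∃ ξ, fderiv ℝ (fun η => Yfib.incl (f η)) η w = leftTranslate (f η).1 ξ ∧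
      dEval (f η).1 ξ (surfaceRelation g) = 0 := by
  have hl : HasDerivAt (fun t : ℝ => η + t • w) w 0 := by
    simpa using ((hasDerivAt_id (0 : ℝ)).smul_const w).const_add η
  have h0 : η + (0 : ℝ) • w = η := by rw [zero_smul, add_zero]
  have h1 := HasFDerivAt.comp_hasDerivAt (x := (0 : ℝ)) (f := fun t : ℝ => η + t • w)
    (l := fun η => Yfib.incl (f η)) (l' := fderiv ℝ (fun η => Yfib.incl (f η)) η)
    (by rw [h0]; exact hf.hasFDerivAt) hl
  have h2 := exists_leftTranslate_of_hasDerivAt (c := fun t : ℝ => f (η + t • w)) h1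
  simpa only [h0] using h2

variable [ChartedSpace (EuclideanSpace ℝ (Fin m)) (Yfib n g β)]

variable (m) in
/-- The differential of the inclusion of the fibre, with the tangent spaces identified with
the model spaces. -/
def inclDeriv (y : Yfib n g β) :
    EuclideanSpace ℝ (Fin m) →L[ℝ] (Fin g × Fin 2 → Mat n) :=
  mfderiv (𝓡 m) 𝓘(ℝ, Fin g × Fin 2 → Mat n) Yfib.incl y

theorem injective_inclDeriv
    (hY : ∀ e ∈ atlas (EuclideanSpace ℝ (Fin m)) (Yfib n g β), IsEmbeddedChart Yfib.incl e)
    (y : Yfib n g β) : Function.Injective (inclDeriv m y) :=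
  injective_mfderiv_of_isEmbeddedChart hY isEmbedding_fibIncl.continuous y

theorem mdifferentiableAt_incl
    (hY : ∀ e ∈ atlas (EuclideanSpace ℝ (Fin m)) (Yfib n g β), IsEmbeddedChart Yfib.incl e)
    (y : Yfib n g β) :
    MDifferentiableAt (𝓡 m) 𝓘(ℝ, Fin g × Fin 2 → Mat n) Yfib.incl y :=
  (contMDiff_of_isEmbeddedChart hY isEmbedding_fibIncl.continuous y).mdifferentiableAt (by simp)

theorem exists_inclDeriv_eq_leftTranslate
    (hY : ∀ e ∈ atlas (EuclideanSpace ℝ (Fin m)) (Yfib n g β), IsEmbeddedChart Yfib.incl e)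
    (y : Yfib n g β) (u : EuclideanSpace ℝ (Fin m)) :
    ∃ ξ, inclDeriv m y u = leftTranslate y.1 ξ ∧ dEval y.1 ξ (surfaceRelation g) = 0 := by
  have hd := mdifferentiableAt_incl hY y
  have hy := (chartAt (EuclideanSpace ℝ (Fin m)) y).left_inv (mem_chart_source _ y)
  have h1 : DifferentiableAt ℝ
      (fun u => Yfib.incl ((chartAt (EuclideanSpace ℝ (Fin m)) y).symm u))
      (chartAt (EuclideanSpace ℝ (Fin m)) y y) :=
    ((hY _ (chart_mem_atlas _ y)).1.contDiffAt ((chartAt _ y).open_target.mem_nhds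
      ((chartAt _ y).map_source (mem_chart_source _ y)))).differentiableAt (by simp)
  obtain ⟨ξ, h2, h3⟩ := exists_leftTranslate_of_differentiableAt h1 u
  rw [hy] at h2 h3
  refine ⟨ξ, ?_, h3⟩
  rw [← h2, inclDeriv, mfderiv_eq_fderiv_chart hd]

/-- The tangent space of the fibre is the kernel of the derivative of `ε_R`. -/
theorem exists_inclDeriv_eq
    (hY : ∀ e ∈ atlas (EuclideanSpace ℝ (Fin m)) (Yfib n g β), IsEmbeddedChart Yfib.incl e)
    {y : Yfib n g β} (hsurj : Function.Surjective (dEvalL y.1 (surfaceRelation g)))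
    (hm : m + Module.finrank ℝ (su n) = Module.finrank ℝ (Fin g × Fin 2 → su n))
    {ξ : Fin g × Fin 2 → su n} (hξ : dEval y.1 ξ (surfaceRelation g) = 0) :
    ∃ u, inclDeriv m y u = leftTranslate y.1 ξ := by
  set D : EuclideanSpace ℝ (Fin m) →ₗ[ℝ] (Fin g × Fin 2 → Mat n) := (inclDeriv m y).toLinearMap
  set K := LinearMap.ker (dEvalL y.1 (surfaceRelation g)) with hK
  have hle : LinearMap.range D ≤ K.map (leftTranslateL y.1) := by
    rintro _ ⟨u, rfl⟩
    obtain ⟨ξ, h1, h2⟩ := exists_inclDeriv_eq_leftTranslate hY y u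
    exact ⟨ξ, h2, h1.symm⟩
  have hD : Module.finrank ℝ (LinearMap.range D) = m := by
    rw [LinearMap.finrank_range_of_inj (injective_inclDeriv hY y), finrank_euclideanSpace_fin]
  have hKr : Module.finrank ℝ (K.map (leftTranslateL y.1)) = Module.finrank ℝ K :=
    (Submodule.equivMapOfInjective _ (leftTranslate_injective y.1) _).finrank_eq.symm
  have hrn := LinearMap.finrank_range_add_finrank_ker (dEvalL y.1 (surfaceRelation g))
  rw [LinearMap.range_eq_top.2 hsurj, finrank_top, ← hK] at hrn
  have heq := Submodule.eq_of_le_of_finrank_eq hle (by rw [hD, hKr]; omega)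
  have : leftTranslate y.1 ξ ∈ LinearMap.range D := by
    rw [heq]; exact ⟨ξ, hξ, rfl⟩
  exact this

variable [ChartedSpace (EuclideanSpace ℝ (Fin (dimModuli n g))) (Moduli n g β)]

variable (m) in
/-- The differential of the quotient map, with the tangent spaces identified with the model
spaces. -/
def projDeriv (y : Yfib n g β) :
    EuclideanSpace ℝ (Fin m) →L[ℝ] EuclideanSpace ℝ (Fin (dimModuli n g)) :=
  mfderiv (𝓡 m) (𝓡 (dimModuli n g)) Moduli.proj y

/-- Orbit directions are tangent to the fibre, and are killed by the differential of the quotient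
map. -/
theorem exists_inclDeriv_eq_orbitDir (hβ : β ∈ Subgroup.center (SU n))
    (hY : ∀ e ∈ atlas (EuclideanSpace ℝ (Fin m)) (Yfib n g β), IsEmbeddedChart Yfib.incl e)
    (hM : ∀ e ∈ atlas (EuclideanSpace ℝ (Fin (dimModuli n g))) (Moduli n g β),
      ∃ (h : Yfib n g β) (S : Slice β h.1) (hS : S.Separating), e = modChart hβ hS)
    (y : Yfib n g β) (X : su n) :
    ∃ u, inclDeriv m y u = leftTranslate y.1 (orbitDir y.1 X) ∧ projDeriv m y u = 0 := by
  set c : ℝ → Yfib n g β := fun t => conjFib hβ (expSU (t • X)) y with hcdef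
  have hc0 : c 0 = y := by
    refine Subtype.ext ?_
    change conjY (expSU ((0 : ℝ) • X)) y.1 = y.1
    rw [zero_smul, expSU_zero, conjY_one]
  have hcs : ContDiff ℝ ∞ fun t => Yfib.incl (c t) := by
    refine contDiff_pi.2 fun s => ?_
    have h1 : ContDiff ℝ ∞ fun t : ℝ => (expSU (t • X) : Mat n) :=
      (contDiff_expSU.of_le le_top).comp (contDiff_id.smul contDiff_const)
    have h2 : ContDiff ℝ ∞ fun t : ℝ => (((expSU (t • X))⁻¹ : SU n) : Mat n) := by
      simp only [← expSU_neg]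
      exact (contDiff_expSU.of_le le_top).comp (contDiff_id.smul contDiff_const).neg
    exact (h1.mul contDiff_const).mul h2
  have hderiv : HasDerivAt (fun t => Yfib.incl (c t)) (leftTranslate y.1 (orbitDir y.1 X)) 0 := by
    refine hasDerivAt_pi.2 fun s => ?_
    have h1 := (hasDerivAt_conjY y.1 X s).const_mul (y.1 s : Mat n)
    have e : (fun t : ℝ => (y.1 s : Mat n) *
        (((y.1 s)⁻¹ * conjY (expSU (t • X)) y.1 s : SU n) : Mat n)) =
        fun t => Yfib.incl (c t) s := by
      funext t
      rw [Submonoid.coe_mul, ← mul_assoc, SU.coe_mul_inv, one_mul]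
      rfl
    rw [e] at h1
    exact h1
  have hcm : MDifferentiableAt 𝓘(ℝ, ℝ) (𝓡 m) c 0 :=
    (contMDiffAt_of_comp_incl hY isEmbedding_fibIncl hcs.contMDiff.contMDiffAt).mdifferentiableAt
      (by simp)
  refine ⟨mfderiv 𝓘(ℝ, ℝ) (𝓡 m) c 0 (1 : ℝ), ?_, ?_⟩
  · have h1 := mfderiv_comp (0 : ℝ) (mdifferentiableAt_incl hY (c 0)) hcm
    have h2 := DFunLike.congr_fun h1 (1 : ℝ)
    rw [mfderiv_eq_fderiv] at h2
    rw [hc0] at h2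
    refine Eq.trans h2.symm ?_
    have h3 : fderiv ℝ (Yfib.incl ∘ c) 0 (1 : ℝ) = _ := fderiv_eq_smul_deriv (f := Yfib.incl ∘ c) 1
    exact h3.trans ((one_smul ℝ _).trans hderiv.deriv)
  · have hq : MDifferentiableAt (𝓡 m) (𝓡 (dimModuli n g)) Moduli.proj (c 0) :=
      ((contMDiff_proj hβ hY hM).mdifferentiable (by simp)) _
    have h1 := mfderiv_comp (0 : ℝ) hq hcm
    have e : Moduli.proj ∘ c = fun _ => Moduli.proj y := by
      funext t
      exact proj_conjFib hβ _ y
    rw [e, mfderiv_const, hc0] at h1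
    exact (DFunLike.congr_fun h1 (1 : ℝ)).symm

/-- The kernel of the differential of the quotient map consists of the orbit directions. -/
theorem exists_orbitDir_of_projDeriv_eq_zero (hβ : β ∈ Subgroup.center (SU n))
    (hY : ∀ e ∈ atlas (EuclideanSpace ℝ (Fin m)) (Yfib n g β), IsEmbeddedChart Yfib.incl e)
    (hM : ∀ e ∈ atlas (EuclideanSpace ℝ (Fin (dimModuli n g))) (Moduli n g β),
      ∃ (h : Yfib n g β) (S : Slice β h.1) (hS : S.Separating), e = modChart hβ hS)
    {y : Yfib n g β} (hinj : Function.Injective (orbitDir y.1))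
    (hm : m = Module.finrank ℝ (su n) + dimModuli n g)
    {u : EuclideanSpace ℝ (Fin m)} (hu : projDeriv m y u = 0) :
    ∃ X, inclDeriv m y u = leftTranslate y.1 (orbitDir y.1 X) := by
  set D : EuclideanSpace ℝ (Fin m) →ₗ[ℝ] (Fin g × Fin 2 → Mat n) := (inclDeriv m y).toLinearMap
  set Q : EuclideanSpace ℝ (Fin m) →ₗ[ℝ] EuclideanSpace ℝ (Fin (dimModuli n g)) :=
    (projDeriv m y).toLinearMap
  set O : su n →ₗ[ℝ] (Fin g × Fin 2 → Mat n) := leftTranslateL y.1 ∘ₗ orbitDir y.1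
  have hO : Function.Injective O := (leftTranslate_injective y.1).comp hinj
  have hle : LinearMap.range O ≤ (LinearMap.ker Q).map D := by
    rintro _ ⟨X, rfl⟩
    obtain ⟨u, h1, h2⟩ := exists_inclDeriv_eq_orbitDir hβ hY hM y X
    exact ⟨u, h2, h1⟩
  have hrn := LinearMap.finrank_range_add_finrank_ker Q
  have hQ : Function.Surjective Q := surjective_mfderiv_proj hβ hY hM y
  rw [LinearMap.range_eq_top.2 hQ, finrank_top,
    finrank_euclideanSpace_fin, finrank_euclideanSpace_fin] at hrn
  have hK : Module.finrank ℝ ((LinearMap.ker Q).map D) = Module.finrank ℝ (LinearMap.ker Q) :=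
    (Submodule.equivMapOfInjective D (injective_inclDeriv hY y) _).finrank_eq.symm
  have heq := Submodule.eq_of_le_of_finrank_eq hle
    (by rw [hK, LinearMap.finrank_range_of_inj hO]; omega)
  have : D u ∈ LinearMap.range O := by
    rw [heq]; exact ⟨u, hu, rfl⟩
  obtain ⟨X, hX⟩ := this
  exact ⟨X, hX.symm⟩

end TangentSpaces

/-! ### Smoothness and invariance of `ω` -/

section Omega

variable {n g : ℕ}

theorem exists_su_projection (n : ℕ) : ∃ P : Mat n →L[ℝ] su n, ∀ X : su n, P X = X := by
  obtain ⟨P, hP⟩ := (su n).subtype.exists_leftInverse_of_injective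
    (LinearMap.ker_eq_bot.2 Subtype.val_injective)
  exact ⟨P.toContinuousLinearMap, fun X => LinearMap.congr_fun hP X⟩

theorem hasDerivAt_inclY_curve (h : Y n g) (ξ : Fin g × Fin 2 → su n) :
    HasDerivAt (fun t => inclY (curve h ξ t)) (leftTranslate h ξ) 0 :=
  hasDerivAt_pi.2 (hasDerivAt_curve h ξ)

/-- The pull-backs of the Maurer-Cartan forms under `eval w` extend to smooth 1-forms on the
space of tuples of matrices. -/
theorem exists_contDiff_mc (n : ℕ) (w : F g) :
    ∃ l r : (Fin g × Fin 2 → Mat n) → (Fin g × Fin 2 → Mat n) →L[ℝ] su n,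
      ContDiff ℝ ∞ l ∧ ContDiff ℝ ∞ r ∧ ∀ (h : Y n g) (ξ : Fin g × Fin 2 → su n),
        l (inclY h) (leftTranslate h ξ) = mcLeft (fun t => eval w (curve h ξ t)) ∧
        r (inclY h) (leftTranslate h ξ) = mcRight (fun t => eval w (curve h ξ t)) := by
  obtain ⟨P, hP⟩ := exists_su_projection n
  obtain ⟨f, hf, hfe⟩ := exists_contDiff_eval (g := g) n w
  have hf' : ContDiff ℝ ∞ f := hf.of_le le_top
  have hstar : ContDiff ℝ ∞ fun A => (f A).conjTranspose :=
    (starL' ℝ : Mat n ≃L[ℝ] Mat n).contDiff.comp hf'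
  have hfd : ∀ V, ContDiff ℝ ∞ fun A => fderiv ℝ f A V := fun V =>
    (hf.fderiv_right (m := ∞) le_top).clm_apply contDiff_const
  have hv : ∀ (h : Y n g) (ξ : Fin g × Fin 2 → su n), velocity (fun t => eval w (curve h ξ t)) =
      fderiv ℝ f (inclY h) (leftTranslate h ξ) := by
    intro h ξ
    have h1 : HasFDerivAt f (fderiv ℝ f (inclY h)) (inclY (curve h ξ 0)) := by
      rw [curve_zero]
      exact (hf'.differentiable (by simp) _).hasFDerivAt
    have h2 := (h1.comp_hasDerivAt (0 : ℝ) (hasDerivAt_inclY_curve h ξ)).deriv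
    rw [← h2, velocity]
    congr 1
    funext t
    exact (hfe _).symm
  refine ⟨fun A => P ∘L ContinuousLinearMap.mul ℝ (Mat n) (f A).conjTranspose ∘L fderiv ℝ f A,
    fun A => P ∘L (ContinuousLinearMap.mul ℝ (Mat n)).flip (f A).conjTranspose ∘L fderiv ℝ f A,
    contDiff_clm_apply_iff.2 fun V => P.contDiff.comp (hstar.mul (hfd V)),
    contDiff_clm_apply_iff.2 fun V => P.contDiff.comp ((hfd V).mul hstar), fun h ξ => ⟨?_, ?_⟩⟩
  · rw [← hP (mcLeft _)]
    simp only [mcLeft, curve_zero, hv]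
    change P ((f (inclY h)).conjTranspose * fderiv ℝ f (inclY h) (leftTranslate h ξ)) = _
    rw [hfe, SU.coe_inv]
  · rw [← hP (mcRight _)]
    simp only [mcRight, curve_zero, hv]
    change P (fderiv ℝ f (inclY h) (leftTranslate h ξ) * (f (inclY h)).conjTranspose) = _
    rw [hfe, SU.coe_inv]

/-- The 2-form `ω` extends to a smooth field of bilinear forms on the space of tuples of
matrices. -/
theorem exists_contDiff_omega (g : ℕ) (B : InvariantInnerProduct n) :
    ∃ W : (Fin g × Fin 2 → Mat n) → LinearMap.BilinForm ℝ (Fin g × Fin 2 → Mat n),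
      (ContDiff ℝ ∞ fun p : (Fin g × Fin 2 → Mat n) × (Fin g × Fin 2 → Mat n) ×
        (Fin g × Fin 2 → Mat n) => W p.1 p.2.1 p.2.2) ∧
      ∀ (h : Y n g) (ξ ζ : Fin g × Fin 2 → su n),
        W (inclY h) (leftTranslate h ξ) (leftTranslate h ζ) = omega B h ξ ζ := by
  choose l r hl hr hlr using fun w : F g => exists_contDiff_mc n w
  set b : su n →L[ℝ] su n →L[ℝ] ℝ := B.form.toContinuousBilinearMap with hb
  have hbs : ContDiff ℝ ∞ fun q : su n × su n => b q.1 q.2 := b.isBoundedBilinearMap.contDiff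
  set w1 : F g × F g → (Fin g × Fin 2 → Mat n) → LinearMap.BilinForm ℝ (Fin g × Fin 2 → Mat n) :=
    fun p A => B.form.compl₁₂ (l p.1 A).toLinearMap (r p.2 A).toLinearMap with hw1
  have hw : ∀ p A V V', w1 p A V V' = b (l p.1 A V) (r p.2 A V') := fun p A V V' => rfl
  have hwf : ∀ p A V V', (w1 p A).flip V V' = b (l p.1 A V') (r p.2 A V) := fun p A V V' => rfl
  have hWe : ∀ A V V', (∑ p ∈ (surfaceChain g).support, (surfaceChain g p : ℝ) •
      (w1 p A - (w1 p A).flip)) V V' = ∑ p ∈ (surfaceChain g).support, (surfaceChain g p : ℝ) *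
      (b (l p.1 A V) (r p.2 A V') - b (l p.1 A V') (r p.2 A V)) := by
    intro A V V'
    simp only [LinearMap.sum_apply, LinearMap.smul_apply, LinearMap.sub_apply,
      hw, hwf, smul_eq_mul]
  refine ⟨fun A => ∑ p ∈ (surfaceChain g).support, (surfaceChain g p : ℝ) •
    (w1 p A - (w1 p A).flip), ?_, ?_⟩
  · simp only [hWe]
    refine ContDiff.sum fun p _ => contDiff_const.mul ?_
    have hterm : ∀ i j : (Fin g × Fin 2 → Mat n) × (Fin g × Fin 2 → Mat n) ×
        (Fin g × Fin 2 → Mat n) → (Fin g × Fin 2 → Mat n), ContDiff ℝ ∞ i → ContDiff ℝ ∞ j →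
        ContDiff ℝ ∞ fun q => b (l p.1 q.1 (i q)) (r p.2 q.1 (j q)) := fun i j hi hj => by
      have h1 := ((hl p.1).comp contDiff_fst).clm_apply hi
      have h2 := ((hr p.2).comp contDiff_fst).clm_apply hj
      exact hbs.comp (h1.prodMk h2)
    exact (hterm _ _ contDiff_snd.fst contDiff_snd.snd).sub
      (hterm _ _ contDiff_snd.snd contDiff_snd.fst)
  · intro h ξ ζ
    rw [hWe]
    refine Finset.sum_congr rfl fun p _ => ?_
    rw [(hlr _ _ _).1, (hlr _ _ _).2, (hlr _ _ _).1, (hlr _ _ _).2]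
    rfl

theorem omega_swap (B : InvariantInnerProduct n) (h : Y n g) (ξ ζ : Fin g × Fin 2 → su n) :
    omega B h ξ ζ = -omega B h ζ ξ := by
  rw [omega_eq, omega_eq, neg_sub]

theorem adRep_conj_eval (k : SU n) (h : Y n g) (w : F g) (X : su n) :
    Ad (eval w (conjY k h)) (Ad k X) = Ad k (Ad (eval w h) X) := by
  rw [eval_conjY]
  simp only [← adRep_apply, map_mul, Module.End.mul_apply, Representation.inv_self_apply]

theorem dEval_conjY (k : SU n) (h : Y n g) (ξ : Fin g × Fin 2 → su n) (w : F g) :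
    dEval (conjY k h) (fun s => Ad k (ξ s)) w = Ad k (dEval h ξ w) := by
  have hc : IsCocycle (adRepOf (conjY k h)) fun w => Ad k (dEval h ξ w) := by
    intro v w
    simp only [adRepOf_apply, adRep_conj_eval, isCocycle_dEval h ξ v w]
    simp only [← adRep_apply, map_add]
  refine congrFun ((isCocycle_dEval _ _).ext hc fun s => ?_) w
  have := adRep_conj_eval k h (FreeGroup.of s) (ξ s)
  rw [eval_of, eval_of] at this
  rw [dEval_of, dEval_of, this]

/-- The 2-form `ω` is invariant under conjugation. -/
theorem omega_conjY (B : InvariantInnerProduct n) (k : SU n) (h : Y n g)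
    (ξ ζ : Fin g × Fin 2 → su n) :
    omega B (conjY k h) (fun s => Ad k (ξ s)) (fun s => Ad k (ζ s)) = omega B h ξ ζ := by
  refine Finsupp.sum_congr fun p _ => ?_
  rw [pullbackOmega_eq, pullbackOmega_eq]
  simp only [dEval_conjY, adRep_conj_eval, B.invariant]

theorem conjMat_leftTranslate (k : SU n) (h : Y n g) (ξ : Fin g × Fin 2 → su n) :
    conjMat k (leftTranslate h ξ) = leftTranslate (conjY k h) (fun s => Ad k (ξ s)) := by
  funext s
  simp only [conjMat, leftTranslate, conjY, Submonoid.coe_mul, coe_Ad, mul_assoc]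
  rw [← mul_assoc ((k⁻¹ : SU n) : Mat n) (k : Mat n), SU.coe_inv_mul, one_mul]

end Omega

/-! ### The 2-form on the moduli space -/

/-- A field of bilinear forms on the tangent spaces of a manifold is smooth if it has smooth
coefficients in every preferred chart. -/
theorem contMDiffAt_twoForm {d : ℕ} {M : Type} [TopologicalSpace M]
    [ChartedSpace (EuclideanSpace ℝ (Fin d)) M] [IsManifold (𝓡 d) ∞ M]
    {τ : ∀ x : M, TangentSpace (𝓡 d) x →L[ℝ] TangentSpace (𝓡 d) x →L[ℝ] ℝ} {x₀ : M}
    {G : EuclideanSpace ℝ (Fin d) → EuclideanSpace ℝ (Fin d) → EuclideanSpace ℝ (Fin d) → ℝ}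
    (hG : ∀ v w, ContDiffOn ℝ ∞ (fun η => G η v w) (chartAt (EuclideanSpace ℝ (Fin d)) x₀).target)
    (hτ : ∀ x ∈ (chartAt (EuclideanSpace ℝ (Fin d)) x₀).source, ∀ v w : EuclideanSpace ℝ (Fin d),
      τ x (mfderiv (𝓡 d) (𝓡 d) (extChartAt (𝓡 d) x₀).symm (chartAt _ x₀ x) v)
        (mfderiv (𝓡 d) (𝓡 d) (extChartAt (𝓡 d) x₀).symm (chartAt _ x₀ x) w) =
      G (chartAt _ x₀ x) v w) :
    ContMDiffAt (𝓡 d) ((𝓡 d).prod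
      𝓘(ℝ, EuclideanSpace ℝ (Fin d) →L[ℝ] EuclideanSpace ℝ (Fin d) →L[ℝ] ℝ)) ∞
    (fun x => TotalSpace.mk' (EuclideanSpace ℝ (Fin d) →L[ℝ] EuclideanSpace ℝ (Fin d) →L[ℝ] ℝ)
      (E := fun x : M => TangentSpace (𝓡 d) x →L[ℝ] TangentSpace (𝓡 d) x →L[ℝ] ℝ) x (τ x)) x₀ := by
  rw [contMDiffAt_section]
  set T : M → EuclideanSpace ℝ (Fin d) →L[ℝ] EuclideanSpace ℝ (Fin d) →L[ℝ] ℝ := fun x =>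
    (trivializationAt (EuclideanSpace ℝ (Fin d) →L[ℝ] EuclideanSpace ℝ (Fin d) →L[ℝ] ℝ)
      (fun x : M => TangentSpace (𝓡 d) x →L[ℝ] TangentSpace (𝓡 d) x →L[ℝ] ℝ) x₀ ⟨x, τ x⟩).2 with hT
  set e := chartAt (EuclideanSpace ℝ (Fin d)) x₀ with he
  have hTG : ∀ x ∈ e.source, ∀ v w, T x v w = G (e x) v w := by
    intro x hx v w
    rw [← hτ x hx v w]
    have hx' : x ∈ (trivializationAt (EuclideanSpace ℝ (Fin d)) (TangentSpace (𝓡 d)) x₀).baseSet :=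
      hx
    have h1 := TangentBundle.symmL_trivializationAt (I := 𝓡 d) hx
    rw [ModelWithCorners.range_eq_univ, mfderivWithin_univ] at h1
    have h2 := inCoordinates_apply_eq₂ (ϕ := τ x) (v := v) (w := w) hx' hx'
      (E₃ := fun _ => ℝ) (F₃ := ℝ) (by simp)
    have h3 := fun a => LinearMap.congr_fun (Bundle.Trivial.linearMapAt_trivialization ℝ M ℝ x) a
    refine (h2.trans (h3 _)).trans ?_
    rw [← Trivialization.symmL_apply (R := ℝ) _ hx', ← Trivialization.symmL_apply (R := ℝ) _ hx',
      h1]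
    rfl
  have hF : ContDiffOn ℝ ∞ (fun η => T (e.symm η)) e.target := by
    refine contDiffOn_clm_apply.2 fun v => contDiffOn_clm_apply.2 fun w => ?_
    refine (hG v w).congr fun η hη => ?_
    rw [hTG _ (e.map_target hη), e.right_inv hη]
  have hx := mem_chart_source (EuclideanSpace ℝ (Fin d)) x₀
  have h1 : ContMDiffAt (𝓡 d) 𝓘(ℝ, EuclideanSpace ℝ (Fin d) →L[ℝ] EuclideanSpace ℝ (Fin d) →L[ℝ] ℝ)
      ∞ (fun η => T (e.symm η)) (e x₀) :=
    (hF.contDiffAt (e.open_target.mem_nhds (e.map_source hx))).contMDiffAt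
  refine (h1.comp x₀ (contMDiffAt_extChartAt (I := 𝓡 d))).congr_of_eventuallyEq ?_
  filter_upwards [e.open_source.mem_nhds hx] with x hx
  change T x = T (e.symm (e x))
  rw [e.left_inv hx]

section ModuliForm

variable {n g m : ℕ} {β : SU n} [ChartedSpace (EuclideanSpace ℝ (Fin m)) (Yfib n g β)]

theorem conjMat_injective (k : SU n) : Function.Injective (conjMat (g := g) k) := by
  intro A A' e
  funext s
  have h1 := congrArg (fun M => ((k⁻¹ : SU n) : Mat n) * M * (k : Mat n)) (congrFun e s)
  have h2 : ∀ M : Mat n, ((k⁻¹ : SU n) : Mat n) * ((k : Mat n) * M * ((k⁻¹ : SU n) : Mat n)) *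
      (k : Mat n) = M := fun M => by
    rw [mul_assoc, mul_assoc _ ((k⁻¹ : SU n) : Mat n), SU.coe_inv_mul, mul_one, ← mul_assoc,
      SU.coe_inv_mul, one_mul]
  simpa only [conjMat, h2] using h1

theorem fderiv_conjMat (k : SU n) (A V : Fin g × Fin 2 → Mat n) :
    fderiv ℝ (conjMat k) A V = conjMat k V := by
  have h1 : HasFDerivAt (conjMat (g := g) k) _ A :=
    ((contDiff_conjMat (m := ∞) k).differentiable (by simp) A).hasFDerivAt
  have hl : HasDerivAt (fun t : ℝ => A + t • V) V 0 := by
    simpa using ((hasDerivAt_id (0 : ℝ)).smul_const V).const_add A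
  have h2 := HasFDerivAt.comp_hasDerivAt (x := (0 : ℝ)) (f := fun t : ℝ => A + t • V)
    (l := conjMat k) (l' := fderiv ℝ (conjMat k) A) (by simpa using h1) hl
  refine h2.unique (hasDerivAt_pi.2 fun s => ?_)
  exact (((hasDerivAt_pi.1 hl s).const_mul (k : Mat n)).mul_const ((k⁻¹ : SU n) : Mat n))

variable (m) in
/-- The differential of conjugation by `k` on the fibre, with the tangent spaces identified with
the model spaces. -/
def conjDeriv (hβ : β ∈ Subgroup.center (SU n)) (k : SU n) (y : Yfib n g β) :
    EuclideanSpace ℝ (Fin m) →L[ℝ] EuclideanSpace ℝ (Fin m) :=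
  mfderiv (𝓡 m) (𝓡 m) (conjFib (g := g) hβ k) y

theorem inclDeriv_conjDeriv (hβ : β ∈ Subgroup.center (SU n))
    (hY : ∀ e ∈ atlas (EuclideanSpace ℝ (Fin m)) (Yfib n g β), IsEmbeddedChart Yfib.incl e)
    (k : SU n) (y : Yfib n g β) (u : EuclideanSpace ℝ (Fin m)) :
    inclDeriv m (conjFib hβ k y) (conjDeriv m hβ k y u) = conjMat k (inclDeriv m y u) := by
  have hc : MDifferentiableAt (𝓡 m) (𝓡 m) (conjFib (g := g) hβ k) y :=
    ((contMDiff_conjFib hβ hY k).mdifferentiable (by simp)) y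
  have h1 := mfderiv_comp y (mdifferentiableAt_incl hY _) hc
  have hk : MDifferentiableAt 𝓘(ℝ, Fin g × Fin 2 → Mat n) 𝓘(ℝ, Fin g × Fin 2 → Mat n)
      (conjMat k) (Yfib.incl y) :=
    ((contDiff_conjMat (m := ∞) k).differentiable (by simp) _).mdifferentiableAt
  have h2 := mfderiv_comp y hk (mdifferentiableAt_incl hY y)
  have e : Yfib.incl ∘ conjFib hβ k = conjMat k ∘ Yfib.incl (n := n) (g := g) (t := β) := rfl
  rw [e, h2, mfderiv_eq_fderiv] at h1
  have h3 := DFunLike.congr_fun h1 u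
  refine h3.symm.trans ?_
  exact fderiv_conjMat k (Yfib.incl y) (inclDeriv m y u)

theorem conjDeriv_surjective (hβ : β ∈ Subgroup.center (SU n))
    (hY : ∀ e ∈ atlas (EuclideanSpace ℝ (Fin m)) (Yfib n g β), IsEmbeddedChart Yfib.incl e)
    (k : SU n) (y : Yfib n g β) : Function.Surjective (conjDeriv m hβ k y) := by
  have hinj : Function.Injective (conjDeriv m hβ k y).toLinearMap := by
    intro u v e
    have h1 := congrArg (inclDeriv m (conjFib hβ k y)) e
    change inclDeriv m (conjFib hβ k y) (conjDeriv m hβ k y u) =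
      inclDeriv m (conjFib hβ k y) (conjDeriv m hβ k y v) at h1
    rw [inclDeriv_conjDeriv hβ hY, inclDeriv_conjDeriv hβ hY] at h1
    exact injective_inclDeriv hY y (conjMat_injective k h1)
  exact LinearMap.injective_iff_surjective.1 hinj

/-- A pair of tangent vectors of the fibre is given by elements of the kernel of the differential of
`ε_R`, on which the ambient form `W` is `ω`. -/
theorem exists_form_inclDeriv
    (hY : ∀ e ∈ atlas (EuclideanSpace ℝ (Fin m)) (Yfib n g β), IsEmbeddedChart Yfib.incl e)
    {B : InvariantInnerProduct n}
    {W : (Fin g × Fin 2 → Mat n) → LinearMap.BilinForm ℝ (Fin g × Fin 2 → Mat n)}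
    (hW : ∀ (h : Y n g) (ξ ζ : Fin g × Fin 2 → su n),
      W (inclY h) (leftTranslate h ξ) (leftTranslate h ζ) = omega B h ξ ζ)
    (y : Yfib n g β) (u v : EuclideanSpace ℝ (Fin m)) :
    ∃ ξ ζ, inclDeriv m y u = leftTranslate y.1 ξ ∧ inclDeriv m y v = leftTranslate y.1 ζ ∧
      dEval y.1 ζ (surfaceRelation g) = 0 ∧
      W (Yfib.incl y) (inclDeriv m y u) (inclDeriv m y v) = omega B y.1 ξ ζ := by
  obtain ⟨ξ, h1, -⟩ := exists_inclDeriv_eq_leftTranslate hY y u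
  obtain ⟨ζ, h2, h3⟩ := exists_inclDeriv_eq_leftTranslate hY y v
  exact ⟨ξ, ζ, h1, h2, h3, by rw [h1, h2]; exact hW y.1 ξ ζ⟩

theorem form_inclDeriv_swap
    (hY : ∀ e ∈ atlas (EuclideanSpace ℝ (Fin m)) (Yfib n g β), IsEmbeddedChart Yfib.incl e)
    {B : InvariantInnerProduct n}
    {W : (Fin g × Fin 2 → Mat n) → LinearMap.BilinForm ℝ (Fin g × Fin 2 → Mat n)}
    (hW : ∀ (h : Y n g) (ξ ζ : Fin g × Fin 2 → su n),
      W (inclY h) (leftTranslate h ξ) (leftTranslate h ζ) = omega B h ξ ζ)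
    (y : Yfib n g β) (u v : EuclideanSpace ℝ (Fin m)) :
    W (Yfib.incl y) (inclDeriv m y u) (inclDeriv m y v) =
      -W (Yfib.incl y) (inclDeriv m y v) (inclDeriv m y u) := by
  obtain ⟨ξ, ζ, h1, h2, -, h3⟩ := exists_form_inclDeriv hY hW y u v
  rw [h3, omega_swap, h1, h2]
  exact congrArg Neg.neg (hW y.1 ζ ξ).symm

/-- The form on the fibre is invariant under conjugation. -/
theorem form_conjDeriv (hβ : β ∈ Subgroup.center (SU n))
    (hY : ∀ e ∈ atlas (EuclideanSpace ℝ (Fin m)) (Yfib n g β), IsEmbeddedChart Yfib.incl e)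
    {B : InvariantInnerProduct n}
    {W : (Fin g × Fin 2 → Mat n) → LinearMap.BilinForm ℝ (Fin g × Fin 2 → Mat n)}
    (hW : ∀ (h : Y n g) (ξ ζ : Fin g × Fin 2 → su n),
      W (inclY h) (leftTranslate h ξ) (leftTranslate h ζ) = omega B h ξ ζ)
    (k : SU n) (y : Yfib n g β) (u v : EuclideanSpace ℝ (Fin m)) :
    W (Yfib.incl (conjFib hβ k y)) (inclDeriv m (conjFib hβ k y) (conjDeriv m hβ k y u))
      (inclDeriv m (conjFib hβ k y) (conjDeriv m hβ k y v)) =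
      W (Yfib.incl y) (inclDeriv m y u) (inclDeriv m y v) := by
  obtain ⟨ξ, ζ, h1, h2, -, h3⟩ := exists_form_inclDeriv hY hW y u v
  rw [h3, inclDeriv_conjDeriv hβ hY, inclDeriv_conjDeriv hβ hY, h1, h2, conjMat_leftTranslate,
    conjMat_leftTranslate, ← omega_conjY B k]
  exact hW (conjY k y.1) _ _

variable [ChartedSpace (EuclideanSpace ℝ (Fin (dimModuli n g))) (Moduli n g β)]

theorem projDeriv_conjDeriv (hβ : β ∈ Subgroup.center (SU n))
    (hY : ∀ e ∈ atlas (EuclideanSpace ℝ (Fin m)) (Yfib n g β), IsEmbeddedChart Yfib.incl e)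
    (hM : ∀ e ∈ atlas (EuclideanSpace ℝ (Fin (dimModuli n g))) (Moduli n g β),
      ∃ (h : Yfib n g β) (S : Slice β h.1) (hS : S.Separating), e = modChart hβ hS)
    (k : SU n) (y : Yfib n g β) (u : EuclideanSpace ℝ (Fin m)) :
    projDeriv m (conjFib hβ k y) (conjDeriv m hβ k y u) = projDeriv m y u := by
  have hc : MDifferentiableAt (𝓡 m) (𝓡 m) (conjFib (g := g) hβ k) y :=
    ((contMDiff_conjFib hβ hY k).mdifferentiable (by simp)) y
  have hq : MDifferentiableAt (𝓡 m) (𝓡 (dimModuli n g)) Moduli.proj (conjFib hβ k y) :=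
    ((contMDiff_proj hβ hY hM).mdifferentiable (by simp)) _
  have h1 := mfderiv_comp y hq hc
  have e : Moduli.proj ∘ conjFib hβ k = Moduli.proj (n := n) (g := g) (t := β) :=
    funext fun z => proj_conjFib hβ k z
  rw [e] at h1
  exact (DFunLike.congr_fun h1 u).symm

/-- The form on the fibre is horizontal: vectors killed by the projection are orbit directions, which
are in the radical. -/
theorem form_eq_zero_of_projDeriv_eq_zero (hβ : β ∈ Subgroup.center (SU n))
    (hY : ∀ e ∈ atlas (EuclideanSpace ℝ (Fin m)) (Yfib n g β), IsEmbeddedChart Yfib.incl e)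
    (hM : ∀ e ∈ atlas (EuclideanSpace ℝ (Fin (dimModuli n g))) (Moduli n g β),
      ∃ (h : Yfib n g β) (S : Slice β h.1) (hS : S.Separating), e = modChart hβ hS)
    (hirr : ∀ h : Y n g, epsR h = β → HasTrivialStabilizer h)
    (hm : m = Module.finrank ℝ (su n) + dimModuli n g) {B : InvariantInnerProduct n}
    {W : (Fin g × Fin 2 → Mat n) → LinearMap.BilinForm ℝ (Fin g × Fin 2 → Mat n)}
    (hW : ∀ (h : Y n g) (ξ ζ : Fin g × Fin 2 → su n),
      W (inclY h) (leftTranslate h ξ) (leftTranslate h ζ) = omega B h ξ ζ)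
    {y : Yfib n g β} {u : EuclideanSpace ℝ (Fin m)} (hu : projDeriv m y u = 0)
    (v : EuclideanSpace ℝ (Fin m)) :
    W (Yfib.incl y) (inclDeriv m y u) (inclDeriv m y v) = 0 := by
  obtain ⟨ξ, ζ, h1, -, h2, h3⟩ := exists_form_inclDeriv hY hW y u v
  obtain ⟨X, hX⟩ := exists_orbitDir_of_projDeriv_eq_zero hβ hY hM
    (orbitDir_injective (hirr y.1 y.2)) hm hu
  rw [h3, leftTranslate_injective y.1 (h1.symm.trans hX), omega_orbitDir B y.1 X h2]

/-- The 2-form `ω` on the fibre descends to each tangent space of the moduli space: it vanishes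
on orbit directions and is invariant under conjugation. -/
theorem exists_descended_form (hβ : β ∈ Subgroup.center (SU n))
    (hY : ∀ e ∈ atlas (EuclideanSpace ℝ (Fin m)) (Yfib n g β), IsEmbeddedChart Yfib.incl e)
    (hM : ∀ e ∈ atlas (EuclideanSpace ℝ (Fin (dimModuli n g))) (Moduli n g β),
      ∃ (h : Yfib n g β) (S : Slice β h.1) (hS : S.Separating), e = modChart hβ hS)
    (hirr : ∀ h : Y n g, epsR h = β → HasTrivialStabilizer h)
    (hm : m = Module.finrank ℝ (su n) + dimModuli n g) {B : InvariantInnerProduct n}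
    {W : (Fin g × Fin 2 → Mat n) → LinearMap.BilinForm ℝ (Fin g × Fin 2 → Mat n)}
    (hW : ∀ (h : Y n g) (ξ ζ : Fin g × Fin 2 → su n),
      W (inclY h) (leftTranslate h ξ) (leftTranslate h ζ) = omega B h ξ ζ)
    (x : Moduli n g β) :
    ∃ τ : EuclideanSpace ℝ (Fin (dimModuli n g)) →L[ℝ]
        EuclideanSpace ℝ (Fin (dimModuli n g)) →L[ℝ] ℝ,
      (∀ v, τ v v = 0) ∧ ∀ y : Yfib n g β, Moduli.proj y = x → ∀ u v,
        τ (projDeriv m y u) (projDeriv m y v) =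
          W (Yfib.incl y) (inclDeriv m y u) (inclDeriv m y v) := by
  obtain ⟨y₀, rfl⟩ := Quotient.mk_surjective x
  have hsurj : Function.Surjective (projDeriv m y₀) := surjective_mfderiv_proj hβ hY hM y₀
  obtain ⟨r, hr⟩ := (projDeriv m y₀).toLinearMap.exists_rightInverse_of_surjective
    (LinearMap.range_eq_top.2 hsurj)
  have hr' : ∀ v, projDeriv m y₀ (r v) = v := fun v => LinearMap.congr_fun hr v
  set D := (inclDeriv m y₀).toLinearMap ∘ₗ r with hD
  have hswap := form_inclDeriv_swap hY hW y₀
  have key : ∀ u v, W (Yfib.incl y₀) (inclDeriv m y₀ (r (projDeriv m y₀ u))) (inclDeriv m y₀ v) =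
      W (Yfib.incl y₀) (inclDeriv m y₀ u) (inclDeriv m y₀ v) := by
    intro u v
    have h0 : projDeriv m y₀ (r (projDeriv m y₀ u) - u) = 0 := by rw [map_sub, hr', sub_self]
    have h1 := form_eq_zero_of_projDeriv_eq_zero hβ hY hM hirr hm hW h0 v
    rwa [map_sub, map_sub, LinearMap.sub_apply, sub_eq_zero] at h1
  have hy₀ : ∀ u v, W (Yfib.incl y₀) (inclDeriv m y₀ (r (projDeriv m y₀ u)))
      (inclDeriv m y₀ (r (projDeriv m y₀ v))) =
      W (Yfib.incl y₀) (inclDeriv m y₀ u) (inclDeriv m y₀ v) := by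
    intro u v
    rw [key, hswap, key, ← hswap]
  refine ⟨((W (Yfib.incl y₀)).compl₁₂ D D).toContinuousBilinearMap, fun v => ?_, fun y hy u v => ?_⟩
  · change W (Yfib.incl y₀) (inclDeriv m y₀ (r v)) (inclDeriv m y₀ (r v)) = 0
    have := hswap (r v) (r v)
    linarith
  · obtain ⟨k, hk⟩ := (proj_eq_iff hβ).1 hy.symm
    have hk' : conjFib hβ k y₀ = y := Subtype.ext hk
    subst hk'
    obtain ⟨u, rfl⟩ := conjDeriv_surjective hβ hY k y₀ u
    obtain ⟨v, rfl⟩ := conjDeriv_surjective hβ hY k y₀ v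
    rw [projDeriv_conjDeriv hβ hY hM, projDeriv_conjDeriv hβ hY hM, form_conjDeriv hβ hY hW]
    exact hy₀ u v

/-- A descended form is smooth: in the chart given by a slice `s`, its coefficients are those of
`s^*ω`. -/
theorem contMDiff_descended_form (hβ : β ∈ Subgroup.center (SU n))
    (hY : ∀ e ∈ atlas (EuclideanSpace ℝ (Fin m)) (Yfib n g β), IsEmbeddedChart Yfib.incl e)
    (hM : ∀ e ∈ atlas (EuclideanSpace ℝ (Fin (dimModuli n g))) (Moduli n g β),
      ∃ (h : Yfib n g β) (S : Slice β h.1) (hS : S.Separating), e = modChart hβ hS)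
    [IsManifold (𝓡 (dimModuli n g)) ∞ (Moduli n g β)]
    {W : (Fin g × Fin 2 → Mat n) → LinearMap.BilinForm ℝ (Fin g × Fin 2 → Mat n)}
    (hWs : ContDiff ℝ ∞ fun p : (Fin g × Fin 2 → Mat n) × (Fin g × Fin 2 → Mat n) ×
        (Fin g × Fin 2 → Mat n) => W p.1 p.2.1 p.2.2)
    {τ : ∀ x : Moduli n g β, TangentSpace (𝓡 (dimModuli n g)) x →L[ℝ]
      TangentSpace (𝓡 (dimModuli n g)) x →L[ℝ] ℝ}
    (hτ : ∀ (y : Yfib n g β) (u v : EuclideanSpace ℝ (Fin m)),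
      τ (Moduli.proj y) (projDeriv m y u) (projDeriv m y v) =
        W (Yfib.incl y) (inclDeriv m y u) (inclDeriv m y v)) :
    ContMDiff (𝓡 (dimModuli n g)) ((𝓡 (dimModuli n g)).prod
      𝓘(ℝ, EuclideanSpace ℝ (Fin (dimModuli n g)) →L[ℝ]
        EuclideanSpace ℝ (Fin (dimModuli n g)) →L[ℝ] ℝ)) ∞
    (fun x => TotalSpace.mk' (EuclideanSpace ℝ (Fin (dimModuli n g)) →L[ℝ]
        EuclideanSpace ℝ (Fin (dimModuli n g)) →L[ℝ] ℝ)
      (E := fun x : Moduli n g β => TangentSpace (𝓡 (dimModuli n g)) x →L[ℝ]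
        TangentSpace (𝓡 (dimModuli n g)) x →L[ℝ] ℝ) x (τ x)) := by
  intro x₀
  obtain ⟨h, S, hS, he⟩ := hM _ (chart_mem_atlas _ x₀)
  have htarget : (chartAt (EuclideanSpace ℝ (Fin (dimModuli n g))) x₀).target = S.dom := by
    rw [he]; rfl
  have hfd : ∀ v, ContDiffOn ℝ ∞ (fun η => fderiv ℝ (fun ζ => Yfib.incl (S.sFib ζ)) η v) S.dom :=
    fun v => (S.contDiffOn_sFib.fderiv_of_isOpen S.isOpen_dom (m := ∞) (by simp)).clm_apply
      contDiffOn_const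
  refine contMDiffAt_twoForm (G := fun η v w => W (Yfib.incl (S.sFib η))
    (fderiv ℝ (fun ζ => Yfib.incl (S.sFib ζ)) η v)
    (fderiv ℝ (fun ζ => Yfib.incl (S.sFib ζ)) η w)) (fun v w => ?_) (fun x hx v w => ?_)
  · rw [htarget]
    exact hWs.comp_contDiffOn (S.contDiffOn_sFib.prodMk ((hfd v).prodMk (hfd w)))
  · set η := chartAt (EuclideanSpace ℝ (Fin (dimModuli n g))) x₀ x with hη
    have hηS : η ∈ S.dom := by
      rw [← htarget]; exact (chartAt _ x₀).map_source hx
    have hs : MDifferentiableAt (𝓡 (dimModuli n g)) (𝓡 m) S.sFib η :=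
      (S.contMDiffAt_sFib hY hηS).mdifferentiableAt (by simp)
    have hq : MDifferentiableAt (𝓡 m) (𝓡 (dimModuli n g)) Moduli.proj (S.sFib η) :=
      (contMDiff_proj hβ hY hM _).mdifferentiableAt (by simp)
    have hx' : Moduli.proj (S.sFib η) = x := by
      rw [← modChart_symm hβ hS, ← he]
      exact (chartAt _ x₀).left_inv hx
    have hcomp := mfderiv_comp η hq hs
    have heq : Moduli.proj ∘ S.sFib = (extChartAt (𝓡 (dimModuli n g)) x₀).symm := by
      funext ζ
      simp only [extChartAt, he, Function.comp_apply, mfld_simps]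
      rw [modChart_symm]
    rw [heq] at hcomp
    have hincl := mfderiv_comp η (mdifferentiableAt_incl hY (S.sFib η)) hs
    rw [mfderiv_eq_fderiv] at hincl
    have h1 : ∀ v : EuclideanSpace ℝ (Fin (dimModuli n g)),
        mfderiv (𝓡 (dimModuli n g)) (𝓡 (dimModuli n g))
          (extChartAt (𝓡 (dimModuli n g)) x₀).symm η v =
        projDeriv m (S.sFib η) (mfderiv (𝓡 (dimModuli n g)) (𝓡 m) S.sFib η v) :=
      fun v => DFunLike.congr_fun hcomp v
    have h2 : ∀ v : EuclideanSpace ℝ (Fin (dimModuli n g)),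
        inclDeriv m (S.sFib η) (mfderiv (𝓡 (dimModuli n g)) (𝓡 m) S.sFib η v) =
        fderiv ℝ (fun ζ => Yfib.incl (S.sFib ζ)) η v :=
      fun v => (DFunLike.congr_fun hincl v).symm
    have h3 := hτ (S.sFib η) (mfderiv (𝓡 (dimModuli n g)) (𝓡 m) S.sFib η v)
      (mfderiv (𝓡 (dimModuli n g)) (𝓡 m) S.sFib η w)
    rw [h2, h2] at h3
    rw [← h3, ← hx']
    exact congrArg₂ (fun a b => τ (Moduli.proj (S.sFib η)) a b) (h1 v) (h1 w)

end ModuliForm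

/-! ### Smooth structures and nondegeneracy -/

section SmoothStructure

variable {n g : ℕ} {β : SU n}

/-- Orbit directions are tangent to the fibre over a central element. -/
theorem dEval_orbitDir_surfaceRelation (hn : 1 ≤ n)
    (hβ : Subgroup.zpowers β = Subgroup.center (SU n)) {h : Y n g} (hh : epsR h = β) (X : su n) :
    dEval h (orbitDir h X) (surfaceRelation g) = 0 := by
  have hβc : β ∈ Subgroup.center (SU n) := hβ ▸ Subgroup.mem_zpowers β
  obtain ⟨c, hc⟩ := eq_scalar_of_commute hn hβ hh (M := (β : Mat n)) fun s =>
    congrArg Subtype.val (Subgroup.mem_center_iff.1 hβc (h s))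
  have h1 : eval (surfaceRelation g) h = β := hh
  have h2 : (β : Mat n) * (X : Mat n) = (X : Mat n) * (β : Mat n) := by
    rw [hc, smul_mul_assoc, one_mul, mul_smul_comm, mul_one]
  rw [dEval_orbitDir]
  refine Subtype.ext ?_
  simp only [adRepOf_apply, h1, Submodule.coe_sub, coe_Ad]
  rw [h2, mul_assoc, SU.coe_mul_inv, mul_one, sub_self]
  rfl

theorem exists_separating_slice_fib (hn : 1 ≤ n) (B : InvariantInnerProduct n)
    (hβ : Subgroup.zpowers β = Subgroup.center (SU n)) (h : Yfib n g β) :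
    ∃ S : Slice β h.1, S.Separating := by
  obtain ⟨L⟩ := nonempty_logChart hn
  have hβc : β ∈ Subgroup.center (SU n) := hβ ▸ Subgroup.mem_zpowers β
  have hirr := hasTrivialStabilizer hn hβ h.2
  obtain ⟨S⟩ := nonempty_slice L hβc h.2 (dEvalL_surjective B hirr) (orbitDir_injective hirr)
    (dEval_orbitDir_surfaceRelation hn hβ h.2)
  exact exists_separating_slice L S fun k hk => mem_center_of_conj_eq hn hβ h.2 (congrFun hk)

theorem finrank_eq_dimModuli (hn : 1 ≤ n) (B : InvariantInnerProduct n)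
    (hβ : Subgroup.zpowers β = Subgroup.center (SU n)) (h : Yfib n g β) :
    Module.finrank ℝ (Fin g × Fin 2 → su n) = 2 * Module.finrank ℝ (su n) + dimModuli n g := by
  obtain ⟨L⟩ := nonempty_logChart hn
  have hβc : β ∈ Subgroup.center (SU n) := hβ ▸ Subgroup.mem_zpowers β
  have hirr := hasTrivialStabilizer hn hβ h.2
  exact (exists_slice_coordinates L h.2 (dEvalL_surjective B hirr) (orbitDir_injective hirr)
    (dEval_orbitDir_surfaceRelation hn hβ h.2)).1

end SmoothStructure

end TwistedModuli

end

theorem corollaryc5p5 (n g : ℕ) (hn : 1 ≤ n) (hg : 2 ≤ g) (B : InvariantInnerProduct n)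
    (β : SU n) (hβ : Subgroup.zpowers β = Subgroup.center (SU n)) :
    IsRegularValue (ExtModuli.incl (n := n) (g := g) (β := β)) momentMap 0 ∧
    T2Space (Moduli n g β) ∧ SecondCountableTopology (Moduli n g β) ∧
    ∃ (k : ℕ) (_ : ChartedSpace (EuclideanSpace ℝ (Fin k)) (Yfib n g β))
      (d : ℕ) (_ : ChartedSpace (EuclideanSpace ℝ (Fin d)) (Moduli n g β))
      (_ : IsManifold (𝓡 d) ∞ (Moduli n g β)),
      IsEmbeddedBy k (Yfib.incl (n := n) (g := g) (t := β)) ∧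
      IsSmoothSubmersion k d (Moduli.proj (n := n) (g := g) (t := β)) ∧
      ∃ σ : TwoForm d (Moduli n g β), IsInducedForm (k := k) B σ ∧ σ.Nondegenerate := by
  have hβc : β ∈ Subgroup.center (SU n) := hβ ▸ Subgroup.mem_zpowers β
  have hirr : ∀ h : Y n g, epsR h = β → HasTrivialStabilizer h := fun h hh =>
    hasTrivialStabilizer hn hβ hh
  obtain ⟨L⟩ := nonempty_logChart hn
  refine ⟨isRegularValue_momentMap L B hirr, t2Space_moduli hβc,
    secondCountableTopology_moduli hβc, ?_⟩
  choose S hS using fun h : Yfib n g β => exists_separating_slice_fib hn B hβ h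
  let _ : ChartedSpace (EuclideanSpace ℝ (Fin (Module.finrank ℝ
      (su n × EuclideanSpace ℝ (Fin (dimModuli n g)))))) (Yfib n g β) :=
    chartedSpaceOfCharts (fun h => fibChart hβc (S h)) fun h => mem_fibChart_source hβc (S h)
  have hout : ∀ x : Moduli n g β, Moduli.proj x.out = x := Quotient.out_eq
  let _ : ChartedSpace (EuclideanSpace ℝ (Fin (dimModuli n g))) (Moduli n g β) :=
    chartedSpaceOfCharts (fun x => modChart hβc (hS x.out)) fun x => by
      have := proj_mem_modChart_source hβc (hS x.out)
      rwa [hout] at this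
  have hm : Module.finrank ℝ (su n × EuclideanSpace ℝ (Fin (dimModuli n g))) =
      Module.finrank ℝ (su n) + dimModuli n g := by
    rw [Module.finrank_prod, finrank_euclideanSpace_fin]
  have hY : ∀ e ∈ atlas (EuclideanSpace ℝ (Fin (Module.finrank ℝ
      (su n × EuclideanSpace ℝ (Fin (dimModuli n g)))))) (Yfib n g β),
      IsEmbeddedChart Yfib.incl e := by
    rintro _ ⟨h, rfl⟩
    exact isEmbeddedChart_fibChart hβc (S h)
  have hM : ∀ e ∈ atlas (EuclideanSpace ℝ (Fin (dimModuli n g))) (Moduli n g β),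
      ∃ (h : Yfib n g β) (S : Slice β h.1) (hS : S.Separating), e = modChart hβc hS := by
    rintro _ ⟨x, rfl⟩
    exact ⟨_, _, hS x.out, rfl⟩
  have hman := isManifold_moduli hβc hM
  obtain ⟨W, hWs, hW⟩ := exists_contDiff_omega g B
  choose τ hτalt hτ using fun x => exists_descended_form hβc hY hM hirr hm hW x
  have hτ' : ∀ (y : Yfib n g β) u v,
      τ (Moduli.proj y) (projDeriv _ y u) (projDeriv _ y v) =
        W (Yfib.incl y) (inclDeriv _ y u) (inclDeriv _ y v) := fun y => hτ _ y rfl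
  refine ⟨_, inferInstance, dimModuli n g, inferInstance, hman,
    isEmbeddedBy_of_isEmbeddedChart hY isEmbedding_fibIncl, isSmoothSubmersion_proj hβc hY hM,
    ⟨τ, hτalt, contMDiff_descended_form hβc hY hM hWs hτ'⟩, ?_, ?_⟩
  · intro y u v
    obtain ⟨ξ, ζ, h1, h2, -, h3⟩ := exists_form_inclDeriv hY hW y u v
    exact ⟨ξ, ζ, h1, h2, (hτ' y u v).trans h3⟩
  · intro x v hv
    obtain ⟨y, rfl⟩ := Quotient.mk_surjective x
    obtain ⟨u, rfl⟩ := surjective_mfderiv_proj hβc hY hM y v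
    have hfin := finrank_eq_dimModuli hn B hβ y
    obtain ⟨ξ, h1, h2⟩ := exists_inclDeriv_eq_leftTranslate hY y u
    -- `ω` pairs `ξ` to zero with the whole tangent space of the fibre
    have hω : ∀ ζ, dEval y.1 ζ (surfaceRelation g) = 0 → omega B y.1 ξ ζ = 0 := by
      intro ζ hζ
      obtain ⟨w, hw⟩ := exists_inclDeriv_eq hY (dEvalL_surjective B (hirr y.1 y.2))
        (by omega) hζ
      have h3 := (hτ' y u w).symm.trans (hv (projDeriv _ y w))
      rw [h1, hw] at h3
      exact (hW y.1 ξ ζ).symm.trans h3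
    obtain ⟨X, hX⟩ := exists_eq_orbitDir B (hirr y.1 y.2) h2 hω
    obtain ⟨u', h3, h4⟩ := exists_inclDeriv_eq_orbitDir hβc hY hM y X
    have h5 : u = u' := injective_inclDeriv hY y (by rw [h1, h3, hX])
    rw [h5]
    exact h4
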